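/- **Proposition 3.4.** Let $X=(X_t)_{t\ge 0}$ be a real-valued Lévy process with $X_0=0$ on a probability space $(\Omega,\mathcal F,\mathbb P)$, with $\mathbb E[e^{i\lambda X_t}]=e^{-t\Psi(\lambda)}$, where $$\Psi(\lambda)=-i\gamma\lambda+\tfrac12\sigma^2\lambda^2+\int_{\mathbb R\setminus\{0\}}\bigl(1-e^{i\lambda z}+i\lambda z1_{\{|z|<1\}}\bigr)\,\Pi(dz),$$ $\gamma\in\mathbb R$, $\sigma\ge 0$, and the Lévy measure $\Pi$ satisfies $\int(1\wedge z^2)\,\Pi(dz)<\infty$. Assume that $X$ is not a driftless compound Poisson process (the zero process counts as one) and that $\int_{\mathbb R\setminus(-1,1)}e^{\bar\theta|z|}\,\Pi(dz)<\infty$ for some $\bar\theta>0$. Let $0=T(0)<T(1)<T(2)<\cdots$, where $T(1),T(2),\dots$ are the arrival times of a Poisson process with intensity $\eta>0$ that is independent of $X$. Let $q>0$ and $C\in\mathbb R$, and let $f:\mathbb R\to\mathbb R$ be convex with $|f(x)|\le k_1+k_2|x|^N$ for all $x$, for some constants $k_1,k_2$ and $N\in\mathbb N$, and with right derivative $f'_+$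 satisfying $\lim_{x\to-\infty}f'_+(x)<-Cq<\lim_{x\to\infty}f'_+(x)$ (limits in $[-\infty,\infty]$). For $x\in\mathbb R$ write $\mathbb E_x$ for the expectation when $X$ is replaced by $x+X$. Fix $b\in\mathbb R$. The periodic barrier strategy at $b$ has the control times $T_b^{(0)}=0$ and, for $n\ge1$, $$T_b^{(n)}=\inf\bigl\{t\in\{T(k):k\ge 1\}:\ t>T_b^{(n-1)},\ \tilde X^{(n-1)}_t<b\bigr\}\quad(\inf\varnothing=\infty),$$ where $\tilde X^{(0)}_t=X_t$ and $\tilde X^{(m)}_t=b+X_t-X_{T_b^{(m)}}$ for $m\ge1$. Put $$R^b_t=\sum_{n\ge1}\bigl(b-\tilde X^{(n-1)}_{T_b^{(n)}}\bigr)1_{\{T_b^{(n)}\le t\}},\qquad U^b_t=X_t+R^b_t,$$ $$v_b(x)=\mathbb E_x\Bigl[\int_0^\infty e^{-qt}f(U^b_t)\,dt+C\int_{[0,\infty)}e^{-qt}\,dR^b_t\Bigr],$$ and $T_b:=T_b^{(1)}$. Then, for every $b\in\mathbb R$ and every $x\in\mathbb R$, $$\mathbb E_x\Bigl[\int_0^\infty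 e^{-qt}|f(U^b_t)|\,dt+\int_{[0,\infty)}e^{-qt}\,dR^b_t\Bigr]<\infty,\qquad \mathbb E_x\Bigl[\int_0^{T_b}e^{-qt}|f'_+(X_t)|\,dt\Bigr]<\infty,$$ the function $v_b$ is continuously differentiable on $\mathbb R$, and $$v_b'(x)=\mathbb E_x\Bigl[\int_0^{T_b}e^{-qt}f'_+(X_t)\,dt\Bigr]-C\,\mathbb E_x\bigl[e^{-qT_b}\bigr],\qquad x\in\mathbb R,$$ with $e^{-q\infty}=0$. -/

import Mathlib

open MeasureTheory ProbabilityTheory Filter Topology Set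
open scoped NNReal ENNReal

/-! ### Lévy processes and their characteristics -/

/-- Right-continuous with left limits (at time `0` the left limit condition is empty). -/
def IsCadlag (w : ℝ≥0 → ℝ) : Prop :=
  ∀ t, ContinuousWithinAt w (Ici t) t ∧ ∃ l, Tendsto w (𝓝[<] t) (𝓝 l)

/-- `X` is a real Lévy process started at `0` under `P`. -/
structure IsLevyProcess {Ω : Type*} [MeasurableSpace Ω] (X : ℝ≥0 → Ω → ℝ) (P : Measure Ω) :
    Prop where
  measurable : ∀ t, Measurable (X t)
  start_zero : ∀ᵐ ω ∂P, X 0 ω = 0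
  cadlag : ∀ᵐ ω ∂P, IsCadlag (fun t => X t ω)
  indep_increments : HasIndepIncrements X P
  stationary_increments : ∀ s t : ℝ≥0,
    P.map (fun ω => X (s + t) ω - X s ω) = P.map (X t)

/-- Lévy measures on `ℝ \ {0}`, viewed as measures on `ℝ` without mass at `0`. -/
structure IsLevyMeasure (ν : Measure ℝ) : Prop where
  zero : ν {0} = 0
  lintegral_lt_top : ∫⁻ z, ENNReal.ofReal (min 1 (z ^ 2)) ∂ν < ⊤

/-- The Lévy-Khintchine exponent
`Ψ(u) = -iγu + σ²u²/2 + ∫ (1 - e^{iuz} + iuz 1_{|z|<1}) ν(dz)`. -/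
noncomputable def levyExponent (γ σ : ℝ) (ν : Measure ℝ) (u : ℝ) : ℂ :=
  -(Complex.I * γ * u) + (1 / 2 : ℂ) * (σ : ℂ) ^ 2 * (u : ℂ) ^ 2
    + ∫ z : ℝ, (1 - Complex.exp (Complex.I * u * z)
        + indicator {z : ℝ | |z| < 1} (fun z : ℝ => Complex.I * u * z) z) ∂ν

/-- `(γ, σ, ν)` are the drift parameter, the Gaussian coefficient and the Lévy measure of `X`:
`E[e^{iuX_t}] = e^{-tΨ(u)}` with `Ψ` the exponent above. -/
structure HasLevyTriplet {Ω : Type*} [MeasurableSpace Ω] (X : ℝ≥0 → Ω → ℝ) (P : Measure Ω)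
    (γ σ : ℝ) (ν : Measure ℝ) : Prop where
  sigma_nonneg : 0 ≤ σ
  levyMeasure : IsLevyMeasure ν
  charFun_eq : ∀ (t : ℝ≥0) (u : ℝ),
    charFun (P.map (X t)) u = Complex.exp (-((t : ℝ) : ℂ) * levyExponent γ σ ν u)

/-- For a Lévy process `X`: `X` is a driftless compound Poisson process, that is, `X_t` has a
compound Poisson law `E[e^{iuX_t}] = exp (-t ∫ (1 - e^{iuz}) ρ(dz))`, where the finite measure
`ρ` is the jump rate times the jump law. The process that is identically zero (`ρ = 0`) is
included. -/
def IsDriftlessCompoundPoisson {Ω : Type*} [MeasurableSpace Ω] (X : ℝ≥0 → Ω → ℝ)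
    (P : Measure Ω) : Prop :=
  ∃ ρ : Measure ℝ, IsFiniteMeasure ρ ∧ ∀ (t : ℝ≥0) (u : ℝ),
    charFun (P.map (X t)) u
      = Complex.exp (-((t : ℝ) : ℂ) * ∫ z : ℝ, (1 - Complex.exp (Complex.I * u * z)) ∂ρ)

/-- `T 1, T 2, …` are the arrival times of a Poisson process with intensity `η`: with `T 0 = 0`,
the interarrival times are independent and exponentially distributed with rate `η`. -/
structure IsPoissonArrivals {Ω : Type*} [MeasurableSpace Ω] (T : ℕ → Ω → ℝ≥0) (η : ℝ)
    (P : Measure Ω) : Prop where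
  measurable : ∀ k, Measurable (T k)
  zero : ∀ᵐ ω ∂P, T 0 ω = 0
  indep : iIndepFun (fun (k : ℕ) (ω : Ω) => (T (k + 1) ω : ℝ) - (T k ω : ℝ)) P
  law : ∀ k, P.map (fun ω => (T (k + 1) ω : ℝ) - (T k ω : ℝ)) = expMeasure η

/-! ### The running cost -/

/-- The right derivative `f'_+`. -/
noncomputable def rightDerivative (f : ℝ → ℝ) (x : ℝ) : ℝ := derivWithin f (Ioi x) x

/-- Assumptions on the running cost `f`, the unit cost/reward `C` and the discount rate `q`. -/
structure IsAdmissibleCost (f : ℝ → ℝ) (C q : ℝ) : Prop where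
  convex : ConvexOn ℝ univ f
  growth : ∃ (k₁ k₂ : ℝ) (N : ℕ), ∀ x, |f x| ≤ k₁ + k₂ * |x| ^ N
  slope_atBot : ∃ l : EReal,
    Tendsto (fun x => (rightDerivative f x : EReal)) atBot (𝓝 l) ∧ l < ((-C * q : ℝ) : EReal)
  slope_atTop : ∃ l : EReal,
    Tendsto (fun x => (rightDerivative f x : EReal)) atTop (𝓝 l) ∧ ((-C * q : ℝ) : EReal) < l

/-! ### The periodic barrier strategy, path by path

`w` is a path of the uncontrolled process (with its starting value), `τ 1, τ 2, …` are the
control opportunities and `b` is the barrier. -/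

/-- The path `X̃^{(m),b}`, given the `m`-th control time `S`: the uncontrolled path for `m = 0`,
and for `m ≥ 1` its parallel shift that is at `b` at time `S`. -/
noncomputable def shiftedPath (w : ℝ≥0 → ℝ) (b : ℝ) (m : ℕ) (S : ℝ≥0∞) (t : ℝ≥0) : ℝ :=
  if m = 0 then w t else b + (w t - w S.toNNReal)

/-- The control times `T_b^{(n)}`: `T_b^{(0)} = 0`, and `T_b^{(n+1)}` is the infimum (`∞` if there
is none) of the control opportunities after `T_b^{(n)}` at which `X̃^{(n),b}` is below `b`. -/
noncomputable def controlTime (w : ℝ≥0 → ℝ) (τ : ℕ → ℝ≥0) (b : ℝ) : ℕ → ℝ≥0∞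
  | 0 => 0
  | n + 1 => sInf {s : ℝ≥0∞ | ∃ k : ℕ, 1 ≤ k ∧ s = (τ k : ℝ≥0∞) ∧ controlTime w τ b n < s ∧
      shiftedPath w b n (controlTime w τ b n) (τ k) < b}

/-- The amount `b - X̃^{(n),b}` (evaluated at `T_b^{(n+1)}`) that is added at the control time
`T_b^{(n+1)}`; only used when this time is finite. -/
noncomputable def controlSize (w : ℝ≥0 → ℝ) (τ : ℕ → ℝ≥0) (b : ℝ) (n : ℕ) : ℝ :=
  b - shiftedPath w b n (controlTime w τ b n) (controlTime w τ b (n + 1)).toNNReal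

/-- The cumulative control `R^b_t`. -/
noncomputable def barrierControl (w : ℝ≥0 → ℝ) (τ : ℕ → ℝ≥0) (b : ℝ) (t : ℝ≥0) : ℝ :=
  open Classical in
  ∑' n : ℕ, if controlTime w τ b (n + 1) ≤ (t : ℝ≥0∞) then controlSize w τ b n else 0

/-- The controlled path `U^b_t = X_t + R^b_t`. -/
noncomputable def controlledPath (w : ℝ≥0 → ℝ) (τ : ℕ → ℝ≥0) (b : ℝ) (t : ℝ≥0) : ℝ :=
  w t + barrierControl w τ b t

/-- The measure `dR^b` on `[0, ∞)` of the step function `R^b`: it has the mass of the jump of `R^b`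
at each finite control time. -/
noncomputable def controlMeasure (w : ℝ≥0 → ℝ) (τ : ℕ → ℝ≥0) (b : ℝ) : Measure ℝ≥0 :=
  open Classical in
  Measure.sum fun n : ℕ =>
    if controlTime w τ b (n + 1) = ⊤ then 0
    else ENNReal.ofReal (controlSize w τ b n)
      • Measure.dirac (controlTime w τ b (n + 1)).toNNReal

/-! ### Costs -/

/-- The discount factor `e^{-qs}` at a time `s ∈ [0, ∞]`, with `e^{-q∞} = 0`. -/
noncomputable def discount (q : ℝ) (s : ℝ≥0∞) : ℝ :=
  open Classical in
  if s = ⊤ then 0 else Real.exp (-q * s.toReal)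

/-- The expected total cost
`v_b(x) = E_x[∫_0^∞ e^{-qt} f(U^b_t) dt + C ∫_{[0,∞)} e^{-qt} dR^b_t]`;
under `P_x` the uncontrolled process is `x + X`. -/
noncomputable def barrierCost {Ω : Type*} [MeasurableSpace Ω] (P : Measure Ω)
    (X : ℝ≥0 → Ω → ℝ) (T : ℕ → Ω → ℝ≥0) (f : ℝ → ℝ) (C q b x : ℝ) : ℝ :=
  ∫ ω, ((∫ t in Ici (0 : ℝ), Real.exp (-q * t)
            * f (controlledPath (fun s => x + X s ω) (fun k => T k ω) b t.toNNReal))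
        + C * ∫ t : ℝ≥0, Real.exp (-q * t)
            ∂(controlMeasure (fun s => x + X s ω) (fun k => T k ω) b)) ∂P

/-- `E_x[∫_0^∞ e^{-qt} |f(U^b_t)| dt + ∫_{[0,∞)} e^{-qt} dR^b_t]`, as an element of `[0, ∞]`. -/
noncomputable def absBarrierCost {Ω : Type*} [MeasurableSpace Ω] (P : Measure Ω)
    (X : ℝ≥0 → Ω → ℝ) (T : ℕ → Ω → ℝ≥0) (f : ℝ → ℝ) (q b x : ℝ) : ℝ≥0∞ :=
  ∫⁻ ω, ((∫⁻ t in Ici (0 : ℝ), ENNReal.ofReal (Real.exp (-q * t)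
            * |f (controlledPath (fun s => x + X s ω) (fun k => T k ω) b t.toNNReal)|))
        + ∫⁻ t : ℝ≥0, ENNReal.ofReal (Real.exp (-q * t))
            ∂(controlMeasure (fun s => x + X s ω) (fun k => T k ω) b)) ∂P

/-- The first control time `T_b` under `P_x`. -/
noncomputable def firstControlTime {Ω : Type*} (X : ℝ≥0 → Ω → ℝ) (T : ℕ → Ω → ℝ≥0)
    (b x : ℝ) (ω : Ω) : ℝ≥0∞ :=
  controlTime (fun s => x + X s ω) (fun k => T k ω) b 1

/-- The time interval `[0, S)` for `S ∈ [0, ∞]`, as a set of real numbers. -/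
def timesBefore (S : ℝ≥0∞) : Set ℝ := {t : ℝ | 0 ≤ t ∧ ENNReal.ofReal t < S}

/-! Path by path, the barrier strategy has an explicit form. A control happens exactly when the
uncontrolled path, seen at the observation times, goes below `b` and below all earlier observed
values. Hence `R_t` is the positive part of `b - x - m_t`, with `m_t` the minimum of `X` over the
observation times up to `t` (`barrierControl_shift`). As a function of `x`, the control is `0` while
`t < T_b` and has slope `-1` afterwards, whereas `U_t` has slope `1` before `T_b` and does not
depend on `x` afterwards. Tonelli turns the control cost into `∫ q e^{-qt} R_t dt`
(`lintegral_controlMeasure`), so that the total cost is one integral over `Ω × [0, ∞)`. Its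
integrand has derivative `e^{-qt} f'_+(x + X_t)` for `t < T_b` and `-C q e^{-qt}` for `t ≥ T_b`; the
second part integrates to `-C e^{-q T_b}`.

Differentiating under the integral sign, and continuity of the derivative, need two facts, collected
in `IsRegularPair`.

Domination: a convex function of polynomial growth has slopes of polynomial growth, so discounted
moments of `X` and of `R` suffice. The law `m_q` of `X` at an independent exponential time has
characteristic function `q / (q + Ψ)`. The exponential moment of the Lévy measure makes `Ψ` smooth
(`contDiff_levyExponent`), and smoothness of a characteristic function at `0` gives all moments
(`integrable_even_pow_of_contDiffAt_charFun`). The arrival times have mean measure `η dt`, which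
carries the moments over to the observed values and thus to the running maximum `R`
(`IsPoissonArrivals.tsum_lintegral_le`).

Almost everywhere differentiability at a fixed `x`: one must avoid `x + X_t` in the countable set of
discontinuities of `f'_+`, and `x + X_{T(k)} = b`. Both events are null if `m_q` has no atoms. An
atom of `m_q` forces `Ψ` to be bounded (`exists_bound_of_resolvent_atom`), and a bounded exponent is
that of a driftless compound Poisson process (`levyExponent_eq_of_bound`), which is excluded. -/

section CharacteristicFunctions

open scoped ContDiff

/-! ### Moments from smoothness of the characteristic function -/

/-- Since `2 - 2 cos (hx) = 2 - e^{ihx} - e^{-ihx}`, a nonnegative integrand is tied to the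
characteristic function. Small `h` yields second moments, and `h = π / z` yields bounds for the atom
at `z`. -/
theorem integral_two_sub_two_cos_eq (μ : Measure ℝ) [IsFiniteMeasure μ] (h : ℝ) :
    ((∫ x, (2 - 2 * Real.cos (h * x)) ∂μ : ℝ) : ℂ)
      = 2 * charFun μ 0 - charFun μ h - charFun μ (-h) := by
  have hint : ∀ t : ℝ, Integrable (fun x : ℝ => Complex.exp (t * x * Complex.I)) μ := fun t =>
    (integrable_const (1 : ℝ)).mono' (by fun_prop)
      (ae_of_all _ fun x => by rw [← Complex.ofReal_mul, Complex.norm_exp_ofReal_mul_I])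
  rw [← integral_complex_ofReal]
  simp only [charFun_apply_real]
  rw [← integral_const_mul, ← integral_sub, ← integral_sub]
  · congr 1 with x
    have h1 : Complex.exp (h * x * Complex.I) + Complex.exp ((-h : ℝ) * x * Complex.I)
        = 2 * Complex.cos (h * x) := by
      rw [Complex.two_cos]; congr 2; push_cast; ring
    push_cast at h1 ⊢
    simp only [zero_mul, Complex.exp_zero]
    linear_combination h1
  · exact ((hint 0).const_mul 2).sub (hint h)
  · exact hint _
  · exact (hint 0).const_mul 2
  · exact hint _

/-- The sum `φ h + φ (-h)` is even and `C²`, so its derivative vanishes at `0` and is `O(h)`; the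
mean value inequality then gives `O(h²)`. -/
theorem exists_bound_symmetric_difference {φ : ℝ → ℂ} (hφ : ContDiffAt ℝ 2 φ 0) :
    ∃ K : ℝ, 0 ≤ K ∧ ∀ᶠ h in 𝓝 (0 : ℝ), ‖2 * φ 0 - φ h - φ (-h)‖ ≤ K * h ^ 2 := by
  set g : ℝ → ℂ := fun h => φ h + φ (-h) with hg
  have hgc : ContDiffAt ℝ 2 g 0 := by
    apply hφ.add
    have : ContDiffAt ℝ 2 φ (-0) := by simpa using hφ
    exact this.comp (0 : ℝ) contDiff_neg.contDiffAt
  have hd1 : ∀ᶠ u in 𝓝 (0 : ℝ), DifferentiableAt ℝ g u := by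
    have := (hgc.eventually (by norm_num)).mono fun u hu => hu.differentiableAt (by simp)
    exact this
  have hd2 : DifferentiableAt ℝ (deriv g) 0 := by
    have := (hgc.derivWithin (m := 1) (by norm_num)).differentiableAt (by simp)
    simpa using this
  have h0 : deriv g 0 = 0 := by
    have he : g ∘ Neg.neg = g := by ext h; simp [hg, add_comm]
    have h1 := deriv_comp_neg (f := g) (x := 0)
    have h2 : (fun x => g (-x)) = g := he
    rw [h2] at h1
    simp only [neg_zero] at h1
    exact self_eq_neg.mp h1
  obtain ⟨K, hK⟩ := (hd2.hasDerivAt.isBigO_sub).bound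
  refine ⟨max K 0, le_max_right _ _, ?_⟩
  simp only [h0, sub_zero] at hK
  obtain ⟨ε, hε, hb⟩ := Metric.eventually_nhds_iff_ball.mp (hK.and hd1)
  filter_upwards [Metric.ball_mem_nhds (0 : ℝ) hε] with h hh
  have hsub : Metric.closedBall (0 : ℝ) |h| ⊆ Metric.ball 0 ε :=
    Metric.closedBall_subset_ball (by simpa using hh)
  have := (convex_closedBall (0 : ℝ) |h|).norm_image_sub_le_of_norm_deriv_le (f := g)
    (C := max K 0 * |h|) (x := 0) (y := h) (fun u hu => (hb u (hsub hu)).2)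
    (fun u hu => ((hb u (hsub hu)).1).trans ?_) (by simp) (by simp)
  · have e : ‖2 * φ 0 - φ h - φ (-h)‖ = ‖g h - g 0‖ := by
      rw [← norm_neg]; congr 1; simp only [hg, neg_zero]; ring
    rw [e]
    refine this.trans (le_of_eq ?_)
    simp only [sub_zero, Real.norm_eq_abs]
    rw [mul_assoc, ← sq, sq_abs]
  · have : |u| ≤ |h| := by simpa using hu
    simp only [Real.norm_eq_abs]
    gcongr
    exact le_max_left _ _

/-- Fatou's lemma along `h = 1 / (n + 1)`: the integrals of `(2 - 2 cos (hx)) / h²` stay bounded by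
the symmetric difference estimate, and the integrand is at least `4 x² / π²` as soon as `|hx| ≤ π`.
-/
theorem integrable_sq_of_contDiffAt_charFun (μ : Measure ℝ) [IsFiniteMeasure μ]
    (h : ContDiffAt ℝ 2 (charFun μ) 0) : Integrable (fun x : ℝ => x ^ 2) μ := by
  obtain ⟨K, hK0, hK⟩ := exists_bound_symmetric_difference h
  set a : ℕ → ℝ := fun n => 1 / ((n : ℝ) + 1)
  have ha : Tendsto a atTop (𝓝 0) := tendsto_one_div_add_atTop_nhds_zero_nat
  have ha0 : ∀ n, 0 < a n := fun n => by positivity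
  have key : ∫⁻ x : ℝ, ENNReal.ofReal (4 / Real.pi ^ 2 * x ^ 2) ∂μ ≤ ENNReal.ofReal K := by
    calc ∫⁻ x : ℝ, ENNReal.ofReal (4 / Real.pi ^ 2 * x ^ 2) ∂μ
        ≤ ∫⁻ x : ℝ, liminf (fun n => ENNReal.ofReal ((2 - 2 * Real.cos (a n * x)) / a n ^ 2))
            atTop ∂μ := by
          refine lintegral_mono fun x => ?_
          refine le_liminf_of_le (by isBoundedDefault) ?_
          have hx : Tendsto (fun n => a n * x) atTop (𝓝 0) := by simpa using ha.mul_const x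
          have := hx.abs
          simp only [abs_zero] at this
          filter_upwards [this.eventually (ge_mem_nhds Real.pi_pos)] with n hn
          apply ENNReal.ofReal_le_ofReal
          rw [le_div_iff₀ (by have := ha0 n; positivity)]
          have := Real.cos_le_one_sub_mul_cos_sq hn
          have e : 4 / Real.pi ^ 2 * x ^ 2 * a n ^ 2 = 2 * (2 / Real.pi ^ 2 * (a n * x) ^ 2) := by
            ring
          linarith
      _ ≤ liminf (fun n => ∫⁻ x : ℝ, ENNReal.ofReal ((2 - 2 * Real.cos (a n * x)) / a n ^ 2) ∂μ)
            atTop := lintegral_liminf_le fun n => by fun_prop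
      _ ≤ ENNReal.ofReal K := by
          refine liminf_le_of_frequently_le' (Eventually.frequently ?_)
          filter_upwards [ha.eventually hK] with n hn
          have hint : Integrable (fun x => (2 - 2 * Real.cos (a n * x)) / a n ^ 2) μ := by
            refine Integrable.div_const ?_ _
            refine (integrable_const (4 : ℝ)).mono' (by fun_prop) (ae_of_all _ fun x => ?_)
            have h1 := Real.cos_le_one (a n * x)
            have h2 := Real.neg_one_le_cos (a n * x)
            rw [Real.norm_eq_abs, abs_le]; constructor <;> linarith
          rw [← ofReal_integral_eq_lintegral_ofReal hint (ae_of_all _ fun x => by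
            have h1 := Real.cos_le_one (a n * x)
            exact div_nonneg (by linarith) (by positivity))]
          apply ENNReal.ofReal_le_ofReal
          rw [integral_div, div_le_iff₀ (by have := ha0 n; positivity)]
          refine le_trans ?_ hn
          rw [← integral_two_sub_two_cos_eq, Complex.norm_real]
          exact le_abs_self _
  refine ⟨by fun_prop, ?_⟩
  have h2 : Integrable (fun x : ℝ => 4 / Real.pi ^ 2 * x ^ 2) μ := by
    refine ⟨by fun_prop, ?_⟩
    rw [hasFiniteIntegral_iff_ofReal (ae_of_all _ fun x => by positivity)]
    exact key.trans_lt ENNReal.ofReal_lt_top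
  have h3 := h2.const_mul (Real.pi ^ 2 / 4)
  have e : (fun x : ℝ => Real.pi ^ 2 / 4 * (4 / Real.pi ^ 2 * x ^ 2)) = fun x => x ^ 2 := by
    ext x; field_simp
  rw [e] at h3
  exact h3.2

theorem integral_ofReal_withDensity_sq (μ : Measure ℝ) (g : ℝ → ℂ) :
    ∫ x, g x ∂(μ.withDensity fun x => ENNReal.ofReal (x ^ 2)) = ∫ x, (x : ℂ) ^ 2 * g x ∂μ := by
  rw [integral_withDensity_eq_integral_toReal_smul (by fun_prop) (by simp)]
  congr 1 with x
  rw [ENNReal.toReal_ofReal (sq_nonneg x), Complex.real_smul]; push_cast; rfl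

/-- Each induction step replaces `μ` by `x² μ`, a finite measure whose characteristic function is
minus the second derivative of that of `μ`, hence again smooth at `0`. -/
theorem integrable_even_pow_of_contDiffAt_charFun (n : ℕ) : ∀ (μ : Measure ℝ) [IsFiniteMeasure μ],
    ContDiffAt ℝ ∞ (charFun μ) 0 → Integrable (fun x : ℝ => x ^ (2 * n)) μ := by
  induction n with
  | zero => intro μ _ _; simp
  | succ n ih =>
    intro μ _ h
    have h2 := integrable_sq_of_contDiffAt_charFun μ (by exact_mod_cast contDiffAt_infty.mp h 2)
    set ρ := μ.withDensity fun x => ENNReal.ofReal (x ^ 2) with hρ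
    have : IsFiniteMeasure ρ := isFiniteMeasure_withDensity_ofReal h2.2
    have hmem : MemLp id ((2 : ℕ) : ℝ≥0∞) μ := by
      have := (memLp_two_iff_integrable_sq (f := (id : ℝ → ℝ)) (μ := μ) (by fun_prop)).mpr h2
      exact_mod_cast this
    have e : charFun ρ = fun t => - iteratedDeriv 2 (charFun μ) t := by
      ext t
      rw [iteratedDeriv_charFun hmem, charFun_apply_real, integral_ofReal_withDensity_sq]
      simp
    have hρs : ContDiffAt ℝ ∞ (charFun ρ) 0 := by
      rw [e]
      refine ContDiffAt.neg ?_
      rw [iteratedDeriv_succ, iteratedDeriv_one]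
      exact (h.derivWithin (m := ∞) le_rfl).derivWithin le_rfl
    have := ih ρ hρs
    rw [hρ, integrable_withDensity_iff (by fun_prop) (by simp)] at this
    refine this.congr (ae_of_all _ fun x => ?_)
    simp only
    rw [ENNReal.toReal_ofReal (sq_nonneg x)]; ring

/-! ### The Lévy-Khintchine exponent -/

theorem norm_one_sub_cexp_I_mul_le (y : ℝ) : ‖1 - Complex.exp (Complex.I * y)‖ ≤ |y| := by
  have h := Real.norm_exp_I_mul_ofReal_sub_one_le (x := y)
  rwa [norm_sub_rev, Real.norm_eq_abs] at h

theorem norm_one_sub_cexp_I_mul_le_two (y : ℝ) : ‖1 - Complex.exp (Complex.I * y)‖ ≤ 2 := by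
  refine (norm_sub_le _ _).trans ?_
  rw [mul_comm, Complex.norm_exp_ofReal_mul_I]; norm_num

theorem norm_one_sub_cexp_add_le (y : ℝ) :
    ‖1 - Complex.exp (Complex.I * y) + Complex.I * y‖ ≤ y ^ 2 := by
  have hd : ∀ u : ℝ, HasDerivAt (fun u : ℝ => 1 - Complex.exp (Complex.I * u) + Complex.I * u)
      (Complex.I * (1 - Complex.exp (Complex.I * u))) u := fun u => by
    have h1 : HasDerivAt (fun u : ℝ => Complex.I * (u : ℂ)) Complex.I u := by
      simpa using (Complex.ofRealCLM.hasDerivAt (x := u)).const_mul Complex.I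
    have h2 := ((h1.cexp).const_sub 1).add h1
    refine h2.congr_deriv ?_
    ring
  have := (convex_closedBall (0 : ℝ) |y|).norm_image_sub_le_of_norm_hasDerivWithin_le
    (C := |y|) (x := 0) (y := y) (fun u _ => (hd u).hasDerivWithinAt)
    (fun u hu => by
      rw [norm_mul, Complex.norm_I, one_mul]
      exact (norm_one_sub_cexp_I_mul_le u).trans (by simpa using hu)) (by simp) (by simp)
  simpa [← sq] using this

/-- The integrand of the jump part of the Lévy-Khintchine exponent. -/
noncomputable def levyIntegrand (u z : ℝ) : ℂ :=
  1 - Complex.exp (Complex.I * u * z)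
    + indicator {z : ℝ | |z| < 1} (fun z : ℝ => Complex.I * u * z) z

/-- The derivative in `u` of `levyIntegrand`. -/
noncomputable def levyIntegrandDeriv (u z : ℝ) : ℂ :=
  - (Complex.I * z * Complex.exp (Complex.I * u * z))
    + indicator {z : ℝ | |z| < 1} (fun z : ℝ => Complex.I * z) z

theorem measurableSet_abs_lt_one : MeasurableSet {z : ℝ | |z| < 1} :=
  measurableSet_lt (by fun_prop) (by fun_prop)

theorem measurable_levyIntegrand (u : ℝ) : Measurable (levyIntegrand u) := by
  unfold levyIntegrand
  exact Measurable.add (by fun_prop) (Measurable.indicator (by fun_prop) measurableSet_abs_lt_one)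

theorem measurable_levyIntegrandDeriv (u : ℝ) : Measurable (levyIntegrandDeriv u) := by
  unfold levyIntegrandDeriv
  exact Measurable.add (by fun_prop) (Measurable.indicator (by fun_prop) measurableSet_abs_lt_one)

theorem norm_levyIntegrand_le (u z : ℝ) : ‖levyIntegrand u z‖ ≤ (u ^ 2 + 2) * min 1 (z ^ 2) := by
  unfold levyIntegrand
  by_cases hz : |z| < 1
  · have hz2 : z ^ 2 ≤ 1 := by rw [← sq_abs]; nlinarith [abs_nonneg z]
    rw [indicator_of_mem (by exact hz), min_eq_right hz2]
    have := norm_one_sub_cexp_add_le (u * z)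
    push_cast at this
    rw [← mul_assoc] at this
    refine this.trans ?_
    nlinarith [sq_nonneg z]
  · have hz2 : 1 ≤ z ^ 2 := by rw [← sq_abs]; nlinarith [abs_nonneg z]
    rw [indicator_of_notMem (by exact hz), min_eq_left hz2, add_zero]
    have := norm_one_sub_cexp_I_mul_le_two (u * z)
    push_cast at this
    rw [← mul_assoc] at this
    nlinarith [sq_nonneg u]

theorem norm_levyIntegrandDeriv_le (u z : ℝ) : ‖levyIntegrandDeriv u z‖ ≤ (|u| + 1) * z ^ 2 := by
  unfold levyIntegrandDeriv
  by_cases hz : |z| < 1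
  · rw [indicator_of_mem (by exact hz)]
    have e : -(Complex.I * z * Complex.exp (Complex.I * u * z)) + Complex.I * z
      = Complex.I * z * (1 - Complex.exp (Complex.I * (u * z : ℝ))) := by
      push_cast; rw [← mul_assoc]; ring
    rw [e, norm_mul, norm_mul, Complex.norm_I, one_mul, Complex.norm_real, Real.norm_eq_abs]
    have := norm_one_sub_cexp_I_mul_le (u * z)
    rw [abs_mul] at this
    calc |z| * _ ≤ |z| * (|u| * |z|) := by gcongr
      _ = |u| * z ^ 2 := by rw [← sq_abs z]; ring
      _ ≤ _ := by nlinarith [sq_nonneg z]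
  · have hz1 : 1 ≤ |z| := not_lt.mp hz
    rw [indicator_of_notMem (by exact hz), add_zero, norm_neg]
    have e : Complex.I * u * z = ((u * z : ℝ) : ℂ) * Complex.I := by push_cast; ring
    rw [e, norm_mul, norm_mul, Complex.norm_I, one_mul, Complex.norm_real, Real.norm_eq_abs,
      Complex.norm_exp_ofReal_mul_I, mul_one, ← sq_abs]
    nlinarith [abs_nonneg u]

theorem hasDerivAt_levyIntegrand (u z : ℝ) :
    HasDerivAt (fun u => levyIntegrand u z) (levyIntegrandDeriv u z) u := by
  unfold levyIntegrand levyIntegrandDeriv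
  have h1 : HasDerivAt (fun u : ℝ => Complex.I * (u : ℂ) * z) (Complex.I * z) u := by
    simpa using ((Complex.ofRealCLM.hasDerivAt (x := u)).const_mul Complex.I).mul_const (z : ℂ)
  have h2 := h1.cexp.const_sub 1
  have h3 : HasDerivAt (fun u : ℝ => indicator {z : ℝ | |z| < 1}
      (fun z : ℝ => Complex.I * u * z) z)
      (indicator {z : ℝ | |z| < 1} (fun z : ℝ => Complex.I * z) z) u := by
    by_cases hz : z ∈ {z : ℝ | |z| < 1}
    · simp only [indicator_of_mem hz]; exact h1
    · simp only [indicator_of_notMem hz]; exact hasDerivAt_const _ _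
  refine (h2.add h3).congr_deriv ?_
  ring

theorem hasDerivAt_levyIntegrandDeriv (u z : ℝ) :
    HasDerivAt (fun u => levyIntegrandDeriv u z)
      ((z : ℂ) ^ 2 * Complex.exp (u * z * Complex.I)) u := by
  unfold levyIntegrandDeriv
  have h1 : HasDerivAt (fun u : ℝ => Complex.I * (u : ℂ) * z) (Complex.I * z) u := by
    simpa using ((Complex.ofRealCLM.hasDerivAt (x := u)).const_mul Complex.I).mul_const (z : ℂ)
  have h2 := ((h1.cexp.const_mul (Complex.I * z)).neg).add_const
    (indicator {z : ℝ | |z| < 1} (fun z : ℝ => Complex.I * z) z)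
  refine h2.congr_deriv ?_
  have : Complex.I * u * z = u * z * Complex.I := by ring
  rw [this]
  linear_combination (-(z : ℂ) ^ 2 * Complex.exp (u * z * Complex.I)) * Complex.I_sq

theorem IsLevyMeasure.integrable_min {ν : Measure ℝ} (hν : IsLevyMeasure ν) :
    Integrable (fun z : ℝ => min 1 (z ^ 2)) ν := by
  refine ⟨by fun_prop, ?_⟩
  rw [hasFiniteIntegral_iff_ofReal (ae_of_all _ fun z => by positivity)]
  exact hν.lintegral_lt_top

theorem IsLevyMeasure.integrable_levyIntegrand {ν : Measure ℝ} (hν : IsLevyMeasure ν) (u : ℝ) :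
    Integrable (levyIntegrand u) ν :=
  (hν.integrable_min.const_mul (u ^ 2 + 2)).mono' (measurable_levyIntegrand u).aestronglyMeasurable
    (ae_of_all _ fun z => norm_levyIntegrand_le u z)

/-- The exponent is at least `2`, so small jumps are controlled by `z²`; large jumps are controlled
by the exponential moment. -/
theorem IsLevyMeasure.integrable_pow {ν : Measure ℝ} (hν : IsLevyMeasure ν) {θ : ℝ} (hθ : 0 < θ)
    (hexp : ∫⁻ z in {z : ℝ | 1 ≤ |z|}, ENNReal.ofReal (Real.exp (θ * |z|)) ∂ν < ⊤) (k : ℕ) :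
    Integrable (fun z : ℝ => |z| ^ (k + 2)) ν := by
  have hS : MeasurableSet {z : ℝ | 1 ≤ |z|} := measurableSet_le (by fun_prop) (by fun_prop)
  have hE : Integrable (indicator {z : ℝ | 1 ≤ |z|} fun z => Real.exp (θ * |z|)) ν := by
    rw [integrable_indicator_iff hS]
    refine ⟨by fun_prop, ?_⟩
    rw [hasFiniteIntegral_iff_ofReal (ae_of_all _ fun z => by positivity)]
    exact hexp
  refine (hν.integrable_min.add (hE.const_mul ((k + 2).factorial / θ ^ (k + 2)))).mono'
    (by fun_prop) (ae_of_all _ fun z => ?_)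
  rw [Real.norm_of_nonneg (by positivity)]
  simp only [Pi.add_apply]
  by_cases hz : 1 ≤ |z|
  · rw [indicator_of_mem (by exact hz)]
    have h := Real.pow_div_factorial_le_exp (θ * |z|) (by positivity) (k + 2)
    have : |z| ^ (k + 2) = (k + 2).factorial / θ ^ (k + 2) * ((θ * |z|) ^ (k + 2)
        / (k + 2).factorial) := by
      field_simp
      ring
    have h0 : 0 ≤ min 1 (z ^ 2) := by positivity
    rw [this]
    have : (k + 2).factorial / θ ^ (k + 2) * ((θ * |z|) ^ (k + 2)
        / (k + 2).factorial) ≤ (k + 2).factorial / θ ^ (k + 2) * Real.exp (θ * |z|) := by gcongr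
    linarith
  · have hz1 : |z| ≤ 1 := (not_le.mp hz).le
    have hz2 : z ^ 2 ≤ 1 := by rw [← sq_abs]; nlinarith [abs_nonneg z]
    rw [indicator_of_notMem (by exact hz), min_eq_right hz2, mul_zero, add_zero, pow_add, sq_abs]
    exact mul_le_of_le_one_left (sq_nonneg z) (pow_le_one₀ (abs_nonneg z) hz1)

/-- Two derivatives in `u` turn the integrand into `z² e^{iuz}`. So the second derivative of the
jump part is the characteristic function of the finite measure `z² ν(dz)`, which has all moments and
is therefore smooth. -/
theorem contDiff_levyExponent (γ σ : ℝ) {ν : Measure ℝ} (hν : IsLevyMeasure ν) {θ : ℝ} (hθ : 0 < θ)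
    (hexp : ∫⁻ z in {z : ℝ | 1 ≤ |z|}, ENNReal.ofReal (Real.exp (θ * |z|)) ∂ν < ⊤) :
    ContDiff ℝ ∞ (levyExponent γ σ ν) := by
  have hsq : Integrable (fun z : ℝ => z ^ 2) ν := by
    simpa using hν.integrable_pow hθ hexp 0
  set ρ := ν.withDensity fun x => ENNReal.ofReal (x ^ 2) with hρ
  have : IsFiniteMeasure ρ := isFiniteMeasure_withDensity_ofReal hsq.2
  have hρm : ∀ k : ℕ, MemLp id k ρ := fun k => by
    rcases Nat.eq_zero_or_pos k with rfl | hk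
    · simpa using by fun_prop
    rw [← integrable_norm_rpow_iff (by fun_prop) (by simpa using hk.ne') (by simp), hρ,
      integrable_withDensity_iff (by fun_prop) (by simp)]
    refine (hν.integrable_pow hθ hexp k).congr (ae_of_all _ fun x => ?_)
    simp only [id, Real.norm_eq_abs, ENNReal.toReal_natCast, Real.rpow_natCast]
    rw [ENNReal.toReal_ofReal (sq_nonneg x), ← sq_abs]; ring
  have hd2 : ∀ u, HasDerivAt (fun u => ∫ z, levyIntegrandDeriv u z ∂ν) (charFun ρ u) u := fun u => by
    have := (hasDerivAt_integral_of_dominated_loc_of_deriv_le (μ := ν) (x₀ := u)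
      (F := levyIntegrandDeriv) (F' := fun u z => (z : ℂ) ^ 2 * Complex.exp (u * z * Complex.I))
      (bound := fun z => z ^ 2) (s := univ) univ_mem
      (Eventually.of_forall fun v => (measurable_levyIntegrandDeriv v).aestronglyMeasurable)
      ((hsq.const_mul (|u| + 1)).mono' (measurable_levyIntegrandDeriv u).aestronglyMeasurable
        (ae_of_all _ fun z => norm_levyIntegrandDeriv_le u z))
      (by fun_prop) (ae_of_all _ fun z v _ => ?_) hsq
      (ae_of_all _ fun z v _ => hasDerivAt_levyIntegrandDeriv v z)).2
    · rwa [← integral_ofReal_withDensity_sq, ← charFun_apply_real] at this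
    · rw [norm_mul, ← Complex.ofReal_mul, Complex.norm_exp_ofReal_mul_I]
      simp
  have hd1 : ∀ u, HasDerivAt (fun u => ∫ z, levyIntegrand u z ∂ν)
      (∫ z, levyIntegrandDeriv u z ∂ν) u := fun u => by
    refine (hasDerivAt_integral_of_dominated_loc_of_deriv_le (μ := ν) (x₀ := u)
      (F := levyIntegrand) (F' := levyIntegrandDeriv)
      (bound := fun z => (|u| + 2) * z ^ 2) (s := Metric.ball u 1) (Metric.ball_mem_nhds _ one_pos)
      (Eventually.of_forall fun v => (measurable_levyIntegrand v).aestronglyMeasurable)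
      (hν.integrable_levyIntegrand u)
      (measurable_levyIntegrandDeriv u).aestronglyMeasurable
      (ae_of_all _ fun z v hv => (norm_levyIntegrandDeriv_le v z).trans ?_) (hsq.const_mul _)
      (ae_of_all _ fun z v _ => hasDerivAt_levyIntegrand v z)).2
    have : |v| ≤ |u| + 1 := by
      have h1 : |v - u| < 1 := by simpa [Real.dist_eq] using hv
      have := abs_add_le (v - u) u
      simp only [sub_add_cancel] at this
      linarith
    nlinarith [sq_nonneg z]
  have hJ : ContDiff ℝ ∞ fun u => ∫ z, levyIntegrand u z ∂ν := by
    rw [contDiff_infty_iff_deriv]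
    refine ⟨fun u => (hd1 u).differentiableAt, ?_⟩
    rw [show deriv (fun u => ∫ z, levyIntegrand u z ∂ν) = fun u => ∫ z, levyIntegrandDeriv u z ∂ν
      from funext fun u => (hd1 u).deriv, contDiff_infty_iff_deriv]
    refine ⟨fun u => (hd2 u).differentiableAt, ?_⟩
    rw [show deriv (fun u => ∫ z, levyIntegrandDeriv u z ∂ν) = charFun ρ
      from funext fun u => (hd2 u).deriv]
    exact contDiff_charFun' (n := ⊤) hρm
  have hof : ContDiff ℝ ∞ (fun u : ℝ => (u : ℂ)) := Complex.ofRealCLM.contDiff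
  unfold levyExponent
  refine ContDiff.add ?_ hJ
  fun_prop

theorem levyExponent_zero (γ σ : ℝ) (ν : Measure ℝ) : levyExponent γ σ ν 0 = 0 := by
  simp [levyExponent]

theorem integrable_pow_of_charFun_eq {m : Measure ℝ} [IsFiniteMeasure m] {q : ℝ} (hq : 0 < q)
    {Ψ : ℝ → ℂ} (hΨ : ContDiff ℝ ∞ Ψ) (h0 : Ψ 0 = 0) (hm : ∀ u, charFun m u = q / (q + Ψ u))
    (N : ℕ) : Integrable (fun x : ℝ => |x| ^ N) m := by
  have hc : ContDiffAt ℝ ∞ (charFun m) 0 := by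
    rw [show charFun m = fun u => (q : ℂ) * (q + Ψ u)⁻¹ from
      funext fun u => by rw [hm, div_eq_mul_inv]]
    -- At `u = 0` the denominator is `q ≠ 0`, so the quotient is smooth there.
    refine contDiffAt_const.mul (ContDiffAt.inv (contDiffAt_const.add hΨ.contDiffAt) ?_)
    simp [h0, hq.ne']
  refine ((integrable_const (1 : ℝ)).add (integrable_even_pow_of_contDiffAt_charFun N m hc)).mono'
    (by fun_prop) (ae_of_all _ fun x => ?_)
  rw [Real.norm_of_nonneg (by positivity)]
  simp only [Pi.add_apply]
  rw [pow_mul, ← sq_abs, ← pow_mul, mul_comm 2, pow_mul]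
  nlinarith [sq_nonneg (|x| ^ N - 1), sq_nonneg (|x| ^ N)]

end CharacteristicFunctions

/-! ### Atoms of the resolvent laws -/

theorem finite_setOf_le_measure_singleton (μ : Measure ℝ) [IsFiniteMeasure μ] {ε : ℝ} (hε : 0 < ε) :
    {x : ℝ | ε ≤ μ.real {x}}.Finite := by
  have := Measure.finite_const_le_meas_of_disjoint_iUnion μ (ε := ENNReal.ofReal ε)
    (As := fun x : ℝ => {x}) (by simpa using hε) (fun x => measurableSet_singleton x)
    (fun x y hxy => by simpa using hxy) (measure_ne_top _ _)
  refine this.subset fun x hx => ?_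
  exact ENNReal.ofReal_le_of_le_toReal hx

/-- Only finitely many atoms are as heavy as a given one, so the supremum of the atom masses is
attained. -/
theorem exists_max_measure_singleton (μ : Measure ℝ) [IsFiniteMeasure μ] {y : ℝ}
    (hy : μ {y} ≠ 0) : ∃ x, 0 < μ.real {x} ∧ ∀ z, μ.real {z} ≤ μ.real {x} := by
  have hy' : 0 < μ.real {y} := by
    rw [measureReal_def]; exact ENNReal.toReal_pos hy (measure_ne_top _ _)
  obtain ⟨x, hx, hmax⟩ := exists_max_image _ (fun x => μ.real {x})
    (finite_setOf_le_measure_singleton μ hy') ⟨y, le_refl (μ.real {y})⟩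
  refine ⟨x, hy'.trans_le hx, fun z => ?_⟩
  by_cases hz : μ.real {y} ≤ μ.real {z}
  · exact hmax z hz
  · exact (not_le.mp hz).le.trans hx

/-- The function `1 - e^{iux}` vanishes at `x = 0` and has modulus at most `2` elsewhere. -/
theorem norm_one_sub_charFun_le (μ : Measure ℝ) [IsProbabilityMeasure μ] (u : ℝ) :
    ‖1 - charFun μ u‖ ≤ 2 * (1 - μ.real {0}) := by
  have hint : Integrable (fun x : ℝ => Complex.exp (u * x * Complex.I)) μ :=
    (integrable_const (1 : ℝ)).mono' (by fun_prop)
      (ae_of_all _ fun x => by rw [← Complex.ofReal_mul, Complex.norm_exp_ofReal_mul_I])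
  have e : 1 - charFun μ u = ∫ x : ℝ, (1 - Complex.exp (u * x * Complex.I)) ∂μ := by
    rw [integral_sub (integrable_const _) hint, charFun_apply_real]; simp
  rw [e, ← probReal_compl_eq_one_sub (measurableSet_singleton _)]
  have h2 : ∫ x : ℝ, (1 - Complex.exp (u * x * Complex.I)) ∂μ
      = ∫ x in {(0 : ℝ)}ᶜ, (1 - Complex.exp (u * x * Complex.I)) ∂μ := by
    rw [setIntegral_eq_integral_of_forall_compl_eq_zero]
    intro x hx
    have : x = 0 := by simpa using hx
    simp [this]
  rw [h2]
  refine norm_setIntegral_le_of_norm_le_const (measure_lt_top _ _) fun x _ => ?_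
  have := norm_one_sub_cexp_I_mul_le_two (u * x)
  rwa [mul_comm, Complex.ofReal_mul] at this

/-- At frequency `π / z` the nonnegative function `2 - 2 cos` takes its maximal value `4` at the
point `z`. -/
theorem two_mul_measure_singleton_le (μ : Measure ℝ) [IsProbabilityMeasure μ] {z : ℝ}
    (hz : z ≠ 0) : 2 * μ.real {z} ≤ ‖1 - charFun μ (Real.pi / z)‖ := by
  have h := integral_two_sub_two_cos_eq μ (Real.pi / z)
  have h1 : ‖2 * charFun μ 0 - charFun μ (Real.pi / z) - charFun μ (-(Real.pi / z))‖
      ≤ 2 * ‖1 - charFun μ (Real.pi / z)‖ := by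
    have e : 2 * charFun μ 0 - charFun μ (Real.pi / z) - charFun μ (-(Real.pi / z))
      = (1 - charFun μ (Real.pi / z)) + (starRingEnd ℂ) (1 - charFun μ (Real.pi / z)) := by
      rw [charFun_neg, charFun_zero]; simp; ring
    rw [e]
    refine (norm_add_le _ _).trans ?_
    rw [Complex.norm_conj]; linarith
  rw [← h, Complex.norm_real] at h1
  have h2 : 4 * μ.real {z} ≤ ∫ x, (2 - 2 * Real.cos (Real.pi / z * x)) ∂μ := by
    have hnn : ∀ x, 0 ≤ 2 - 2 * Real.cos (Real.pi / z * x) := fun x => by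
      have := Real.cos_le_one (Real.pi / z * x); linarith
    have hint : Integrable (fun x => 2 - 2 * Real.cos (Real.pi / z * x)) μ := by
      refine (integrable_const (4 : ℝ)).mono' (by fun_prop) (ae_of_all _ fun x => ?_)
      have h2 := Real.neg_one_le_cos (Real.pi / z * x)
      rw [Real.norm_of_nonneg (hnn x)]; linarith
    refine le_trans (le_of_eq ?_) (setIntegral_le_integral (s := {z}) hint (ae_of_all _ hnn))
    rw [integral_singleton, div_mul_cancel₀ _ hz, Real.cos_pi, smul_eq_mul]; ring
  have := Real.le_norm_self (∫ x, (2 - 2 * Real.cos (Real.pi / z * x)) ∂μ)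
  linarith

/-- The resolvent equation for measures with characteristic functions `q / (q + Ψ)`. -/
theorem resolvent_equation {m : ℝ → Measure ℝ} {Ψ : ℝ → ℂ}
    (hprob : ∀ q, 0 < q → IsProbabilityMeasure (m q)) (hre : ∀ u, 0 ≤ (Ψ u).re)
    (hm : ∀ q, 0 < q → ∀ u, charFun (m q) u = q / (q + Ψ u)) {q r : ℝ} (hq : 0 < q) (hr : q ≤ r) :
    m q = ENNReal.ofReal (q / r) • m r + ENNReal.ofReal (1 - q / r) • (m r ∗ m q) := by
  have hr0 : 0 < r := hq.trans_le hr
  have := hprob q hq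
  have := hprob r hr0
  have hne : ∀ s : ℝ, 0 < s → ∀ u, (s : ℂ) + Ψ u ≠ 0 := fun s hs u h => by
    have := congrArg Complex.re h
    simp at this
    linarith [hre u]
  have hle : q / r ≤ 1 := (div_le_one hr0).mpr hr
  have f1 := Measure.smul_finite (m r) (c := ENNReal.ofReal (q / r)) (by simp)
  have f2 := Measure.smul_finite (m r ∗ m q) (c := ENNReal.ofReal (1 - q / r)) (by simp)
  apply Measure.ext_of_charFun
  ext u
  have hint : ∀ (μ : Measure ℝ) [IsFiniteMeasure μ],
      Integrable (fun x : ℝ => Complex.exp (u * x * Complex.I)) μ := fun μ _ =>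
    (integrable_const (1 : ℝ)).mono' (by fun_prop)
      (ae_of_all _ fun x => by rw [← Complex.ofReal_mul, Complex.norm_exp_ofReal_mul_I])
  rw [charFun_apply_real (μ := _ + _), integral_add_measure (hint _) (hint _),
    integral_smul_measure, integral_smul_measure, ← charFun_apply_real, ← charFun_apply_real,
    charFun_conv, hm q hq, hm r hr0, ENNReal.toReal_ofReal (by positivity),
    ENNReal.toReal_ofReal (by linarith)]
  have h1 := hne q hq u
  have h2 := hne r hr0 u
  have h3 : (r : ℂ) ≠ 0 := by exact_mod_cast hr0.ne'
  simp only [Complex.real_smul]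
  push_cast
  field_simp
  ring

/-- Let `α` be the largest atom mass of `m q`, attained at `x`. The resolvent equation writes it, up
to `q / r`, as an `m r`-average of the masses `m q {x - z}`, none above `α`. For large `r` the
measure `m r` must therefore put most of its mass on the finite set `F` where these masses are at
least `α / 2`. Its atoms at `z ≠ 0` are of order `‖Ψ (π / z)‖ / r`, so most of the mass sits at `0`.
Then `1 - q`-type differences are small: `‖Ψ u‖ / ‖r + Ψ u‖ ≤ 3 / 4` for all `u`, which bounds `Ψ`.
-/
theorem exists_bound_of_resolvent_atom {m : ℝ → Measure ℝ} {Ψ : ℝ → ℂ}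
    (hprob : ∀ q, 0 < q → IsProbabilityMeasure (m q)) (hre : ∀ u, 0 ≤ (Ψ u).re)
    (hm : ∀ q, 0 < q → ∀ u, charFun (m q) u = q / (q + Ψ u)) {q : ℝ} (hq : 0 < q) {y : ℝ}
    (hy : m q {y} ≠ 0) : ∃ K : ℝ, ∀ u, ‖Ψ u‖ ≤ K := by
  have := hprob q hq
  have hlow : ∀ s : ℝ, 0 < s → ∀ u, s ≤ ‖(s : ℂ) + Ψ u‖ := fun s hs u => by
    refine le_trans ?_ (Complex.re_le_norm _)
    simp [hre u]
  have hone : ∀ s : ℝ, 0 < s → ∀ u, ‖1 - charFun (m s) u‖ = ‖Ψ u‖ / ‖(s : ℂ) + Ψ u‖ :=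
    fun s hs u => by
      have h0 : (s : ℂ) + Ψ u ≠ 0 := norm_pos_iff.mp (hs.trans_le (hlow s hs u))
      rw [hm s hs, one_sub_div h0, norm_div]; simp
  obtain ⟨x, hx0, hmax⟩ := exists_max_measure_singleton (m q) hy
  set α := (m q).real {x} with hα
  have hF : {z : ℝ | α / 2 ≤ (m q).real {x - z}}.Finite :=
    (finite_setOf_le_measure_singleton (m q) (half_pos hx0)).preimage
      (f := fun z => x - z) (by intro a _ b _ h; simpa using h)
  set F := hF.toFinset with hFdef
  have h0F : (0 : ℝ) ∈ F := by
    rw [hFdef, Finite.mem_toFinset, mem_ofPred_eq, sub_zero]; linarith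
  set L := ∑ z ∈ F.erase 0, ‖Ψ (Real.pi / z)‖ with hL
  have hL0 : 0 ≤ L := Finset.sum_nonneg fun _ _ => norm_nonneg _
  -- Large enough for `q / r ≤ α / 8` and `L / r ≤ 1 / 8`.
  set r := q + 8 * q / α + 8 * L with hr
  have hqr : q ≤ r := by
    have : 0 ≤ 8 * q / α := by positivity
    linarith
  have hr0 : 0 < r := hq.trans_le hqr
  have := hprob r hr0
  have hstep : α ≤ q / r + ∫ z, (m q).real {x - z} ∂(m r) := by
    have h1 : (m q) {x} ≤ ENNReal.ofReal (q / r) + ∫⁻ z, (m q) {x - z} ∂(m r) := by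
      conv_lhs => rw [resolvent_equation hprob hre hm hq hqr]
      rw [Measure.add_apply, Measure.smul_apply, Measure.smul_apply, smul_eq_mul, smul_eq_mul]
      refine add_le_add (mul_le_of_le_one_right' prob_le_one) ?_
      refine (mul_le_of_le_one_left' ?_).trans (le_of_eq ?_)
      · rw [ENNReal.ofReal_le_one]
        have : 0 ≤ q / r := by positivity
        linarith
      · rw [← lintegral_indicator_one (measurableSet_singleton x), Measure.lintegral_conv
          (measurable_one.indicator (measurableSet_singleton x))]
        refine lintegral_congr fun z => ?_
        rw [← lintegral_indicator_one (measurableSet_singleton _)]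
        refine lintegral_congr fun w => ?_
        simp only [indicator, mem_singleton_iff, eq_sub_iff_add_eq, add_comm w z, Pi.one_apply]
    have hmeas : Measurable fun z => (m q) {x - z} := by
      have e : (fun z => (m q) {x - z}) = fun z => ∫⁻ w, indicator {x} 1 (z + w) ∂(m q) := by
        ext z
        rw [← lintegral_indicator_one (measurableSet_singleton _)]
        refine lintegral_congr fun w => ?_
        simp only [indicator, mem_singleton_iff, eq_sub_iff_add_eq, add_comm w z, Pi.one_apply]
      rw [e]
      exact Measurable.lintegral_prod_right'
        (f := fun p : ℝ × ℝ => indicator {x} (1 : ℝ → ℝ≥0∞) (p.1 + p.2))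
        ((measurable_one.indicator (measurableSet_singleton x)).comp measurable_add)
    have h2 : ∫ z, (m q).real {x - z} ∂(m r) = (∫⁻ z, (m q) {x - z} ∂(m r)).toReal :=
      integral_toReal hmeas.aemeasurable (ae_of_all _ fun z => measure_lt_top _ _)
    have hfin : ∫⁻ z, (m q) {x - z} ∂(m r) ≠ ⊤ := by
      refine ne_top_of_le_ne_top (b := 1) (by simp) ?_
      calc _ ≤ ∫⁻ z, 1 ∂(m r) := lintegral_mono fun z => prob_le_one
        _ = 1 := by simp
    rw [h2, hα, measureReal_def, ← ENNReal.toReal_ofReal (show 0 ≤ q / r by positivity),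
      ← ENNReal.toReal_add (by simp) hfin]
    exact ENNReal.toReal_mono (by finiteness) h1
  -- The integrand is at most `α` on `F` and less than `α / 2` off `F`.
  have hint : ∫ z, (m q).real {x - z} ∂(m r) ≤ α / 2 + α / 2 * (m r).real F := by
    have hFm : MeasurableSet (F : Set ℝ) := F.measurableSet
    have : ∫ z, (α / 2 + indicator (F : Set ℝ) (fun _ => α / 2) z) ∂(m r)
        = α / 2 + α / 2 * (m r).real F := by
      rw [integral_add (integrable_const _) ((integrable_const _).indicator hFm),
        integral_indicator_const _ hFm]
      simp [mul_comm]
    rw [← this]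
    refine integral_mono_of_nonneg (ae_of_all _ fun z => measureReal_nonneg)
      ((integrable_const _).add ((integrable_const _).indicator hFm)) (ae_of_all _ fun z => ?_)
    by_cases hz : z ∈ F
    · have := hmax (x - z)
      simp only [indicator_of_mem (show z ∈ (F : Set ℝ) from hz)]; linarith
    · simp only [indicator_of_notMem (show z ∉ (F : Set ℝ) from hz)]
      rw [hFdef, Finite.mem_toFinset, mem_ofPred_eq, not_le] at hz
      linarith
  have hsum : (m r).real F = (m r).real {0} + ∑ z ∈ F.erase 0, (m r).real {z} := by
    rw [Finset.add_sum_erase _ (fun z => (m r).real {z}) h0F, sum_measureReal_singleton]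
  have hsmall : ∑ z ∈ F.erase 0, (m r).real {z} ≤ 1 / 8 := by
    calc ∑ z ∈ F.erase 0, (m r).real {z} ≤ ∑ z ∈ F.erase 0, ‖Ψ (Real.pi / z)‖ / r := by
          refine Finset.sum_le_sum fun z hz => ?_
          have hz0 : z ≠ 0 := Finset.ne_of_mem_erase hz
          have h1 := two_mul_measure_singleton_le (m r) hz0
          rw [hone r hr0] at h1
          have h2 : ‖Ψ (Real.pi / z)‖ / ‖(r : ℂ) + Ψ (Real.pi / z)‖ ≤ ‖Ψ (Real.pi / z)‖ / r :=
            div_le_div_of_nonneg_left (norm_nonneg _) hr0 (hlow r hr0 _)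
          have := measureReal_nonneg (μ := m r) (s := {z})
          linarith
      _ = L / r := by rw [← Finset.sum_div]
      _ ≤ 1 / 8 := by
          rw [div_le_div_iff₀ hr0 (by norm_num)]
          have : 0 ≤ 8 * q / α := by positivity
          linarith
  have hqα : q / r ≤ α / 8 := by
    rw [div_le_div_iff₀ hr0 (by norm_num)]
    have : α * (8 * q / α) = 8 * q := by field_simp
    have : 0 ≤ α * (q + 8 * L) := by positivity
    rw [hr]; nlinarith
  have hFge : 3 / 4 ≤ (m r).real F := by
    have : α ≤ α / 8 + (α / 2 + α / 2 * (m r).real F) := by linarith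
    by_contra! hlt
    nlinarith
  -- Here `5 / 8 = 3 / 4 - 1 / 8`, and `2 (1 - 5 / 8) = 3 / 4` is the ratio used below.
  have h0 : 5 / 8 ≤ (m r).real {0} := by linarith
  refine ⟨3 * r, fun u => ?_⟩
  have h1 := norm_one_sub_charFun_le (m r) u
  rw [hone r hr0] at h1
  have h2 : ‖Ψ u‖ ≤ 3 / 4 * ‖(r : ℂ) + Ψ u‖ := by
    rw [← div_le_iff₀ (hr0.trans_le (hlow r hr0 u))]; linarith
  have h3 : ‖(r : ℂ) + Ψ u‖ ≤ r + ‖Ψ u‖ := by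
    refine (norm_add_le _ _).trans ?_
    rw [Complex.norm_real, Real.norm_of_nonneg hr0.le]
  linarith

/-! ### Bounded Lévy-Khintchine exponents -/

theorem re_levyIntegrand (u z : ℝ) : (levyIntegrand u z).re = 1 - Real.cos (u * z) := by
  unfold levyIntegrand
  have e : Complex.I * u * z = ((u * z : ℝ) : ℂ) * Complex.I := by push_cast; ring
  by_cases hz : z ∈ {z : ℝ | |z| < 1}
  · rw [indicator_of_mem hz, e]
    rw [← Complex.exp_ofReal_mul_I_re]; simp
  · rw [indicator_of_notMem hz, e]
    rw [← Complex.exp_ofReal_mul_I_re]; simp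

theorem levyExponent_eq (γ σ : ℝ) (ν : Measure ℝ) (u : ℝ) :
    levyExponent γ σ ν u = -(Complex.I * γ * u) + (1 / 2 : ℂ) * (σ : ℂ) ^ 2 * (u : ℂ) ^ 2
      + ∫ z, levyIntegrand u z ∂ν := rfl

theorem re_levyExponent (γ σ : ℝ) {ν : Measure ℝ} (hν : IsLevyMeasure ν) (u : ℝ) :
    (levyExponent γ σ ν u).re = σ ^ 2 * u ^ 2 / 2 + ∫ z, (1 - Real.cos (u * z)) ∂ν := by
  have h1 : (∫ z, levyIntegrand u z ∂ν).re = ∫ z, (1 - Real.cos (u * z)) ∂ν := by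
    have := integral_re (hν.integrable_levyIntegrand u)
    simp only [RCLike.re_eq_complex_re, re_levyIntegrand] at this
    exact this.symm
  have h2 : (1 / 2 : ℂ) * (σ : ℂ) ^ 2 * (u : ℂ) ^ 2 = ((1 / 2 * σ ^ 2 * u ^ 2 : ℝ) : ℂ) := by
    push_cast; ring
  rw [levyExponent_eq, Complex.add_re, Complex.add_re, h1, h2, Complex.ofReal_re]
  simp
  ring

theorem IsLevyMeasure.measure_abs_ge_lt_top {ν : Measure ℝ} (hν : IsLevyMeasure ν) {ε : ℝ}
    (hε : 0 < ε) : ν {z : ℝ | ε ≤ |z|} < ⊤ := by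
  have hδ : 0 < min 1 (ε ^ 2) := by positivity
  refine lt_of_le_of_lt (measure_mono ?_) (hν.integrable_min.measure_norm_ge_lt_top hδ)
  intro z hz
  have hz' : ε ≤ |z| := hz
  change min 1 (ε ^ 2) ≤ ‖min 1 (z ^ 2)‖
  rw [Real.norm_of_nonneg (by positivity), ← sq_abs z]
  gcongr

/-- Integrating `1 - cos (uz)` over `0 < u ≤ U` gives `U - sin (Uz) / z`, which is at least `U / 2`
when `|z| ≥ 2 / U`. Hence `ν {|z| ≥ 2 / U} ≤ 2 K` for every `U`, and these sets increase to the
complement of `0`. -/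
theorem IsLevyMeasure.isFiniteMeasure_of_bound {ν : Measure ℝ} (hν : IsLevyMeasure ν) {K : ℝ}
    (hK : ∀ u : ℝ, ∫ z, (1 - Real.cos (u * z)) ∂ν ≤ K) : IsFiniteMeasure ν := by
  have hint : ∀ u : ℝ, Integrable (fun z => 1 - Real.cos (u * z)) ν := fun u => by
    have := (hν.integrable_levyIntegrand u).re
    simpa only [RCLike.re_eq_complex_re, re_levyIntegrand] using this
  have hnn : ∀ u z : ℝ, 0 ≤ 1 - Real.cos (u * z) := fun u z => by
    have := Real.cos_le_one (u * z); linarith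
  have hbig : ∀ n : ℕ, ν {z : ℝ | 2 / ((n : ℝ) + 1) ≤ |z|} ≤ ENNReal.ofReal (2 * K) := fun n => by
    set U : ℝ := (n : ℝ) + 1 with hU
    have hU0 : 0 < U := by positivity
    set S : Set ℝ := {z : ℝ | 2 / U ≤ |z|} with hS
    have hSm : MeasurableSet S := measurableSet_le (by fun_prop) (by fun_prop)
    have hfin : IsFiniteMeasure (ν.restrict S) :=
      ⟨by rw [Measure.restrict_apply_univ]; exact hν.measure_abs_ge_lt_top (by positivity)⟩
    have h1 : ∫⁻ u in Ioc 0 U, ∫⁻ z in S, ENNReal.ofReal (1 - Real.cos (u * z)) ∂ν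
        ≤ ENNReal.ofReal K * ENNReal.ofReal U := by
      calc _ ≤ ∫⁻ u in Ioc 0 U, ENNReal.ofReal K := by
            refine lintegral_mono fun u => ?_
            refine (setLIntegral_le_lintegral _ _).trans ?_
            rw [← ofReal_integral_eq_lintegral_ofReal (hint u) (ae_of_all _ (hnn u))]
            exact ENNReal.ofReal_le_ofReal (hK u)
        _ = _ := by simp
    have h2 : ENNReal.ofReal (U / 2) * ν S
        ≤ ∫⁻ u in Ioc 0 U, ∫⁻ z in S, ENNReal.ofReal (1 - Real.cos (u * z)) ∂ν := by
      rw [lintegral_lintegral_swap (by fun_prop), ← setLIntegral_const]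
      refine setLIntegral_mono' hSm fun z hz => ?_
      have hz0 : z ≠ 0 := by
        rintro rfl
        have : 2 / U ≤ |(0 : ℝ)| := hz
        rw [abs_zero] at this
        have : 0 < 2 / U := by positivity
        linarith
      have hc : IntervalIntegrable (fun u => 1 - Real.cos (u * z)) volume 0 U :=
        Continuous.intervalIntegrable (by fun_prop) _ _
      rw [← ofReal_integral_eq_lintegral_ofReal
        ((intervalIntegrable_iff_integrableOn_Ioc_of_le hU0.le).mp hc)
        (ae_of_all _ fun u => hnn u z), ← intervalIntegral.integral_of_le hU0.le]
      apply ENNReal.ofReal_le_ofReal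
      rw [intervalIntegral.integral_sub (by simp) (Continuous.intervalIntegrable (by fun_prop) _ _),
        intervalIntegral.integral_comp_mul_right (fun x => Real.cos x) hz0]
      simp only [intervalIntegral.integral_const, integral_cos, zero_mul, Real.sin_zero, sub_zero,
        smul_eq_mul, mul_one]
      have h3 : |z⁻¹ * Real.sin (U * z)| ≤ U / 2 := by
        rw [abs_mul, abs_inv]
        have hz2 : 2 / U ≤ |z| := hz
        have h4 : |z|⁻¹ ≤ U / 2 := by
          rw [inv_le_comm₀ (by positivity) (by positivity), inv_div]; exact hz2
        calc |z|⁻¹ * |Real.sin (U * z)| ≤ |z|⁻¹ * 1 := by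
              gcongr; exact Real.abs_sin_le_one _
          _ ≤ U / 2 := by simpa using h4
      have := (abs_le.mp h3).2
      linarith
    have h3 := h2.trans h1
    rw [← ENNReal.mul_le_mul_iff_right (a := ENNReal.ofReal (U / 2))
      (by simpa using hU0) (by simp)]
    refine h3.trans (le_of_eq ?_)
    have hK0 : 0 ≤ K := (integral_nonneg (hnn 0)).trans (hK 0)
    rw [← ENNReal.ofReal_mul hK0, ← ENNReal.ofReal_mul (by positivity)]
    congr 1; ring
  refine ⟨?_⟩
  have hun : (univ : Set ℝ) ⊆ {0} ∪ ⋃ n : ℕ, {z : ℝ | 2 / ((n : ℝ) + 1) ≤ |z|} := by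
    intro z _
    by_cases hz : z = 0
    · left; exact hz
    · right
      obtain ⟨n, hn⟩ := exists_nat_ge (2 / |z|)
      rw [mem_iUnion]
      refine ⟨n, ?_⟩
      have hz0 : 0 < |z| := abs_pos.mpr hz
      rw [mem_ofPred_eq, div_le_iff₀ (by positivity)]
      rw [div_le_iff₀ hz0] at hn
      nlinarith
  have hmono : Monotone fun n : ℕ => {z : ℝ | 2 / ((n : ℝ) + 1) ≤ |z|} := by
    intro a b hab z hz
    have hz' : 2 / ((a : ℝ) + 1) ≤ |z| := hz
    refine le_trans ?_ hz'
    have : (a : ℝ) ≤ b := by exact_mod_cast hab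
    gcongr
  calc ν univ ≤ ν {0} + ν (⋃ n : ℕ, {z : ℝ | 2 / ((n : ℝ) + 1) ≤ |z|}) :=
        (measure_mono hun).trans (measure_union_le _ _)
    _ ≤ ENNReal.ofReal (2 * K) := by
        rw [hν.zero, zero_add, hmono.measure_iUnion]
        exact iSup_le hbig
    _ < ⊤ := ENNReal.ofReal_lt_top

theorem eq_zero_of_forall_mul_le {a K : ℝ} (h : ∀ u : ℝ, a * u ≤ K) : a = 0 := by
  by_contra ha
  have := h ((K + 1) / a)
  rw [mul_div_cancel₀ _ ha] at this
  linarith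

/-- The real part is a sum of two nonnegative terms, so both are bounded: `σ = 0` and `ν` is finite.
The compensator can then be split off and merged with the drift into a linear term. All other terms
are bounded, so this linear term vanishes. -/
theorem levyExponent_eq_of_bound {γ σ : ℝ} {ν : Measure ℝ} (hν : IsLevyMeasure ν) {K : ℝ}
    (hK : ∀ u, ‖levyExponent γ σ ν u‖ ≤ K) :
    IsFiniteMeasure ν ∧
      ∀ u, levyExponent γ σ ν u = ∫ z : ℝ, (1 - Complex.exp (Complex.I * u * z)) ∂ν := by
  have hcos : ∀ u : ℝ, 0 ≤ ∫ z, (1 - Real.cos (u * z)) ∂ν := fun u => integral_nonneg fun z => by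
    have := Real.cos_le_one (u * z)
    simp only [Pi.zero_apply]; linarith
  have hre : ∀ u, σ ^ 2 * u ^ 2 / 2 + ∫ z, (1 - Real.cos (u * z)) ∂ν ≤ K := fun u => by
    rw [← re_levyExponent γ σ hν u]
    exact (Complex.re_le_norm _).trans (hK u)
  have hfin : IsFiniteMeasure ν := hν.isFiniteMeasure_of_bound (K := K) fun u => by
    have := hre u
    have : 0 ≤ σ ^ 2 * u ^ 2 / 2 := by positivity
    linarith
  have hσ : σ ^ 2 = 0 := by
    -- The bound at frequency `√u` makes the Gaussian term linear in `u`.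
    refine eq_zero_of_forall_mul_le (K := 2 * K) fun u => ?_
    rcases le_total u 0 with hu | hu
    · have h0 := hre 0
      have h1 := hcos 0
      nlinarith [sq_nonneg σ]
    · have h0 := hre (Real.sqrt u)
      have h1 := hcos (Real.sqrt u)
      rw [Real.sq_sqrt hu] at h0
      linarith
  refine ⟨hfin, ?_⟩
  -- The total compensation of the small jumps, finite because `ν` is finite.
  set d : ℝ := ∫ z, indicator {z : ℝ | |z| < 1} (fun z => z) z ∂ν with hd
  have hint1 : ∀ u : ℝ, Integrable (fun z : ℝ => 1 - Complex.exp (Complex.I * u * z)) ν := fun u =>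
    (integrable_const (2 : ℝ)).mono' (by fun_prop) (ae_of_all _ fun z => by
      have := norm_one_sub_cexp_I_mul_le_two (u * z)
      rwa [Complex.ofReal_mul, ← mul_assoc] at this)
  have hint2 : Integrable (fun z : ℝ => indicator {z : ℝ | |z| < 1} (fun z => z) z) ν := by
    refine (integrable_const (1 : ℝ)).mono'
      (measurable_id.indicator measurableSet_abs_lt_one).aestronglyMeasurable
      (ae_of_all _ fun z => ?_)
    by_cases hz : z ∈ {z : ℝ | |z| < 1}
    · rw [indicator_of_mem hz]; exact le_of_lt hz
    · rw [indicator_of_notMem hz]; simp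
  have hform : ∀ u : ℝ, levyExponent γ σ ν u
      = Complex.I * (((d - γ) * u : ℝ) : ℂ) + ∫ z : ℝ, (1 - Complex.exp (Complex.I * u * z)) ∂ν := by
    intro u
    have hsp : ∀ z, levyIntegrand u z = (1 - Complex.exp (Complex.I * u * z))
        + Complex.I * u * ((indicator {z : ℝ | |z| < 1} (fun z => z) z : ℝ) : ℂ) := fun z => by
      unfold levyIntegrand
      by_cases hz : z ∈ {z : ℝ | |z| < 1}
      · simp only [indicator_of_mem hz]
      · simp only [indicator_of_notMem hz]; simp
    have hint3 : Integrable (fun z : ℝ => Complex.I * u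
        * ((indicator {z : ℝ | |z| < 1} (fun z => z) z : ℝ) : ℂ)) ν :=
      hint2.ofReal.const_mul _
    have hσ' : (σ : ℂ) ^ 2 = 0 := by exact_mod_cast hσ
    rw [levyExponent_eq, integral_congr_ae (ae_of_all _ hsp),
      integral_add (hint1 u) hint3, integral_const_mul, integral_complex_ofReal,
      ← hd, hσ']
    push_cast
    ring
  have hdγ : d - γ = 0 := by
    refine eq_zero_of_forall_mul_le (K := K + 2 * ν.real univ) fun u => ?_
    have h1 : Complex.I * (((d - γ) * u : ℝ) : ℂ) = levyExponent γ σ ν u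
      - ∫ z : ℝ, (1 - Complex.exp (Complex.I * u * z)) ∂ν := by rw [hform u]; ring
    have h2 : ‖∫ z : ℝ, (1 - Complex.exp (Complex.I * u * z)) ∂ν‖ ≤ 2 * ν.real univ :=
      norm_integral_le_of_norm_le_const (ae_of_all _ fun z => by
        have := norm_one_sub_cexp_I_mul_le_two (u * z)
        rwa [Complex.ofReal_mul, ← mul_assoc] at this)
    have h3 := congrArg norm h1
    rw [norm_mul, Complex.norm_I, one_mul, Complex.norm_real, Real.norm_eq_abs] at h3
    have h4 := norm_sub_le (levyExponent γ σ ν u)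
      (∫ z : ℝ, (1 - Complex.exp (Complex.I * u * z)) ∂ν)
    have h5 := le_abs_self ((d - γ) * u)
    have h6 := hK u
    linarith
  intro u
  rw [hform u, hdγ]
  simp

/-! ### Arrival times of a Poisson process -/

theorem lintegral_expMeasure {r : ℝ} {g : ℝ → ℝ≥0∞} (hg : Measurable g) :
    ∫⁻ t, g t ∂(expMeasure r)
      = ∫⁻ t in Ici (0 : ℝ), ENNReal.ofReal (r * Real.exp (-(r * t))) * g t := by
  have e : expMeasure r = volume.withDensity (exponentialPDF r) := rfl
  have hm : Measurable (exponentialPDF r) := by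
    unfold exponentialPDF; exact (measurable_exponentialPDFReal r).ennreal_ofReal
  rw [e, lintegral_withDensity_eq_lintegral_mul _ hm hg, ← lintegral_indicator measurableSet_Ici]
  refine lintegral_congr fun t => ?_
  by_cases ht : t ∈ Ici (0 : ℝ)
  · rw [indicator_of_mem ht, Pi.mul_apply, exponentialPDF_of_nonneg ht]
  · rw [indicator_of_notMem ht, Pi.mul_apply, exponentialPDF_of_neg (not_le.mp ht), zero_mul]

theorem expMeasure_Iic {r : ℝ} (hr : 0 < r) {x : ℝ} (hx : 0 ≤ x) :
    expMeasure r (Iic x) = ENNReal.ofReal (1 - Real.exp (-(r * x))) := by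
  have e : expMeasure r = volume.withDensity (exponentialPDF r) := rfl
  rw [e, withDensity_apply _ measurableSet_Iic, lintegral_exponentialPDF_eq_antiDeriv hr, if_pos hx]

/-- The renewal identity for the exponential distribution. -/
theorem lintegral_expMeasure_renewal {r : ℝ} (hr : 0 < r) {g : ℝ → ℝ≥0∞} (hg : Measurable g) :
    ∫⁻ t, g t ∂(expMeasure r)
        + ENNReal.ofReal r * ∫⁻ s in Ici (0 : ℝ), ∫⁻ t, g (s + t) ∂(expMeasure r)
      = ENNReal.ofReal r * ∫⁻ t in Ici (0 : ℝ), g t := by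
  have := isProbabilityMeasure_expMeasure hr
  have h1 : ∫⁻ s in Ici (0 : ℝ), ∫⁻ t, g (s + t) ∂(expMeasure r)
      = ∫⁻ t in Ici (0 : ℝ), ENNReal.ofReal (1 - Real.exp (-(r * t))) * g t := by
    calc ∫⁻ s in Ici (0 : ℝ), ∫⁻ t, g (s + t) ∂(expMeasure r)
        = ∫⁻ t, (∫⁻ s in Ici (0 : ℝ), g (s + t)) ∂(expMeasure r) := by
          rw [lintegral_lintegral_swap (by fun_prop)]
      _ = ∫⁻ t, (∫⁻ s, indicator (Ici t) g s) ∂(expMeasure r) := by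
          refine lintegral_congr fun t => ?_
          rw [← lintegral_indicator measurableSet_Ici,
            ← lintegral_add_right_eq_self (indicator (Ici t) g) t]
          refine lintegral_congr fun s => ?_
          simp [indicator]
      _ = ∫⁻ s, ∫⁻ t, indicator (Ici t) g s ∂(expMeasure r) := by
          rw [lintegral_lintegral_swap]
          refine Measurable.aemeasurable ?_
          exact Measurable.ite (measurableSet_le measurable_fst measurable_snd)
            (hg.comp measurable_snd) measurable_const
      _ = ∫⁻ s, indicator (Ici 0) (fun t => ENNReal.ofReal (1 - Real.exp (-(r * t))) * g t) s := by
          refine lintegral_congr fun s => ?_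
          have e : ∀ t, indicator (Ici t) g s = g s * indicator (Iic s) 1 t := fun t => by
            by_cases h : t ≤ s <;> simp [h]
          simp_rw [e]
          rw [lintegral_const_mul _ (measurable_one.indicator measurableSet_Iic),
            lintegral_indicator_one measurableSet_Iic]
          by_cases hs : s ∈ Ici (0 : ℝ)
          · rw [indicator_of_mem hs, expMeasure_Iic hr hs, mul_comm]
          · rw [indicator_of_notMem hs]
            have hs' : s < 0 := not_le.mp hs
            have : expMeasure r (Iic s) = 0 := by
              have e : expMeasure r = volume.withDensity (exponentialPDF r) := rfl
              rw [e, withDensity_apply _ measurableSet_Iic, lintegral_exponentialPDF_eq_antiDeriv hr,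
                if_neg (not_le.mpr hs'), ENNReal.ofReal_zero]
            rw [this, mul_zero]
      _ = _ := lintegral_indicator measurableSet_Ici _
  -- The two densities `r e^{-rt}` and `r (1 - e^{-rt})` add up to `r`.
  rw [h1, lintegral_expMeasure hg, ← lintegral_const_mul _ (by fun_prop),
    ← lintegral_const_mul _ hg, ← lintegral_add_left (by fun_prop)]
  refine setLIntegral_congr_fun measurableSet_Ici fun t (ht : 0 ≤ t) => ?_
  have h2 : Real.exp (-(r * t)) ≤ 1 := by
    have : 0 ≤ r * t := mul_nonneg hr.le ht
    simpa using this
  rw [← mul_assoc, ← ENNReal.ofReal_mul hr.le, ← add_mul,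
    ← ENNReal.ofReal_add (by positivity) (mul_nonneg hr.le (by linarith))]
  congr 2; ring

section Arrivals

variable {Ω : Type*} [MeasurableSpace Ω] {P : Measure Ω} {T : ℕ → Ω → ℝ≥0}
  {η : ℝ}

theorem IsPoissonArrivals.indepFun_increment (hT : IsPoissonArrivals T η P) (k : ℕ) :
    IndepFun (fun ω => (T k ω : ℝ)) (fun ω => (T (k + 1) ω : ℝ) - (T k ω : ℝ)) P := by
  have hm : ∀ k, Measurable fun ω => (T (k + 1) ω : ℝ) - (T k ω : ℝ) := fun k =>
    (hT.measurable (k + 1)).coe_nnreal_real.sub (hT.measurable k).coe_nnreal_real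
  have h := hT.indep.indepFun_finsetSum_of_notMem hm (s := Finset.range k) (i := k) (by simp)
  refine h.congr ?_ (EventuallyEq.refl _ _)
  filter_upwards [hT.zero] with ω hω
  rw [Finset.sum_apply, Finset.sum_range_sub (fun k => (T k ω : ℝ)), hω]
  simp

theorem IsPoissonArrivals.lintegral_succ [IsProbabilityMeasure P] (hη : 0 < η)
    (hT : IsPoissonArrivals T η P) (k : ℕ)
    {g : ℝ → ℝ≥0∞} (hg : Measurable g) :
    ∫⁻ ω, g (T (k + 1) ω) ∂P = ∫⁻ ω, ∫⁻ t, g (T k ω + t) ∂(expMeasure η) ∂P := by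
  have := isProbabilityMeasure_expMeasure hη
  have m1 : Measurable fun ω => (T k ω : ℝ) := (hT.measurable k).coe_nnreal_real
  have m2 : Measurable fun ω => (T (k + 1) ω : ℝ) - (T k ω : ℝ) :=
    (hT.measurable (k + 1)).coe_nnreal_real.sub m1
  have h := (indepFun_iff_map_prod_eq_prod_map_map m1.aemeasurable m2.aemeasurable).mp
    (hT.indepFun_increment k)
  rw [hT.law k] at h
  have hG : Measurable fun p : ℝ × ℝ => g (p.1 + p.2) := by fun_prop
  calc ∫⁻ ω, g (T (k + 1) ω) ∂P
      = ∫⁻ ω, (fun p : ℝ × ℝ => g (p.1 + p.2)) ((T k ω : ℝ), (T (k + 1) ω : ℝ) - (T k ω : ℝ)) ∂P := by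
        simp
    _ = ∫⁻ s, ∫⁻ t, g (s + t) ∂(expMeasure η) ∂(P.map fun ω => (T k ω : ℝ)) := by
        rw [← lintegral_map hG (m1.prodMk m2), h, lintegral_prod _ hG.aemeasurable]
    _ = _ := lintegral_map (Measurable.lintegral_prod_right' hG) m1

/-- Induction on `n` for all `g` at once. Removing the last interarrival time replaces `g` by `G s =
∫ g (s + t)` against the exponential law and lowers the index by one; the term of the first arrival
is the one that the renewal identity absorbs. The inequality is all that the moment bounds and the
null sets require. -/
theorem IsPoissonArrivals.sum_lintegral_le [IsProbabilityMeasure P] (hη : 0 < η)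
    (hT : IsPoissonArrivals T η P) (n : ℕ)
    {g : ℝ → ℝ≥0∞} (hg : Measurable g) :
    ∑ k ∈ Finset.range n, ∫⁻ ω, g (T (k + 1) ω) ∂P
      ≤ ENNReal.ofReal η * ∫⁻ t in Ici (0 : ℝ), g t := by
  have := isProbabilityMeasure_expMeasure hη
  induction n generalizing g with
  | zero => simp
  | succ n ih =>
    have hG : Measurable fun s => ∫⁻ t, g (s + t) ∂(expMeasure η) :=
      Measurable.lintegral_prod_right' (f := fun p : ℝ × ℝ => g (p.1 + p.2)) (by fun_prop)
    rw [Finset.sum_range_succ', ← lintegral_expMeasure_renewal hη hg, add_comm]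
    refine add_le_add (le_of_eq ?_) ?_
    · rw [hT.lintegral_succ hη 0 hg]
      have : ∀ᵐ ω ∂P, ∫⁻ t, g (T 0 ω + t) ∂(expMeasure η) = ∫⁻ t, g t ∂(expMeasure η) := by
        filter_upwards [hT.zero] with ω hω
        simp [hω]
      rw [lintegral_congr_ae this]
      simp
    · refine le_trans (le_of_eq (Finset.sum_congr rfl fun k _ => ?_)) (ih hG)
      exact hT.lintegral_succ hη (k + 1) hg

theorem IsPoissonArrivals.tsum_lintegral_le [IsProbabilityMeasure P] (hη : 0 < η)
    (hT : IsPoissonArrivals T η P)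
    {g : ℝ → ℝ≥0∞} (hg : Measurable g) :
    ∑' k, ∫⁻ ω, g (T (k + 1) ω) ∂P ≤ ENNReal.ofReal η * ∫⁻ t in Ici (0 : ℝ), g t := by
  rw [ENNReal.tsum_eq_iSup_nat]
  exact iSup_le fun n => hT.sum_lintegral_le hη n hg

theorem IsPoissonArrivals.strictMono (hη : 0 < η) (hT : IsPoissonArrivals T η P) :
    ∀ᵐ ω ∂P, StrictMono fun k => T k ω := by
  have h : ∀ k, ∀ᵐ ω ∂P, T k ω < T (k + 1) ω := fun k => by
    have m2 : Measurable fun ω => (T (k + 1) ω : ℝ) - (T k ω : ℝ) :=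
      (hT.measurable (k + 1)).coe_nnreal_real.sub (hT.measurable k).coe_nnreal_real
    have h0 : ∀ᵐ x ∂(P.map fun ω => (T (k + 1) ω : ℝ) - (T k ω : ℝ)), 0 < x := by
      have h3 : expMeasure η (Iic 0) = 0 := by rw [expMeasure_Iic hη le_rfl]; simp
      rw [hT.law k, ae_iff]
      simp only [not_lt]
      exact h3
    filter_upwards [ae_of_ae_map m2.aemeasurable h0] with ω hω
    rw [← NNReal.coe_lt_coe]; linarith
  filter_upwards [ae_all_iff.mpr h] with ω hω
  exact strictMono_nat_of_lt_succ hω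

/-- The sum of `e^{-T (k + 1)}` has finite expectation, so its terms almost surely tend to `0`. -/
theorem IsPoissonArrivals.tendsto_atTop [IsProbabilityMeasure P] (hη : 0 < η)
    (hT : IsPoissonArrivals T η P) :
    ∀ᵐ ω ∂P, Tendsto (fun k => T k ω) atTop atTop := by
  have hg : Measurable fun t : ℝ => ENNReal.ofReal (Real.exp (-t)) := by fun_prop
  have h1 : ∫⁻ ω, ∑' k, ENNReal.ofReal (Real.exp (-(T (k + 1) ω : ℝ))) ∂P < ⊤ := by
    rw [lintegral_tsum (f := fun k ω => ENNReal.ofReal (Real.exp (-(T (k + 1) ω : ℝ))))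
      fun k => (hg.comp (hT.measurable (k + 1)).coe_nnreal_real).aemeasurable]
    refine (hT.tsum_lintegral_le hη hg).trans_lt (ENNReal.mul_lt_top (by simp) ?_)
    have : IntegrableOn (fun t : ℝ => Real.exp (-t)) (Ici 0) := by
      rw [integrableOn_Ici_iff_integrableOn_Ioi]
      exact integrableOn_exp_neg_Ioi 0
    have h2 := this.2
    rwa [hasFiniteIntegral_iff_ofReal (ae_of_all _ fun t => by positivity)] at h2
  have hm : Measurable fun ω => ∑' k, ENNReal.ofReal (Real.exp (-(T (k + 1) ω : ℝ))) :=
    Measurable.tsum fun k => hg.comp (hT.measurable (k + 1)).coe_nnreal_real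
  filter_upwards [ae_lt_top hm h1.ne] with ω hω
  have h3 := ENNReal.tendsto_atTop_zero_of_tsum_ne_top hω.ne
  rw [← tendsto_add_atTop_iff_nat 1]
  have h4 : Tendsto (fun k => Real.exp (-(T (k + 1) ω : ℝ))) atTop (𝓝 0) := by
    have := (ENNReal.tendsto_toReal ENNReal.zero_ne_top).comp h3
    refine this.congr fun k => ?_
    simp [ENNReal.toReal_ofReal (Real.exp_pos _).le]
  have h5 := (Real.tendsto_exp_comp_nhds_zero.mp h4)
  rw [tendsto_neg_atBot_iff] at h5
  exact NNReal.tendsto_coe_atTop.mp h5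

end Arrivals

/-! ### A jointly measurable version of a càdlàg process -/

/-- The point of the grid `ℕ / (n + 1)` that follows `t`. -/
noncomputable def gridAfter (n : ℕ) (t : ℝ≥0) : ℝ≥0 := ((⌊t * (n + 1)⌋₊ + 1 : ℕ) : ℝ≥0) / (n + 1)

/-- The evaluation of a path at `t`, as a limit from the right along grid points. -/
noncomputable def rightLimitEval (t : ℝ≥0) (p : ℝ≥0 → ℝ) : ℝ :=
  limsup (fun n : ℕ => p (gridAfter n t)) atTop

/-- The grid index takes countably many values, so each approximation is pieced together from
coordinate evaluations. Measurability jointly in time and path is what permits conditioning on an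
independent time. -/
theorem measurable_rightLimitEval :
    Measurable fun a : ℝ≥0 × (ℝ≥0 → ℝ) => rightLimitEval a.1 a.2 := by
  refine Measurable.limsup fun n => ?_
  have h1 : Measurable fun a : ℕ × (ℝ≥0 → ℝ) => a.2 (((a.1 + 1 : ℕ) : ℝ≥0) / (n + 1)) :=
    measurable_from_prod_countable_right fun k =>
      measurable_pi_apply (((k + 1 : ℕ) : ℝ≥0) / (n + 1))
  have h2 : Measurable fun a : ℝ≥0 × (ℝ≥0 → ℝ) => (⌊a.1 * (n + 1)⌋₊, a.2) :=
    (Nat.measurable_floor.comp (measurable_fst.mul_const _)).prodMk measurable_snd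
  exact h1.comp h2

theorem lt_gridAfter (n : ℕ) (t : ℝ≥0) : t < gridAfter n t := by
  unfold gridAfter
  rw [lt_div_iff₀ (by positivity)]
  exact_mod_cast Nat.lt_floor_add_one (t * (n + 1))

theorem gridAfter_le (n : ℕ) (t : ℝ≥0) : gridAfter n t ≤ t + 1 / (n + 1) := by
  unfold gridAfter
  rw [div_le_iff₀ (by positivity), add_mul, div_mul_cancel₀ _ (by positivity)]
  push_cast
  gcongr
  exact Nat.floor_le (by positivity)

theorem tendsto_gridAfter (t : ℝ≥0) : Tendsto (fun n => gridAfter n t) atTop (𝓝[≥] t) := by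
  refine tendsto_nhdsWithin_iff.mpr ⟨?_, Eventually.of_forall fun n => (lt_gridAfter n t).le⟩
  refine tendsto_of_tendsto_of_tendsto_of_le_of_le tendsto_const_nhds
    (h := fun n : ℕ => t + 1 / ((n : ℝ≥0) + 1)) ?_
    (fun n => (lt_gridAfter n t).le) (fun n => gridAfter_le n t)
  have := (tendsto_one_div_add_atTop_nhds_zero_nat (𝕜 := ℝ≥0)).const_add t
  simpa using this

theorem IsCadlag.rightLimitEval_eq {p : ℝ≥0 → ℝ} (hp : IsCadlag p) (t : ℝ≥0) :
    rightLimitEval t p = p t :=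
  ((hp t).1.tendsto.comp (tendsto_gridAfter t)).limsup_eq

attribute [irreducible] rightLimitEval

/-! ### The properties of the process and of the arrival times that are used below -/

/-- A jointly measurable process `Y` and times `T 1 < T 2 < ⋯ → ∞` such that `Y` has moments and no
atoms, with respect to the discounted time and at the times `T k`. -/
structure IsRegularPair {Ω : Type*} [MeasurableSpace Ω] (P : Measure Ω) (Y : ℝ≥0 → Ω → ℝ)
    (T : ℕ → Ω → ℝ≥0) (q : ℝ) : Prop where
  measurable : Measurable fun a : ℝ≥0 × Ω => Y a.1 a.2
  measurable_time : ∀ k, Measurable (T k)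
  zero : ∀ᵐ ω ∂P, T 0 ω = 0
  strictMono : ∀ᵐ ω ∂P, StrictMono fun k => T k ω
  tendsto_atTop : ∀ᵐ ω ∂P, Tendsto (fun k => T k ω) atTop atTop
  moment : ∀ N : ℕ, ∫⁻ ω, (∫⁻ t in Ici (0 : ℝ),
    ENNReal.ofReal (Real.exp (-q * t) * |Y t.toNNReal ω| ^ N)) ∂P < ⊤
  moment_arrival : ∀ N : ℕ, ∫⁻ ω, (∑' k, ENNReal.ofReal (Real.exp (-q * T (k + 1) ω)
    * |Y (T (k + 1) ω) ω| ^ N)) ∂P < ⊤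
  ne : ∀ y, ∀ᵐ a ∂(P.prod (volume.restrict (Ici (0 : ℝ)))), Y a.2.toNNReal a.1 ≠ y
  ne_arrival : ∀ y, ∀ᵐ ω ∂P, ∀ k, Y (T (k + 1) ω) ω ≠ y

/-! ### The resolvent of a Lévy process -/

theorem integral_expMeasure {r : ℝ} (hr : 0 < r) (g : ℝ → ℂ) :
    ∫ t, g t ∂(expMeasure r) = ∫ t in Ioi (0 : ℝ), (r * Real.exp (-(r * t)) : ℝ) * g t := by
  have e : expMeasure r = volume.withDensity (exponentialPDF r) := rfl
  have hm : Measurable (exponentialPDF r) := by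
    unfold exponentialPDF; exact (measurable_exponentialPDFReal r).ennreal_ofReal
  rw [e, integral_withDensity_eq_integral_toReal_smul hm
    (ae_of_all _ fun x => by simp [exponentialPDF]), ← integral_Ici_eq_integral_Ioi,
    ← integral_indicator measurableSet_Ici]
  congr 1 with t
  by_cases ht : t ∈ Ici (0 : ℝ)
  · rw [indicator_of_mem ht, exponentialPDF_of_nonneg ht, ENNReal.toReal_ofReal (by positivity),
      Complex.real_smul]
  · rw [indicator_of_notMem ht, exponentialPDF_of_neg (not_le.mp ht)]; simp

section Resolvent

variable {Ω : Type*} [MeasurableSpace Ω]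

/-- The law of `Y` at an independent exponential time with rate `q`. -/
noncomputable def resolventLaw (P : Measure Ω) (Y : ℝ≥0 → Ω → ℝ) (q : ℝ) : Measure ℝ :=
  ((expMeasure q).prod P).map fun a => Y a.1.toNNReal a.2

variable {P : Measure Ω} [IsProbabilityMeasure P] {Y : ℝ≥0 → Ω → ℝ}

theorem measurable_toNNReal_comp (hY : Measurable fun a : ℝ≥0 × Ω => Y a.1 a.2) :
    Measurable fun a : ℝ × Ω => Y a.1.toNNReal a.2 :=
  hY.comp ((measurable_real_toNNReal.comp measurable_fst).prodMk measurable_snd)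

theorem isProbabilityMeasure_resolventLaw (hY : Measurable fun a : ℝ≥0 × Ω => Y a.1 a.2) {q : ℝ}
    (hq : 0 < q) : IsProbabilityMeasure (resolventLaw P Y q) := by
  have := isProbabilityMeasure_expMeasure hq
  exact Measure.isProbabilityMeasure_map (measurable_toNNReal_comp hY).aemeasurable

/-- By Fubini this is the Laplace transform `∫ q e^{-qt} e^{-tΨ} dt`, which converges because the
real part of `Ψ` is nonnegative. -/
theorem charFun_resolventLaw (hY : Measurable fun a : ℝ≥0 × Ω => Y a.1 a.2) {Ψ : ℝ → ℂ}
    (hre : ∀ u, 0 ≤ (Ψ u).re)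
    (hΨ : ∀ (t : ℝ≥0) (u : ℝ), charFun (P.map (Y t)) u = Complex.exp (-((t : ℝ) : ℂ) * Ψ u))
    {q : ℝ} (hq : 0 < q) (u : ℝ) : charFun (resolventLaw P Y q) u = q / (q + Ψ u) := by
  have := isProbabilityMeasure_expMeasure hq
  have hm := measurable_toNNReal_comp hY
  have hint : Integrable (fun a : ℝ × Ω => Complex.exp (u * Y a.1.toNNReal a.2 * Complex.I))
      ((expMeasure q).prod P) := by
    refine (integrable_const (1 : ℝ)).mono' ?_ (ae_of_all _ fun x => ?_)
    · exact (by fun_prop : Measurable fun y : ℝ => Complex.exp (u * y * Complex.I)).comp hm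
        |>.aestronglyMeasurable
    · rw [← Complex.ofReal_mul, Complex.norm_exp_ofReal_mul_I]
  have h1 : charFun (resolventLaw P Y q) u
      = ∫ t, Complex.exp (-((t.toNNReal : ℝ) : ℂ) * Ψ u) ∂(expMeasure q) := by
    rw [charFun_apply_real, resolventLaw, integral_map hm.aemeasurable (by fun_prop),
      integral_prod _ hint]
    refine integral_congr_ae (ae_of_all _ fun t => ?_)
    have hYt : Measurable (Y t.toNNReal) := hY.comp measurable_prodMk_left
    simp only
    rw [← hΨ, charFun_apply_real, integral_map hYt.aemeasurable (by fun_prop)]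
  have h2 : ∫ t in Ioi (0 : ℝ), (q * Real.exp (-(q * t)) : ℝ)
        * Complex.exp (-((t.toNNReal : ℝ) : ℂ) * Ψ u)
      = ∫ t in Ioi (0 : ℝ), (q : ℂ) * Complex.exp (-(q + Ψ u) * t) := by
    refine setIntegral_congr_fun measurableSet_Ioi fun t ht => ?_
    rw [Real.coe_toNNReal t (le_of_lt ht)]
    push_cast
    rw [mul_assoc, ← Complex.exp_add]
    congr 2; ring
  have hneg : (-(q + Ψ u)).re < 0 := by
    have := hre u
    simp; linarith
  have h0 : (q : ℂ) + Ψ u ≠ 0 := fun h => by simp [h] at hneg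
  rw [h1, integral_expMeasure hq, h2, integral_const_mul, integral_exp_mul_complex_Ioi hneg]
  simp only [Complex.ofReal_zero, mul_zero, Complex.exp_zero]
  field_simp

theorem lintegral_resolventLaw (hY : Measurable fun a : ℝ≥0 × Ω => Y a.1 a.2) {q : ℝ} (hq : 0 < q)
    {g : ℝ → ℝ≥0∞} (hg : Measurable g) :
    ∫⁻ x, g x ∂(resolventLaw P Y q) = ENNReal.ofReal q * ∫⁻ t in Ici (0 : ℝ),
      ENNReal.ofReal (Real.exp (-q * t)) * ∫⁻ ω, g (Y t.toNNReal ω) ∂P := by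
  have := isProbabilityMeasure_expMeasure hq
  have hm := measurable_toNNReal_comp hY
  have hgm : Measurable fun a : ℝ × Ω => g (Y a.1.toNNReal a.2) := hg.comp hm
  have h1 : Measurable fun t : ℝ => ∫⁻ ω, g (Y t.toNNReal ω) ∂P :=
    Measurable.lintegral_prod_right' hgm
  rw [resolventLaw, lintegral_map hg hm, lintegral_prod _ hgm.aemeasurable,
    lintegral_expMeasure h1, ← lintegral_const_mul _ (by fun_prop)]
  refine lintegral_congr fun t => ?_
  rw [ENNReal.ofReal_mul hq.le, mul_assoc, neg_mul]

end Resolvent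

/-! ### Moments and absence of atoms for a Lévy process at independent arrival times -/

section Pair

variable {Ω : Type*} [MeasurableSpace Ω] {P : Measure Ω}
  {X : ℝ≥0 → Ω → ℝ} {T : ℕ → Ω → ℝ≥0}

/-- The jointly measurable version of `X`. -/
noncomputable def jointVersion (X : ℝ≥0 → Ω → ℝ) (t : ℝ≥0) (ω : Ω) : ℝ :=
  rightLimitEval t fun s => X s ω

theorem IsLevyProcess.jointVersion_eq (hX : IsLevyProcess X P) :
    ∀ᵐ ω ∂P, ∀ t, jointVersion X t ω = X t ω := by
  filter_upwards [hX.cadlag] with ω hω t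
  exact hω.rightLimitEval_eq t

theorem IsLevyProcess.measurable_path (hX : IsLevyProcess X P) :
    Measurable fun ω => fun t : ℝ≥0 => X t ω :=
  measurable_pi_iff.mpr hX.measurable

theorem IsLevyProcess.measurable_jointVersion (hX : IsLevyProcess X P) :
    Measurable fun a : ℝ≥0 × Ω => jointVersion X a.1 a.2 := by
  have h : Measurable fun a : ℝ≥0 × Ω => (a.1, fun t : ℝ≥0 => X t a.2) :=
    measurable_fst.prodMk (hX.measurable_path.comp measurable_snd)
  exact measurable_rightLimitEval.comp h

/-- `jointVersion` is a measurable functional of time and path. Since the path is independent of `T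
k`, the time can be frozen and the path averaged separately. -/
theorem IsLevyProcess.lintegral_arrival [IsProbabilityMeasure P]
    (hX : IsLevyProcess X P)
    (hT : ∀ k, Measurable (T k))
    (hXT : IndepFun (fun ω => fun t : ℝ≥0 => X t ω) (fun ω => fun k : ℕ => T k ω) P) (k : ℕ)
    {H : ℝ≥0 × ℝ → ℝ≥0∞} (hH : Measurable H) :
    ∫⁻ ω, H (T k ω, jointVersion X (T k ω) ω) ∂P
      = ∫⁻ ω, ∫⁻ ω', H (T k ω, jointVersion X (T k ω) ω') ∂P ∂P := by
  have hind : IndepFun (T k) (fun ω => fun t : ℝ≥0 => X t ω) P :=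
    (hXT.comp measurable_id (measurable_pi_apply k)).symm
  have h := (indepFun_iff_map_prod_eq_prod_map_map (hT k).aemeasurable
    hX.measurable_path.aemeasurable).mp hind
  have : IsProbabilityMeasure (P.map fun ω => fun t : ℝ≥0 => X t ω) :=
    Measure.isProbabilityMeasure_map hX.measurable_path.aemeasurable
  have hG : Measurable fun a : ℝ≥0 × (ℝ≥0 → ℝ) => H (a.1, rightLimitEval a.1 a.2) :=
    hH.comp (measurable_fst.prodMk measurable_rightLimitEval)
  calc ∫⁻ ω, H (T k ω, jointVersion X (T k ω) ω) ∂P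
      = ∫⁻ a, H (a.1, rightLimitEval a.1 a.2) ∂(P.map fun ω => (T k ω, fun t : ℝ≥0 => X t ω)) := by
        rw [lintegral_map hG ((hT k).prodMk hX.measurable_path)]; rfl
    _ = ∫⁻ s, ∫⁻ p, H (s, rightLimitEval s p) ∂(P.map fun ω => fun t : ℝ≥0 => X t ω)
          ∂(P.map (T k)) := by
        rw [h, lintegral_prod _ hG.aemeasurable]
    _ = ∫⁻ ω, ∫⁻ p, H (T k ω, rightLimitEval (T k ω) p) ∂(P.map fun ω => fun t : ℝ≥0 => X t ω)
          ∂P := lintegral_map (Measurable.lintegral_prod_right' hG) (hT k)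
    _ = _ := by
        refine lintegral_congr fun ω => ?_
        exact lintegral_map (hG.comp measurable_prodMk_left) hX.measurable_path

theorem IsLevyProcess.tsum_lintegral_arrival_le [IsProbabilityMeasure P]
    (hX : IsLevyProcess X P) {η : ℝ} (hη : 0 < η)
    (hT : IsPoissonArrivals T η P)
    (hXT : IndepFun (fun ω => fun t : ℝ≥0 => X t ω) (fun ω => fun k : ℕ => T k ω) P)
    {H : ℝ≥0 × ℝ → ℝ≥0∞} (hH : Measurable H) :
    ∑' k, ∫⁻ ω, H (T (k + 1) ω, jointVersion X (T (k + 1) ω) ω) ∂P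
      ≤ ENNReal.ofReal η
        * ∫⁻ t in Ici (0 : ℝ), ∫⁻ ω, H (t.toNNReal, jointVersion X t.toNNReal ω) ∂P := by
  have hm : Measurable fun a : ℝ × Ω => H (a.1.toNNReal, jointVersion X a.1.toNNReal a.2) :=
    hH.comp ((measurable_real_toNNReal.comp measurable_fst).prodMk
      (measurable_toNNReal_comp hX.measurable_jointVersion))
  have hg : Measurable fun t : ℝ => ∫⁻ ω, H (t.toNNReal, jointVersion X t.toNNReal ω) ∂P :=
    Measurable.lintegral_prod_right' hm
  refine le_trans (le_of_eq (tsum_congr fun k => ?_)) (hT.tsum_lintegral_le hη hg)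
  rw [hX.lintegral_arrival hT.measurable hXT (k + 1) hH]
  simp only [Real.toNNReal_coe]

theorem IsLevyProcess.isRegularPair [IsProbabilityMeasure P]
    (hX : IsLevyProcess X P) {γ σ : ℝ} {ν : Measure ℝ} {η q : ℝ}
    (hq : 0 < q) (hη : 0 < η) (hν : HasLevyTriplet X P γ σ ν) (hT : IsPoissonArrivals T η P)
    (hXT : IndepFun (fun ω => fun t : ℝ≥0 => X t ω) (fun ω => fun k : ℕ => T k ω) P)
    (hCP : ¬ IsDriftlessCompoundPoisson X P)
    (hexp : ∃ θ : ℝ, 0 < θ ∧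
      ∫⁻ z in {z : ℝ | 1 ≤ |z|}, ENNReal.ofReal (Real.exp (θ * |z|)) ∂ν < ⊤) :
    IsRegularPair P (jointVersion X) T q := by
  obtain ⟨θ, hθ, hexp⟩ := hexp
  set Ψ := levyExponent γ σ ν with hΨdef
  have hY := hX.measurable_jointVersion
  have hΨ : ∀ (t : ℝ≥0) (u : ℝ),
      charFun (P.map (jointVersion X t)) u = Complex.exp (-((t : ℝ) : ℂ) * Ψ u) := fun t u => by
    rw [← hν.charFun_eq t u]
    congr 1
    refine Measure.map_congr ?_
    filter_upwards [hX.jointVersion_eq] with ω hω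
    exact hω t
  -- A characteristic function has modulus at most `1`; apply this at time `1`.
  have hre : ∀ u, 0 ≤ (Ψ u).re := fun u => by
    have h1 := hν.charFun_eq 1 u
    have : IsProbabilityMeasure (P.map (X 1)) :=
      Measure.isProbabilityMeasure_map (hX.measurable 1).aemeasurable
    have h2 := norm_charFun_le_one (μ := P.map (X 1)) (t := u)
    rw [h1, Complex.norm_exp, Real.exp_le_one_iff] at h2
    simpa using h2
  have hprob : ∀ r, 0 < r → IsProbabilityMeasure (resolventLaw P (jointVersion X) r) :=
    fun r hr => isProbabilityMeasure_resolventLaw hY hr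
  have hcf : ∀ r, 0 < r → ∀ u, charFun (resolventLaw P (jointVersion X) r) u = r / (r + Ψ u) :=
    fun r hr u => charFun_resolventLaw hY hre hΨ hr u
  -- An atom would make `Ψ` bounded, and then `ν` itself serves as the jump measure of a driftless
  -- compound Poisson process.
  have hatom : ∀ y, resolventLaw P (jointVersion X) q {y} = 0 := fun y => by
    by_contra hy
    obtain ⟨K, hK⟩ := exists_bound_of_resolvent_atom hprob hre hcf hq hy
    obtain ⟨hfin, heq⟩ := levyExponent_eq_of_bound hν.levyMeasure hK
    exact hCP ⟨ν, hfin, fun t u => by rw [hν.charFun_eq, heq]⟩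
  have := hprob q hq
  have hq' : ENNReal.ofReal q ≠ 0 := by simpa using hq
  have hmom : ∀ N : ℕ, ∫⁻ t in Ici (0 : ℝ), ∫⁻ ω,
      ENNReal.ofReal (Real.exp (-q * t) * |jointVersion X t.toNNReal ω| ^ N) ∂P < ⊤ := fun N => by
    have h1 := (integrable_pow_of_charFun_eq hq (contDiff_levyExponent γ σ hν.levyMeasure hθ hexp)
      (levyExponent_zero γ σ ν) (hcf q hq) N).2
    rw [hasFiniteIntegral_iff_ofReal (ae_of_all _ fun x => by positivity),
      lintegral_resolventLaw hY hq (by fun_prop)] at h1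
    refine lt_of_le_of_lt (le_of_eq ?_) (ENNReal.lt_top_of_mul_ne_top_right h1.ne hq')
    refine lintegral_congr fun t => ?_
    have hYt : Measurable (jointVersion X t.toNNReal) := hY.comp measurable_prodMk_left
    rw [← lintegral_const_mul _ (by fun_prop)]
    refine lintegral_congr fun ω => ?_
    rw [ENNReal.ofReal_mul (Real.exp_pos _).le]
  have hzero : ∀ y, ∫⁻ t in Ici (0 : ℝ),
      ∫⁻ ω, indicator {y} (1 : ℝ → ℝ≥0∞) (jointVersion X t.toNNReal ω) ∂P = 0 := fun y => by
    have hind : Measurable (indicator {y} (1 : ℝ → ℝ≥0∞)) :=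
      measurable_one.indicator (measurableSet_singleton y)
    have h1 := hatom y
    rw [← lintegral_indicator_one (measurableSet_singleton y),
      lintegral_resolventLaw hY hq hind, mul_eq_zero, or_iff_right hq'] at h1
    have hm : Measurable fun t : ℝ =>
        ∫⁻ ω, indicator {y} (1 : ℝ → ℝ≥0∞) (jointVersion X t.toNNReal ω) ∂P :=
      Measurable.lintegral_prod_right' (hind.comp (measurable_toNNReal_comp hY))
    rw [lintegral_eq_zero_iff (by fun_prop)] at h1
    rw [lintegral_eq_zero_iff hm]
    filter_upwards [h1] with t ht
    refine (mul_eq_zero.mp ht).resolve_left ?_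
    simpa using Real.exp_pos _
  have hTm := hT.measurable
  have hYT : ∀ k, Measurable fun ω => jointVersion X (T k ω) ω := fun k =>
    hY.comp ((hTm k).prodMk measurable_id)
  refine ⟨hY, hTm, hT.zero, hT.strictMono hη, hT.tendsto_atTop hη, fun N => ?_, fun N => ?_,
    fun y => ?_, fun y => ?_⟩
  · have hm : Measurable fun a : Ω × ℝ =>
        ENNReal.ofReal (Real.exp (-q * a.2) * |jointVersion X a.2.toNNReal a.1| ^ N) := by
      have := (measurable_toNNReal_comp hY).comp (measurable_swap (α := Ω) (β := ℝ))
      have h2 : Measurable fun a : Ω × ℝ => jointVersion X a.2.toNNReal a.1 := this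
      fun_prop
    rw [lintegral_lintegral_swap hm.aemeasurable]
    exact hmom N
  · have hH : Measurable fun a : ℝ≥0 × ℝ =>
        ENNReal.ofReal (Real.exp (-q * (a.1 : ℝ)) * |a.2| ^ N) := by fun_prop
    have h1 := hX.tsum_lintegral_arrival_le hη hT hXT hH
    have hHk : ∀ k, Measurable fun ω => ENNReal.ofReal (Real.exp (-q * (T (k + 1) ω : ℝ))
        * |jointVersion X (T (k + 1) ω) ω| ^ N) := fun k =>
      hH.comp ((hTm (k + 1)).prodMk (hYT (k + 1)))
    rw [lintegral_tsum fun k => (hHk k).aemeasurable]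
    refine h1.trans_lt (ENNReal.mul_lt_top (by simp) ?_)
    refine lt_of_le_of_lt (le_of_eq ?_) (hmom N)
    refine setLIntegral_congr_fun measurableSet_Ici fun t ht => ?_
    simp only [Real.coe_toNNReal t ht]
  · have hm : Measurable fun a : ℝ × Ω => jointVersion X a.1.toNNReal a.2 :=
      measurable_toNNReal_comp hY
    have h2 : Measurable fun a : Ω × ℝ => jointVersion X a.2.toNNReal a.1 := hm.comp measurable_swap
    have hs : MeasurableSet {a : Ω × ℝ | jointVersion X a.2.toNNReal a.1 = y} :=
      h2 (measurableSet_singleton y)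
    rw [ae_iff]
    simp only [ne_eq, not_not]
    rw [← lintegral_indicator_one hs, lintegral_prod_symm _ (measurable_one.indicator hs).aemeasurable]
    exact hzero y
  · have hH : Measurable fun a : ℝ≥0 × ℝ => indicator {y} (1 : ℝ → ℝ≥0∞) a.2 :=
      (measurable_one.indicator (measurableSet_singleton y)).comp measurable_snd
    have h1 := hX.tsum_lintegral_arrival_le hη hT hXT hH
    simp only [hzero y, mul_zero, nonpos_iff_eq_zero, ENNReal.tsum_eq_zero] at h1
    rw [ae_all_iff]
    intro k
    have h2 := h1 k
    have hHk : Measurable fun ω =>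
        indicator {y} (1 : ℝ → ℝ≥0∞) (jointVersion X (T (k + 1) ω) ω) :=
      hH.comp ((hTm (k + 1)).prodMk (hYT (k + 1)))
    rw [lintegral_eq_zero_iff hHk] at h2
    filter_upwards [h2] with ω hω h3
    simp [h3] at hω

end Pair

/-! ### The periodic barrier strategy, path by path -/

section Pathwise

/-- The value of the uncontrolled path at the last control time, and `b` before the first one. -/
noncomputable def controlLevel (w : ℝ≥0 → ℝ) (τ : ℕ → ℝ≥0) (b : ℝ) (n : ℕ) : ℝ :=
  if n = 0 then b else w (controlTime w τ b n).toNNReal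

variable {w : ℝ≥0 → ℝ} {τ : ℕ → ℝ≥0} {b : ℝ}

/-- The level `b` cancels: the shifted path is below `b` exactly when `w` is below its value at the
last control. Control times are thus successive record lows below `b` among the observed values, and
control sizes telescope. -/
theorem shiftedPath_controlTime (n : ℕ) (t : ℝ≥0) :
    shiftedPath w b n (controlTime w τ b n) t = b + (w t - controlLevel w τ b n) := by
  unfold shiftedPath controlLevel
  split_ifs <;> ring

theorem controlSize_eq (n : ℕ) :
    controlSize w τ b n = controlLevel w τ b n - controlLevel w τ b (n + 1) := by
  rw [controlSize, shiftedPath_controlTime]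
  simp only [controlLevel, Nat.add_eq_zero_iff, one_ne_zero, and_false, if_false]
  ring

theorem controlTime_zero : controlTime w τ b 0 = 0 := rfl

theorem controlTime_succ (n : ℕ) : controlTime w τ b (n + 1) =
    sInf {s : ℝ≥0∞ | ∃ k : ℕ, 1 ≤ k ∧ s = (τ k : ℝ≥0∞) ∧ controlTime w τ b n < s ∧
      w (τ k) < controlLevel w τ b n} := by
  rw [controlTime]
  simp only [shiftedPath_controlTime]
  congr 1
  ext s
  simp only [mem_ofPred_eq]
  refine exists_congr fun k => and_congr_right fun _ => and_congr_right fun _ =>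
    and_congr_right fun _ => ⟨fun h => by linarith, fun h => by linarith⟩

theorem controlTime_succ_le {n k : ℕ} (hk : 1 ≤ k) (h1 : controlTime w τ b n < τ k)
    (h2 : w (τ k) < controlLevel w τ b n) : controlTime w τ b (n + 1) ≤ τ k := by
  rw [controlTime_succ]
  exact sInf_le ⟨k, hk, rfl, h1, h2⟩

/-- As `τ` is increasing, the infimum is attained at the smallest admissible index. -/
theorem exists_controlTime_succ_eq (hτ : StrictMono τ) {n : ℕ}
    (h : controlTime w τ b (n + 1) ≠ ⊤) :
    ∃ k, 1 ≤ k ∧ controlTime w τ b (n + 1) = τ k ∧ controlTime w τ b n < τ k ∧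
      w (τ k) < controlLevel w τ b n := by
  classical
  rw [controlTime_succ] at h ⊢
  have hne : ∃ k : ℕ, 1 ≤ k ∧ controlTime w τ b n < τ k ∧ w (τ k) < controlLevel w τ b n := by
    by_contra hcon
    apply h
    rw [sInf_eq_top]
    rintro s ⟨k, hk, rfl, h1, h2⟩
    exact absurd ⟨k, hk, h1, h2⟩ hcon
  have hs := Nat.find_spec hne
  refine ⟨Nat.find hne, hs.1, ?_, hs.2⟩
  refine IsLeast.csInf_eq ⟨⟨_, hs.1, rfl, hs.2⟩, ?_⟩
  rintro s ⟨k, hk, rfl, h1, h2⟩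
  have := Nat.find_min' hne ⟨hk, h1, h2⟩
  exact_mod_cast hτ.monotone this

theorem controlTime_le_succ (hτ : StrictMono τ) (n : ℕ) :
    controlTime w τ b n ≤ controlTime w τ b (n + 1) := by
  by_cases h : controlTime w τ b (n + 1) = ⊤
  · rw [h]; exact le_top
  · obtain ⟨k, _, h1, h2, _⟩ := exists_controlTime_succ_eq hτ h
    rw [h1]; exact h2.le

theorem monotone_controlTime (hτ : StrictMono τ) : Monotone (controlTime w τ b) :=
  monotone_nat_of_le_succ (controlTime_le_succ hτ)

theorem controlLevel_succ_lt (hτ : StrictMono τ) {n : ℕ} (h : controlTime w τ b (n + 1) ≠ ⊤) :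
    controlLevel w τ b (n + 1) < controlLevel w τ b n := by
  obtain ⟨k, _, h1, _, h3⟩ := exists_controlTime_succ_eq hτ h
  have : controlLevel w τ b (n + 1) = w (τ k) := by
    unfold controlLevel
    rw [if_neg (by simp), h1]
    simp
  rwa [this]

/-- Every control uses up at least one opportunity; hence only finitely many controls occur in
bounded time. -/
theorem le_controlTime (hτ0 : τ 0 = 0) (hτ : StrictMono τ) (n : ℕ) :
    (τ n : ℝ≥0∞) ≤ controlTime w τ b n := by
  induction n with
  | zero => simp [hτ0]
  | succ n ih =>
    by_cases h : controlTime w τ b (n + 1) = ⊤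
    · rw [h]; exact le_top
    · obtain ⟨k, _, h1, h2, _⟩ := exists_controlTime_succ_eq hτ h
      have : (τ n : ℝ≥0∞) < τ k := ih.trans_lt h2
      have hnk : n < k := hτ.lt_iff_lt.mp (by exact_mod_cast this)
      rw [h1]
      exact_mod_cast hτ.monotone hnk

/-- The current level is a lower bound for all values observed before the next control. An
observation after the last control that broke it would itself trigger a control; earlier ones are
covered by induction, since levels decrease. -/
theorem controlLevel_le_of_lt (hτ0 : τ 0 = 0) (hτ : StrictMono τ) {n : ℕ}
    (hn : controlTime w τ b n ≠ ⊤) {k : ℕ} (hk : 1 ≤ k) (h : τ k < controlTime w τ b (n + 1)) :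
    controlLevel w τ b n ≤ w (τ k) := by
  induction n with
  | zero =>
    by_contra! hlt
    refine absurd (controlTime_succ_le hk ?_ hlt) (not_le.mpr h)
    have : τ 0 < τ k := hτ hk
    rw [hτ0] at this
    rw [controlTime_zero]
    exact_mod_cast this
  | succ n ih =>
    rcases lt_trichotomy (τ k : ℝ≥0∞) (controlTime w τ b (n + 1)) with h1 | h1 | h1
    · have h2 := ih (ne_top_of_le_ne_top hn (controlTime_le_succ hτ n)) h1
      exact (controlLevel_succ_lt hτ hn).le.trans h2
    · unfold controlLevel
      rw [if_neg (by simp), ← h1]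
      simp
    · by_contra! hlt
      exact absurd (controlTime_succ_le hk h1 hlt) (not_le.mpr h)

theorem exists_controlTime_le_lt (hτ0 : τ 0 = 0) (hτ : StrictMono τ) (hτt : Tendsto τ atTop atTop)
    (t : ℝ≥0) :
    ∃ n, controlTime w τ b n ≤ t ∧ (t : ℝ≥0∞) < controlTime w τ b (n + 1) := by
  classical
  have hex : ∃ n, (t : ℝ≥0∞) < controlTime w τ b n := by
    obtain ⟨n, hn⟩ := (hτt.eventually_gt_atTop t).exists
    exact ⟨n, lt_of_lt_of_le (by exact_mod_cast hn) (le_controlTime hτ0 hτ n)⟩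
  have h0 : Nat.find hex ≠ 0 := fun h => by
    have := Nat.find_spec hex
    rw [h, controlTime_zero] at this
    simp at this
  obtain ⟨n, hn⟩ := Nat.exists_eq_succ_of_ne_zero h0
  refine ⟨n, not_lt.mp (Nat.find_min hex (m := n) (by omega)), ?_⟩
  have := Nat.find_spec hex
  rwa [hn] at this

theorem barrierControl_eq_sum (hτ : StrictMono τ) {t : ℝ≥0} {n : ℕ}
    (h1 : controlTime w τ b n ≤ t) (h2 : (t : ℝ≥0∞) < controlTime w τ b (n + 1)) :
    barrierControl w τ b t = b - controlLevel w τ b n := by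
  classical
  have hm := monotone_controlTime (w := w) (b := b) hτ
  unfold barrierControl
  rw [tsum_eq_sum (s := Finset.range n)]
  · rw [Finset.sum_congr rfl (g := fun j => controlLevel w τ b j - controlLevel w τ b (j + 1)),
      Finset.sum_range_sub', controlLevel, if_pos rfl]
    intro j hj
    rw [if_pos ((hm (Nat.succ_le_of_lt (Finset.mem_range.mp hj))).trans h1), controlSize_eq]
  · intro j hj
    rw [if_neg]
    rw [not_le]
    refine h2.trans_le (hm ?_)
    rw [Finset.mem_range] at hj
    omega

theorem barrierControl_cases (hτ0 : τ 0 = 0) (hτ : StrictMono τ) (hτt : Tendsto τ atTop atTop)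
    (t : ℝ≥0) :
    (barrierControl w τ b t = 0 ∧ ∀ k, 1 ≤ k → τ k ≤ t → b ≤ w (τ k)) ∨
    ∃ k, 1 ≤ k ∧ τ k ≤ t ∧ w (τ k) < b ∧ barrierControl w τ b t = b - w (τ k) ∧
      ∀ j, 1 ≤ j → τ j ≤ t → w (τ k) ≤ w (τ j) := by
  obtain ⟨n, h1, h2⟩ := exists_controlTime_le_lt (w := w) (b := b) hτ0 hτ hτt t
  have hR := barrierControl_eq_sum hτ h1 h2
  have hn : controlTime w τ b n ≠ ⊤ := ne_top_of_le_ne_top ENNReal.coe_ne_top h1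
  have hle : ∀ j, 1 ≤ j → τ j ≤ t → controlLevel w τ b n ≤ w (τ j) := fun j hj hjt =>
    controlLevel_le_of_lt hτ0 hτ hn hj (lt_of_le_of_lt (by exact_mod_cast hjt) h2)
  rcases Nat.eq_zero_or_pos n with rfl | hpos
  · left
    have : controlLevel w τ b 0 = b := rfl
    rw [this] at hR hle
    exact ⟨by rw [hR, sub_self], hle⟩
  · right
    obtain ⟨m, rfl⟩ := Nat.exists_eq_succ_of_ne_zero hpos.ne'
    obtain ⟨k, hk, hk1, hk2, hk3⟩ := exists_controlTime_succ_eq hτ hn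
    have hl : controlLevel w τ b (m + 1) = w (τ k) := by
      unfold controlLevel
      rw [if_neg (by simp), hk1]
      simp
    simp only [Nat.succ_eq_add_one] at *
    rw [hl] at hR hle
    refine ⟨k, hk, ?_, ?_, hR, hle⟩
    · rw [hk1] at h1; exact_mod_cast h1
    · refine hk3.trans_le ?_
      -- The sequence is frozen after `m + 1`, because later control times may be infinite and the
      -- level is then a meaningless default value.
      have : Antitone fun j => if j ≤ m + 1 then controlLevel w τ b j else
          controlLevel w τ b (m + 1) := by
        refine antitone_nat_of_succ_le fun j => ?_
        by_cases hj : j + 1 ≤ m + 1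
        · rw [if_pos hj, if_pos (by omega)]
          exact (controlLevel_succ_lt hτ
            (ne_top_of_le_ne_top hn (monotone_controlTime hτ hj))).le
        · rw [if_neg hj]
          split_ifs with hj2
          · have : j = m + 1 := by omega
            rw [this]
          · exact le_rfl
      have h3 := this (Nat.zero_le m)
      simpa [controlLevel] using h3

theorem lt_controlTime_one_iff (hτ0 : τ 0 = 0) (hτ : StrictMono τ) (t : ℝ≥0) :
    (t : ℝ≥0∞) < controlTime w τ b 1 ↔ ∀ k, 1 ≤ k → τ k ≤ t → b ≤ w (τ k) := by
  constructor
  · intro h k hk hkt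
    exact controlLevel_le_of_lt (n := 0) hτ0 hτ (by simp [controlTime_zero]) hk
      (lt_of_le_of_lt (by exact_mod_cast hkt) h)
  · intro h
    by_contra! hle
    obtain ⟨k, hk, h1, _, h3⟩ := exists_controlTime_succ_eq (n := 0) hτ
      (ne_top_of_le_ne_top ENNReal.coe_ne_top hle)
    simp only [zero_add] at h1
    rw [h1] at hle
    exact absurd (h k hk (by exact_mod_cast hle)) (not_le.mpr h3)

theorem barrierControl_nonneg (hτ0 : τ 0 = 0) (hτ : StrictMono τ) (hτt : Tendsto τ atTop atTop)
    (t : ℝ≥0) : 0 ≤ barrierControl w τ b t := by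
  rcases barrierControl_cases (w := w) (b := b) hτ0 hτ hτt t with ⟨h, _⟩ | ⟨k, _, _, h1, h2, _⟩
  · exact h.ge
  · rw [h2]; linarith

/-- The control as a countable supremum over fixed indices, a form in which measurability in `(ω,
t)` is visible. -/
theorem ofReal_barrierControl_eq_iSup (hτ0 : τ 0 = 0) (hτ : StrictMono τ)
    (hτt : Tendsto τ atTop atTop) (t : ℝ≥0) :
    ENNReal.ofReal (barrierControl w τ b t)
      = ⨆ k : ℕ, if τ (k + 1) ≤ t then ENNReal.ofReal (b - w (τ (k + 1))) else 0 := by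
  refine le_antisymm ?_ (iSup_le fun k => ?_)
  · rcases barrierControl_cases (w := w) (b := b) hτ0 hτ hτt t with ⟨h, _⟩ | ⟨k, hk, hkt, _, h2, _⟩
    · rw [h]; simp
    · obtain ⟨j, rfl⟩ := Nat.exists_eq_succ_of_ne_zero (Nat.pos_iff_ne_zero.mp hk)
      refine le_iSup_of_le j ?_
      rw [if_pos hkt, h2]
  · split_ifs with hk
    · apply ENNReal.ofReal_le_ofReal
      rcases barrierControl_cases (w := w) (b := b) hτ0 hτ hτt t with ⟨h, h1⟩ | ⟨j, _, _, _, h2, h3⟩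
      · have := h1 (k + 1) (by omega) hk
        rw [h]; linarith
      · have := h3 (k + 1) (by omega) hk
        rw [h2]; linarith
    · exact zero_le

/-- The dependence of the control and of the first control time on the starting point. -/
theorem barrierControl_shift {p : ℝ≥0 → ℝ} (hτ0 : τ 0 = 0) (hτ : StrictMono τ)
    (hτt : Tendsto τ atTop atTop) (b : ℝ) (t : ℝ≥0) :
    (∀ x : ℝ, barrierControl (fun s => x + p s) τ b t = 0 ∧
      (t : ℝ≥0∞) < controlTime (fun s => x + p s) τ b 1) ∨
    ∃ k : ℕ, ∀ x : ℝ, barrierControl (fun s => x + p s) τ b t = max 0 (b - p (τ (k + 1)) - x) ∧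
      ((t : ℝ≥0∞) < controlTime (fun s => x + p s) τ b 1 ↔ b - p (τ (k + 1)) ≤ x) := by
  have hfin : {j : ℕ | τ (j + 1) ≤ t}.Finite := by
    obtain ⟨n, hn⟩ := (hτt.eventually_gt_atTop t).exists
    refine (finite_lt_nat n).subset fun j hj => ?_
    have hj' : τ (j + 1) ≤ t := hj
    have : j + 1 < n := hτ.lt_iff_lt.mp (hj'.trans_lt hn)
    exact (Nat.lt_succ_self j).trans this
  rcases eq_empty_or_nonempty {j : ℕ | τ (j + 1) ≤ t} with hemp | hne
  · left
    have hno : ∀ k, 1 ≤ k → ¬ τ k ≤ t := fun k hk hkt => by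
      obtain ⟨j, rfl⟩ := Nat.exists_eq_succ_of_ne_zero (Nat.pos_iff_ne_zero.mp hk)
      have : j ∈ {j : ℕ | τ (j + 1) ≤ t} := hkt
      rw [hemp] at this
      exact this
    intro x
    refine ⟨?_, (lt_controlTime_one_iff hτ0 hτ t).mpr fun k hk hkt => absurd hkt (hno k hk)⟩
    rcases barrierControl_cases (w := fun s => x + p s) (b := b) hτ0 hτ hτt t with
      ⟨h, _⟩ | ⟨k, hk, hkt, _⟩
    · exact h
    · exact absurd hkt (hno k hk)
  · right
    -- The index of the smallest observed value does not depend on `x`, so the same `k` works for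
    -- all starting points.
    obtain ⟨k, hk, hmin⟩ := exists_min_image _ (fun j => p (τ (j + 1))) hfin hne
    have hmin' : ∀ j, 1 ≤ j → τ j ≤ t → p (τ (k + 1)) ≤ p (τ j) := fun j hj hjt => by
      obtain ⟨i, rfl⟩ := Nat.exists_eq_succ_of_ne_zero (Nat.pos_iff_ne_zero.mp hj)
      exact hmin i hjt
    refine ⟨k, fun x => ⟨?_, ?_⟩⟩
    · rcases barrierControl_cases (w := fun s => x + p s) (b := b) hτ0 hτ hτt t with
        ⟨h, h1⟩ | ⟨j, hj, hjt, h1, h2, h3⟩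
      · have := h1 (k + 1) (by omega) hk
        rw [h, max_eq_left (by linarith)]
      · have e1 := hmin' j hj hjt
        have e2 := h3 (k + 1) (by omega) hk
        rw [h2, max_eq_right (by linarith)]
        linarith
    · rw [lt_controlTime_one_iff hτ0 hτ t]
      refine ⟨fun h => ?_, fun h j hj hjt => ?_⟩
      · have := h (k + 1) (by omega) hk
        linarith
      · have := hmin' j hj hjt
        linarith

theorem setLIntegral_Ici_exp {q : ℝ} (hq : 0 < q) (s : ℝ) :
    ∫⁻ t in Ici s, ENNReal.ofReal (q * Real.exp (-q * t)) = ENNReal.ofReal (Real.exp (-q * s)) := by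
  have hint : IntegrableOn (fun t => q * Real.exp (-q * t)) (Ioi s) :=
    (integrableOn_exp_mul_Ioi (by linarith) s).const_mul q
  rw [setLIntegral_congr Ioi_ae_eq_Ici.symm,
    ← ofReal_integral_eq_lintegral_ofReal hint (ae_of_all _ fun t => by positivity),
    integral_const_mul, integral_exp_mul_Ioi (by linarith)]
  congr 1
  field_simp

/-- Integration by parts through Tonelli: a jump at `s` is discounted by `e^{-qs} = ∫_s^∞ q e^{-qt}
dt`, and for given `t` the jumps up to `t` sum to `R_t`. -/
theorem lintegral_controlMeasure {q : ℝ} (hq : 0 < q) (hτ0 : τ 0 = 0) (hτ : StrictMono τ)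
    (hτt : Tendsto τ atTop atTop) :
    ∫⁻ t : ℝ≥0, ENNReal.ofReal (Real.exp (-q * t)) ∂(controlMeasure w τ b)
      = ∫⁻ t in Ici (0 : ℝ),
        ENNReal.ofReal (Real.exp (-q * t) * (q * barrierControl w τ b t.toNNReal)) := by
  classical
  have hsize : ∀ (t : ℝ≥0) (n : ℕ), controlTime w τ b (n + 1) ≤ t → 0 ≤ controlSize w τ b n :=
    fun t n h => by
      rw [controlSize_eq]
      have := controlLevel_succ_lt hτ (ne_top_of_le_ne_top ENNReal.coe_ne_top h)
      linarith
  have hR : ∀ t : ℝ≥0, ENNReal.ofReal (barrierControl w τ b t)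
      = ∑' n, if controlTime w τ b (n + 1) ≤ t then ENNReal.ofReal (controlSize w τ b n) else 0 := by
    intro t
    obtain ⟨n, h1, h2⟩ := exists_controlTime_le_lt (w := w) (b := b) hτ0 hτ hτt t
    have hm := monotone_controlTime (w := w) (b := b) hτ
    have hz : ∀ j, j ∉ Finset.range n → ¬ controlTime w τ b (j + 1) ≤ t := fun j hj => by
      rw [not_le]
      refine h2.trans_le (hm ?_)
      rw [Finset.mem_range] at hj
      omega
    unfold barrierControl
    rw [tsum_eq_sum (s := Finset.range n) fun j hj => if_neg (hz j hj),
      tsum_eq_sum (s := Finset.range n) fun j hj => if_neg (hz j hj),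
      ENNReal.ofReal_sum_of_nonneg]
    · refine Finset.sum_congr rfl fun j _ => ?_
      split_ifs <;> simp
    · intro j _
      split_ifs with h
      · exact hsize t j h
      · exact le_rfl
  have hms : ∀ n, MeasurableSet {t : ℝ | controlTime w τ b (n + 1) ≤ (t.toNNReal : ℝ≥0∞)} :=
    fun n => measurableSet_le measurable_const measurable_real_toNNReal.coe_nnreal_ennreal
  have hrhs : ∫⁻ t in Ici (0 : ℝ),
        ENNReal.ofReal (Real.exp (-q * t) * (q * barrierControl w τ b t.toNNReal))
      = ∑' n, ∫⁻ t in Ici (0 : ℝ), ENNReal.ofReal (q * Real.exp (-q * t))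
        * (if controlTime w τ b (n + 1) ≤ (t.toNNReal : ℝ≥0∞)
            then ENNReal.ofReal (controlSize w τ b n) else 0) := by
    rw [← lintegral_tsum fun n => ?_]
    · refine lintegral_congr fun t => ?_
      rw [ENNReal.tsum_mul_left, ← hR, ← ENNReal.ofReal_mul (by positivity)]
      congr 1; ring
    · exact (Measurable.mul (by fun_prop)
        (Measurable.ite (hms n) measurable_const measurable_const)).aemeasurable
  rw [hrhs, controlMeasure, lintegral_sum_measure]
  refine tsum_congr fun n => ?_
  split_ifs with htop
  · simp [htop]
  · set s := (controlTime w τ b (n + 1)).toNNReal with hs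
    have hs' : controlTime w τ b (n + 1) = s := (ENNReal.coe_toNNReal htop).symm
    rw [lintegral_smul_measure, lintegral_dirac, smul_eq_mul, ← setLIntegral_Ici_exp hq,
      ← lintegral_const_mul _ (by fun_prop), ← lintegral_indicator measurableSet_Ici,
      ← lintegral_indicator measurableSet_Ici]
    refine lintegral_congr fun t => ?_
    rw [hs']
    simp only [indicator, mem_Ici, ENNReal.coe_le_coe]
    by_cases ht : (s : ℝ) ≤ t
    · have ht0 : 0 ≤ t := s.coe_nonneg.trans ht
      rw [if_pos ht, if_pos ht0, if_pos (NNReal.le_toNNReal_of_coe_le ht), mul_comm]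
    · rw [if_neg ht]
      by_cases ht0 : 0 ≤ t
      · rw [if_pos ht0, if_neg, mul_zero]
        rwa [Real.le_toNNReal_iff_coe_le ht0]
      · rw [if_neg ht0]

end Pathwise

/-! ### Convex functions of polynomial growth -/

section Convex

variable {f : ℝ → ℝ}

theorem monotone_rightDerivative (hf : ConvexOn ℝ univ f) : Monotone (rightDerivative f) := by
  have h := hf.monotoneOn_rightDeriv
  rw [interior_univ] at h
  exact monotoneOn_univ.mp h

theorem rightDerivative_le_slope (hf : ConvexOn ℝ univ f) {x y : ℝ} (hxy : x < y) :
    rightDerivative f x ≤ slope f x y :=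
  hf.rightDeriv_le_slope_of_mem_interior (by simp) (mem_univ y) hxy

theorem slope_le_rightDerivative (hf : ConvexOn ℝ univ f) {x y : ℝ} (hxy : x < y) :
    slope f x y ≤ rightDerivative f y :=
  (hf.slope_le_leftDeriv_of_mem_interior (mem_univ x) (by simp) hxy).trans
    (hf.leftDeriv_le_rightDeriv_of_mem_interior (by simp))

/-- The left derivative at `x` is at least `f'_+ y` for every `y < x`. Letting `y` tend to `x`,
continuity makes it at least the right derivative, and convexity gives the reverse inequality. -/
theorem hasDerivAt_of_continuousAt_rightDerivative (hf : ConvexOn ℝ univ f) {x : ℝ}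
    (hx : ContinuousAt (rightDerivative f) x) : HasDerivAt f (rightDerivative f x) x := by
  have hr : HasDerivWithinAt f (rightDerivative f x) (Ioi x) x :=
    hf.hasDerivWithinAt_rightDeriv_of_mem_interior (by simp)
  have hl : HasDerivWithinAt f (derivWithin f (Iio x) x) (Iio x) x :=
    hf.hasDerivWithinAt_leftDeriv_of_mem_interior (by simp)
  have e : derivWithin f (Iio x) x = rightDerivative f x := by
    refine le_antisymm (hf.leftDeriv_le_rightDeriv_of_mem_interior (by simp)) ?_
    have ht : Tendsto (rightDerivative f) (𝓝[<] x) (𝓝 (rightDerivative f x)) :=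
      hx.tendsto.mono_left nhdsWithin_le_nhds
    refine le_of_tendsto ht ?_
    filter_upwards [self_mem_nhdsWithin] with y hy
    exact (rightDerivative_le_slope hf hy).trans
      (hf.slope_le_leftDeriv_of_mem_interior (mem_univ y) (by simp) hy)
  rw [e] at hl
  have := hl.Iic_of_Iio.union hr.Ici_of_Ioi
  rwa [Iic_union_Ici, hasDerivWithinAt_univ] at this

/-- `f` has growth of order `N` with constant `K`. -/
def HasPolyGrowth (f : ℝ → ℝ) (K : ℝ) (N : ℕ) : Prop :=
  0 ≤ K ∧ ∀ x, |f x| ≤ K * (1 + |x| ^ N)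

/-- A bound for the slope of a convex function with `HasPolyGrowth f K N` on `[-r, r]`. -/
noncomputable def slopeBound (K : ℝ) (N : ℕ) (r : ℝ) : ℝ := 2 * K * (1 + (r + 1) ^ N)

theorem IsAdmissibleCost.exists_hasPolyGrowth {C q : ℝ} (hf : IsAdmissibleCost f C q) :
    ∃ K N, HasPolyGrowth f K N := by
  obtain ⟨k₁, k₂, N, h⟩ := hf.growth
  refine ⟨|k₁| + |k₂|, N, by positivity, fun x => (h x).trans ?_⟩
  have h1 := le_abs_self k₁
  have h2 : k₂ * |x| ^ N ≤ |k₂| * |x| ^ N := by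
    gcongr; exact le_abs_self _
  have h3 : 0 ≤ |k₁| * |x| ^ N := by positivity
  have h4 := abs_nonneg k₂
  nlinarith

variable {K : ℝ} {N : ℕ}

theorem HasPolyGrowth.slopeBound_nonneg (hg : HasPolyGrowth f K N) {r : ℝ} (hr : 0 ≤ r) :
    0 ≤ slopeBound K N r := by
  have := hg.1
  unfold slopeBound; positivity

theorem HasPolyGrowth.le_of_abs_le (hg : HasPolyGrowth f K N) {x r : ℝ} (hx : |x| ≤ r) :
    |f x| ≤ K * (1 + r ^ N) := by
  have := hg.1
  refine (hg.2 x).trans ?_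
  gcongr

theorem HasPolyGrowth.abs_rightDerivative_le (hg : HasPolyGrowth f K N) (hf : ConvexOn ℝ univ f)
    {x r : ℝ} (hx : |x| ≤ r) : |rightDerivative f x| ≤ slopeBound K N r := by
  -- Slopes over unit steps to both sides enclose the derivative; this is the source of `r + 1` and
  -- of the factor `2` in `slopeBound`.
  have h1 := rightDerivative_le_slope hf (show x < x + 1 by linarith)
  have h2 := slope_le_rightDerivative hf (show x - 1 < x by linarith)
  have a0 := abs_le.mp (hg.le_of_abs_le (show |x| ≤ r + 1 by linarith))
  have a1 := abs_le.mp (hg.le_of_abs_le (show |x + 1| ≤ r + 1 by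
    refine (abs_add_le _ _).trans ?_; rw [abs_one]; linarith))
  have a2 := abs_le.mp (hg.le_of_abs_le (show |x - 1| ≤ r + 1 by
    refine (abs_sub _ _).trans ?_; rw [abs_one]; linarith))
  rw [slope_def_field, add_sub_cancel_left, div_one] at h1
  rw [slope_def_field, sub_sub_cancel, div_one] at h2
  unfold slopeBound
  rw [abs_le]
  constructor <;> linarith

theorem HasPolyGrowth.abs_sub_le (hg : HasPolyGrowth f K N) (hf : ConvexOn ℝ univ f)
    {x y r : ℝ} (hx : |x| ≤ r) (hy : |y| ≤ r) : |f x - f y| ≤ slopeBound K N r * |x - y| := by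
  wlog hxy : x < y generalizing x y
  · rcases (not_lt.mp hxy).eq_or_lt with rfl | h
    · simp
    · rw [abs_sub_comm (f x), abs_sub_comm x]
      exact this hy hx h
  have h1 := rightDerivative_le_slope hf hxy
  have h2 := slope_le_rightDerivative hf hxy
  have b1 := abs_le.mp (hg.abs_rightDerivative_le hf hx)
  have b2 := abs_le.mp (hg.abs_rightDerivative_le hf hy)
  have hs : |slope f x y| ≤ slopeBound K N r := by
    rw [abs_le]; constructor <;> linarith
  have e : f x - f y = slope f x y * (x - y) := by
    have : y - x ≠ 0 := sub_ne_zero.mpr hxy.ne'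
    rw [slope_def_field]; field_simp; ring
  rw [e, abs_mul]
  gcongr

end Convex

/-! ### Differentiation of the cost under the expectation -/

section Core

variable {Ω : Type*} {Y : ℝ≥0 → Ω → ℝ} {T : ℕ → Ω → ℝ≥0} {q : ℝ}

/-- The times before the first control, as a subset of `Ω × ℝ`. -/
def uncontrolledSet (Y : ℝ≥0 → Ω → ℝ) (T : ℕ → Ω → ℝ≥0) (b x : ℝ) : Set (Ω × ℝ) :=
  {a | ∀ k, T (k + 1) a.1 ≤ a.2.toNNReal → b - Y (T (k + 1) a.1) a.1 ≤ x}

/-- The cumulative control as a running maximum, which is measurable. -/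
noncomputable def runningControl (Y : ℝ≥0 → Ω → ℝ) (T : ℕ → Ω → ℝ≥0) (b x : ℝ) (a : Ω × ℝ) : ℝ :=
  (⨆ k : ℕ, if T (k + 1) a.1 ≤ a.2.toNNReal
    then ENNReal.ofReal (b - (x + Y (T (k + 1) a.1) a.1)) else 0).toReal

/-- The outcomes for which the control opportunities are strictly increasing to infinity. -/
structure GoodTimes (T : ℕ → Ω → ℝ≥0) (ω : Ω) : Prop where
  zero : T 0 ω = 0
  strictMono : StrictMono fun k => T k ω
  tendsto : Tendsto (fun k => T k ω) atTop atTop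

theorem GoodTimes.barrierControl_eq {ω : Ω} (hω : GoodTimes T ω) (b x t : ℝ) :
    barrierControl (fun s => x + Y s ω) (fun k => T k ω) b t.toNNReal
      = runningControl Y T b x (ω, t) := by
  have h := ofReal_barrierControl_eq_iSup (w := fun s => x + Y s ω) (b := b) hω.zero hω.strictMono
    hω.tendsto t.toNNReal
  rw [runningControl, ← h, ENNReal.toReal_ofReal
    (barrierControl_nonneg hω.zero hω.strictMono hω.tendsto _)]

theorem GoodTimes.lt_controlTime_iff {ω : Ω} (hω : GoodTimes T ω) (b x t : ℝ) :
    (t.toNNReal : ℝ≥0∞) < controlTime (fun s => x + Y s ω) (fun k => T k ω) b 1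
      ↔ (ω, t) ∈ uncontrolledSet Y T b x := by
  rw [lt_controlTime_one_iff hω.zero hω.strictMono]
  constructor
  · intro h k hk
    have := h (k + 1) (by omega) hk
    linarith
  · intro h k hk hkt
    obtain ⟨j, rfl⟩ := Nat.exists_eq_succ_of_ne_zero (Nat.pos_iff_ne_zero.mp hk)
    have := h j hkt
    simp only [Nat.succ_eq_add_one]
    linarith

theorem runningControl_nonneg (b x : ℝ) (a : Ω × ℝ) : 0 ≤ runningControl Y T b x a :=
  ENNReal.toReal_nonneg

/-- The dependence of the control on the starting point. -/
theorem GoodTimes.runningControl_shift {a : Ω × ℝ} (ha : GoodTimes T a.1) (b : ℝ) :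
    (∀ x, runningControl Y T b x a = 0 ∧ a ∈ uncontrolledSet Y T b x) ∨
    ∃ k, ∀ x, runningControl Y T b x a = max 0 (b - Y (T (k + 1) a.1) a.1 - x) ∧
      (a ∈ uncontrolledSet Y T b x ↔ b - Y (T (k + 1) a.1) a.1 ≤ x) := by
  have h := barrierControl_shift (p := fun s => Y s a.1) ha.zero ha.strictMono ha.tendsto b
    a.2.toNNReal
  simpa only [ha.barrierControl_eq, ha.lt_controlTime_iff] using h

theorem GoodTimes.runningControl_antitone {a : Ω × ℝ} (ha : GoodTimes T a.1) (b : ℝ) :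
    Antitone fun x => runningControl Y T b x a := by
  intro x y hxy
  rcases ha.runningControl_shift (Y := Y) b with h | ⟨k, h⟩
  · simp [(h x).1, (h y).1]
  · simp only [(h x).1, (h y).1]
    gcongr

theorem GoodTimes.abs_runningControl_sub_le {a : Ω × ℝ} (ha : GoodTimes T a.1) (b x y : ℝ) :
    |runningControl Y T b x a - runningControl Y T b y a| ≤ |x - y| := by
  rcases ha.runningControl_shift (Y := Y) b with h | ⟨k, h⟩
  · simp [(h x).1, (h y).1]
  · rw [(h x).1, (h y).1, max_comm 0, max_comm 0]
    refine (abs_max_sub_max_le_abs _ _ _).trans (le_of_eq ?_)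
    rw [abs_sub_comm x]; congr 1; ring

theorem GoodTimes.abs_add_runningControl_sub_le {a : Ω × ℝ} (ha : GoodTimes T a.1) (b x y : ℝ) :
    |(x + runningControl Y T b x a) - (y + runningControl Y T b y a)| ≤ |x - y| := by
  rcases ha.runningControl_shift (Y := Y) b with h | ⟨k, h⟩
  · simp [(h x).1, (h y).1]
  · rw [(h x).1, (h y).1, ← max_add_add_left, ← max_add_add_left]
    simp only [add_zero, add_sub_cancel]
    exact abs_max_sub_max_le_abs _ _ _

/-- The maximum is attained at one observation and is bounded by the sum over all of them, to which
the arrival moments apply. For `N = 0` the bound could fail, as `0 ^ 0 = 1` with no observation yet.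
-/
theorem GoodTimes.runningControl_pow_le {a : Ω × ℝ} (ha : GoodTimes T a.1) (b x : ℝ) {N : ℕ}
    (hN : N ≠ 0) : ENNReal.ofReal (runningControl Y T b x a ^ N) ≤
      ∑' k, if T (k + 1) a.1 ≤ a.2.toNNReal
        then ENNReal.ofReal (2 ^ N * (|b - x| ^ N + |Y (T (k + 1) a.1) a.1| ^ N)) else 0 := by
  have hc := barrierControl_cases (w := fun s => x + Y s a.1) (b := b) ha.zero ha.strictMono
    ha.tendsto a.2.toNNReal
  rw [ha.barrierControl_eq] at hc
  rcases hc with ⟨h, _⟩ | ⟨k, hk, hkt, _, h2, _⟩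
  · rw [h, zero_pow hN]; simp
  · obtain ⟨j, rfl⟩ := Nat.exists_eq_succ_of_ne_zero (Nat.pos_iff_ne_zero.mp hk)
    refine le_trans ?_ (ENNReal.le_tsum j)
    rw [if_pos hkt]
    apply ENNReal.ofReal_le_ofReal
    set y := Y (T (j + 1) a.1) a.1 with hy
    have h3 : runningControl Y T b x a ≤ |b - x| + |y| := by
      rw [h2]
      have h4 := le_abs_self (b - x)
      have h5 := neg_abs_le y
      change b - (x + y) ≤ _
      linarith
    calc runningControl Y T b x a ^ N ≤ (|b - x| + |y|) ^ N :=
          pow_le_pow_left₀ (runningControl_nonneg _ _ _) h3 N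
      _ ≤ 2 ^ (N - 1) * (|b - x| ^ N + |y| ^ N) := add_pow_le (abs_nonneg _) (abs_nonneg _) N
      _ ≤ 2 ^ N * (|b - x| ^ N + |y| ^ N) := by
          gcongr
          · norm_num
          · omega

/-- The size of the controlled process, up to bounded changes of the starting point. -/
noncomputable def pathSize (Y : ℝ≥0 → Ω → ℝ) (T : ℕ → Ω → ℝ≥0) (b x c : ℝ) (a : Ω × ℝ) : ℝ :=
  c + |Y a.2.toNNReal a.1| + runningControl Y T b x a

variable [MeasurableSpace Ω] {P : Measure Ω}

/-- The discounted-time reference measure on `Ω × [0, ∞)`. -/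
noncomputable def timeProd (P : Measure Ω) : Measure (Ω × ℝ) := P.prod (volume.restrict (Ici 0))

theorem IsRegularPair.measurable_arrival (h : IsRegularPair P Y T q) (k : ℕ) :
    Measurable fun ω => Y (T k ω) ω :=
  h.measurable.comp ((h.measurable_time k).prodMk measurable_id)

theorem IsRegularPair.measurable_space_time (h : IsRegularPair P Y T q) :
    Measurable fun a : Ω × ℝ => Y a.2.toNNReal a.1 :=
  h.measurable.comp ((measurable_real_toNNReal.comp measurable_snd).prodMk measurable_fst)

theorem IsRegularPair.measurableSet_arrival_le (h : IsRegularPair P Y T q) (k : ℕ) :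
    MeasurableSet {a : Ω × ℝ | T k a.1 ≤ a.2.toNNReal} :=
  measurableSet_le ((h.measurable_time k).comp measurable_fst)
    (measurable_real_toNNReal.comp measurable_snd)

theorem IsRegularPair.measurable_runningControl (h : IsRegularPair P Y T q) (b x : ℝ) :
    Measurable (runningControl Y T b x) := by
  unfold runningControl
  refine (Measurable.iSup fun k => ?_).ennreal_toReal
  refine Measurable.ite (h.measurableSet_arrival_le (k + 1)) ?_ measurable_const
  have := (h.measurable_arrival (k + 1)).comp (measurable_fst : Measurable (Prod.fst : Ω × ℝ → Ω))
  exact (measurable_const.sub (measurable_const.add this)).ennreal_ofReal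

theorem IsRegularPair.measurableSet_uncontrolledSet (h : IsRegularPair P Y T q) (b x : ℝ) :
    MeasurableSet (uncontrolledSet Y T b x) := by
  have e : uncontrolledSet Y T b x = ⋂ k, ({a : Ω × ℝ | T (k + 1) a.1 ≤ a.2.toNNReal}ᶜ
      ∪ {a | b - Y (T (k + 1) a.1) a.1 ≤ x}) := by
    ext a
    simp only [uncontrolledSet, mem_ofPred_eq, mem_iInter, mem_union, mem_compl_iff]
    exact forall_congr' fun k => imp_iff_not_or
  rw [e]
  refine MeasurableSet.iInter fun k => (h.measurableSet_arrival_le (k + 1)).compl.union ?_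
  have := (h.measurable_arrival (k + 1)).comp (measurable_fst : Measurable (Prod.fst : Ω × ℝ → Ω))
  exact measurableSet_le (measurable_const.sub this) measurable_const

theorem IsRegularPair.goodTimes (h : IsRegularPair P Y T q) : ∀ᵐ ω ∂P, GoodTimes T ω := by
  filter_upwards [h.zero, h.strictMono, h.tendsto_atTop] with ω h1 h2 h3
  exact ⟨h1, h2, h3⟩

theorem IsRegularPair.measurable_arrival_term (h : IsRegularPair P Y T q) (k N : ℕ) :
    Measurable fun ω => ENNReal.ofReal (Real.exp (-q * T k ω) * |Y (T k ω) ω| ^ N) := by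
  have h1 : Measurable fun p : ℝ × ℝ => ENNReal.ofReal (Real.exp (-q * p.1) * |p.2| ^ N) := by
    fun_prop
  exact h1.comp ((h.measurable_time k).coe_nnreal_real.prodMk (h.measurable_arrival k))

theorem IsRegularPair.measurable_space_time_term (h : IsRegularPair P Y T q) (N : ℕ) :
    Measurable fun a : Ω × ℝ => Real.exp (-q * a.2) * |Y a.2.toNNReal a.1| ^ N := by
  have h1 : Measurable fun p : ℝ × ℝ => Real.exp (-q * p.1) * |p.2| ^ N := by fun_prop
  exact h1.comp (measurable_snd.prodMk h.measurable_space_time)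

theorem IsRegularPair.measurable_pathSize (h : IsRegularPair P Y T q) (b x c : ℝ) :
    Measurable (pathSize Y T b x c) :=
  (measurable_const.add h.measurable_space_time.norm).add (h.measurable_runningControl b x)

theorem IsRegularPair.goodTimes_timeProd (h : IsRegularPair P Y T q) :
    ∀ᵐ a ∂(timeProd P), GoodTimes T a.1 :=
  Measure.quasiMeasurePreserving_fst.ae h.goodTimes

theorem IsRegularPair.integrable_abs_pow (h : IsRegularPair P Y T q) (N : ℕ) :
    Integrable (fun a : Ω × ℝ => Real.exp (-q * a.2) * |Y a.2.toNNReal a.1| ^ N) (timeProd P) := by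
  have hm := h.measurable_space_time_term N
  refine ⟨hm.aestronglyMeasurable, ?_⟩
  rw [hasFiniteIntegral_iff_ofReal (ae_of_all _ fun a => by positivity), timeProd,
    lintegral_prod _ hm.ennreal_ofReal.aemeasurable]
  exact h.moment N

theorem setLIntegral_exp_arrival {q : ℝ} (hq : 0 < q) (s : ℝ≥0) (c : ℝ≥0∞) :
    ∫⁻ t in Ici (0 : ℝ), ENNReal.ofReal (Real.exp (-q * t)) * (if s ≤ t.toNNReal then c else 0)
      = ENNReal.ofReal q⁻¹ * (ENNReal.ofReal (Real.exp (-q * s)) * c) := by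
  rw [← setLIntegral_Ici_exp hq, ← lintegral_mul_const _ (by fun_prop),
    ← lintegral_const_mul _ (by fun_prop),
    ← lintegral_indicator measurableSet_Ici, ← lintegral_indicator measurableSet_Ici]
  refine lintegral_congr fun t => ?_
  simp only [indicator, mem_Ici]
  by_cases ht : (s : ℝ) ≤ t
  · have ht0 : 0 ≤ t := s.coe_nonneg.trans ht
    rw [if_pos ht, if_pos ht0, if_pos (NNReal.le_toNNReal_of_coe_le ht), ← mul_assoc,
      ← ENNReal.ofReal_mul (by positivity)]
    congr 2; field_simp
  · rw [if_neg ht]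
    by_cases ht0 : 0 ≤ t
    · rw [if_pos ht0, if_neg, mul_zero]
      rwa [Real.le_toNNReal_iff_coe_le ht0]
    · rw [if_neg ht0]

/-- Bound the power by the sum over arrivals and integrate in time first: the `k`-th term lives on
`t ≥ T k` and contributes the factor `e^{-q T k} / q`. What remains are arrival moments of orders
`0` and `N`. -/
theorem IsRegularPair.integrable_runningControl_pow (h : IsRegularPair P Y T q) (hq : 0 < q)
    (b x : ℝ) (N : ℕ) :
    Integrable (fun a : Ω × ℝ => Real.exp (-q * a.2) * runningControl Y T b x a ^ N)
      (timeProd P) := by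
  rcases eq_or_ne N 0 with rfl | hN
  · simpa using h.integrable_abs_pow 0
  have hRm := h.measurable_runningControl b x
  refine ⟨by fun_prop, ?_⟩
  have hnn := runningControl_nonneg (Y := Y) (T := T) b x
  rw [hasFiniteIntegral_iff_ofReal (ae_of_all _ fun a => by have := hnn a; positivity)]
  set c : ℕ → Ω → ℝ≥0∞ := fun k ω =>
    ENNReal.ofReal (2 ^ N * (|b - x| ^ N + |Y (T (k + 1) ω) ω| ^ N)) with hc
  have hcm : ∀ k, Measurable (c k) := fun k => by
    have h1 : Measurable fun y : ℝ => ENNReal.ofReal (2 ^ N * (|b - x| ^ N + |y| ^ N)) := by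
      fun_prop
    exact h1.comp (h.measurable_arrival (k + 1))
  have hterm : ∀ k, Measurable fun a : Ω × ℝ => ENNReal.ofReal (Real.exp (-q * a.2))
      * (if T (k + 1) a.1 ≤ a.2.toNNReal then c k a.1 else 0) := fun k =>
    Measurable.mul (by fun_prop) (Measurable.ite (h.measurableSet_arrival_le (k + 1))
      ((hcm k).comp measurable_fst) measurable_const)
  have hmom : ∀ M : ℕ, ∑' k, ∫⁻ ω, ENNReal.ofReal (Real.exp (-q * T (k + 1) ω)
      * |Y (T (k + 1) ω) ω| ^ M) ∂P < ⊤ := fun M => by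
    rw [← lintegral_tsum fun k => ?_]
    · exact h.moment_arrival M
    · exact (h.measurable_arrival_term (k + 1) M).aemeasurable
  calc ∫⁻ a, ENNReal.ofReal (Real.exp (-q * a.2) * runningControl Y T b x a ^ N) ∂(timeProd P)
      ≤ ∫⁻ a, ∑' k, ENNReal.ofReal (Real.exp (-q * a.2))
          * (if T (k + 1) a.1 ≤ a.2.toNNReal then c k a.1 else 0) ∂(timeProd P) := by
        refine lintegral_mono_ae ?_
        filter_upwards [h.goodTimes_timeProd] with a ha
        rw [ENNReal.ofReal_mul (by positivity), ENNReal.tsum_mul_left]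
        gcongr
        exact ha.runningControl_pow_le b x hN
    _ = ∑' k, ∫⁻ ω, ENNReal.ofReal q⁻¹
          * (ENNReal.ofReal (Real.exp (-q * T (k + 1) ω)) * c k ω) ∂P := by
        rw [lintegral_tsum fun k => (hterm k).aemeasurable]
        refine tsum_congr fun k => ?_
        rw [timeProd, lintegral_prod _ (hterm k).aemeasurable]
        exact lintegral_congr fun ω => setLIntegral_exp_arrival hq (T (k + 1) ω) (c k ω)
    _ = ∑' k, ENNReal.ofReal (q⁻¹ * 2 ^ N) * (ENNReal.ofReal (|b - x| ^ N)
            * ∫⁻ ω, ENNReal.ofReal (Real.exp (-q * T (k + 1) ω) * |Y (T (k + 1) ω) ω| ^ 0) ∂P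
          + ∫⁻ ω, ENNReal.ofReal (Real.exp (-q * T (k + 1) ω) * |Y (T (k + 1) ω) ω| ^ N) ∂P) := by
        refine tsum_congr fun k => ?_
        have h1 := h.measurable_arrival_term (k + 1)
        rw [← lintegral_const_mul _ (h1 0), ← lintegral_add_left ((h1 0).const_mul _),
          ← lintegral_const_mul' _ _ ENNReal.ofReal_ne_top]
        refine lintegral_congr fun ω => ?_
        rw [← ENNReal.ofReal_mul (by positivity), ← ENNReal.ofReal_mul (by positivity),
          ← ENNReal.ofReal_mul (by positivity), ← ENNReal.ofReal_add (by positivity)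
          (by positivity), ← ENNReal.ofReal_mul (by positivity)]
        congr 1; ring
    _ < ⊤ := by
        rw [ENNReal.tsum_mul_left, ENNReal.tsum_add, ENNReal.tsum_mul_left]
        exact ENNReal.mul_lt_top (by simp) (ENNReal.add_lt_top.mpr
          ⟨ENNReal.mul_lt_top (by simp) (hmom 0), hmom N⟩)

theorem IsRegularPair.integrable_pathSize_pow (h : IsRegularPair P Y T q) (hq : 0 < q)
    (b x : ℝ) {c : ℝ} (hc : 0 ≤ c) (N : ℕ) :
    Integrable (fun a : Ω × ℝ => Real.exp (-q * a.2) * pathSize Y T b x c a ^ N) (timeProd P) := by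
  have hY := h.measurable_space_time
  have hR := h.measurable_runningControl b x
  have h0 : Integrable (fun a : Ω × ℝ => Real.exp (-q * a.2)) (timeProd P) := by
    simpa using h.integrable_abs_pow 0
  refine ((h0.mul_const (2 ^ N * (2 ^ N * c ^ N))).add
    (((h.integrable_abs_pow N).const_mul (2 ^ N * 2 ^ N)).add
      ((h.integrable_runningControl_pow hq b x N).const_mul (2 ^ N)))).mono' ?_
      (ae_of_all _ fun a => ?_)
  · have := h.measurable_pathSize b x c
    fun_prop
  · have hRnn := runningControl_nonneg (Y := Y) (T := T) b x a
    have hpow : ∀ u v : ℝ, 0 ≤ u → 0 ≤ v → (u + v) ^ N ≤ 2 ^ N * (u ^ N + v ^ N) :=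
      fun u v hu hv => (add_pow_le hu hv N).trans (by
        gcongr
        · norm_num
        · omega)
    have h1 := hpow (c + |Y a.2.toNNReal a.1|) (runningControl Y T b x a) (by positivity) hRnn
    have h2 := hpow c |Y a.2.toNNReal a.1| hc (abs_nonneg _)
    have h3 : pathSize Y T b x c a ^ N ≤ 2 ^ N * (2 ^ N * (c ^ N + |Y a.2.toNNReal a.1| ^ N)
        + runningControl Y T b x a ^ N) := by
      refine h1.trans ?_
      gcongr
    have hnn : 0 ≤ pathSize Y T b x c a := by unfold pathSize; positivity
    rw [Real.norm_of_nonneg (by positivity)]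
    calc Real.exp (-q * a.2) * pathSize Y T b x c a ^ N ≤ Real.exp (-q * a.2)
          * (2 ^ N * (2 ^ N * (c ^ N + |Y a.2.toNNReal a.1| ^ N)
          + runningControl Y T b x a ^ N)) := by gcongr
      _ = _ := by simp only [Pi.add_apply]; ring

end Core

/-! ### Pointwise derivative of the integrand in the starting point, and its domination -/

section Derivative

variable {Ω : Type*} {Y : ℝ≥0 → Ω → ℝ} {T : ℕ → Ω → ℝ≥0} {f : ℝ → ℝ} {C q b : ℝ} {K : ℝ} {N : ℕ}

/-- The discounted running cost, with the control cost integrated by parts. -/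
noncomputable def costDensity (Y : ℝ≥0 → Ω → ℝ) (T : ℕ → Ω → ℝ≥0) (f : ℝ → ℝ) (C q b x : ℝ)
    (a : Ω × ℝ) : ℝ :=
  Real.exp (-q * a.2) * (f (x + Y a.2.toNNReal a.1 + runningControl Y T b x a)
    + C * (q * runningControl Y T b x a))

/-- The part of the derivative of the cost that comes from the times before the first control. -/
noncomputable def slopeDensity (Y : ℝ≥0 → Ω → ℝ) (T : ℕ → Ω → ℝ≥0) (f : ℝ → ℝ) (q b x : ℝ) :
    Ω × ℝ → ℝ :=
  indicator (uncontrolledSet Y T b x)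
    fun a => Real.exp (-q * a.2) * rightDerivative f (x + Y a.2.toNNReal a.1)

/-- The part of the derivative of the cost that comes from the times after the first control. -/
noncomputable def discountDensity (Y : ℝ≥0 → Ω → ℝ) (T : ℕ → Ω → ℝ≥0) (q b x : ℝ) : Ω × ℝ → ℝ :=
  indicator (uncontrolledSet Y T b x)ᶜ fun a => q * Real.exp (-q * a.2)

/-- Off the kink of `max 0 (z - x)`, which `hne` excludes, one of two regimes holds near `x`. Either
there is no control yet and only `f` moves with `x`, or the controlled value is fixed and only the
control moves, with slope `-1`. -/
theorem GoodTimes.hasDerivAt_costDensity {a : Ω × ℝ} (ha : GoodTimes T a.1)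
    (hf : ConvexOn ℝ univ f) {x : ℝ}
    (hx : ContinuousAt (rightDerivative f) (x + Y a.2.toNNReal a.1))
    (hne : ∀ k, b - Y (T (k + 1) a.1) a.1 ≠ x) :
    HasDerivAt (fun x => costDensity Y T f C q b x a)
      (slopeDensity Y T f q b x a - C * discountDensity Y T q b x a) x := by
  have hfd := hasDerivAt_of_continuousAt_rightDerivative hf hx
  have hfx : HasDerivAt (fun x => Real.exp (-q * a.2) * f (x + Y a.2.toNNReal a.1))
      (Real.exp (-q * a.2) * rightDerivative f (x + Y a.2.toNNReal a.1)) x := by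
    have h1 : HasDerivAt (fun x => x + Y a.2.toNNReal a.1) 1 x := (hasDerivAt_id x).add_const _
    have := (HasDerivAt.comp x hfd h1).const_mul (Real.exp (-q * a.2))
    simpa using this
  unfold slopeDensity discountDensity
  rcases ha.runningControl_shift (Y := Y) b with h | ⟨k, h⟩
  · rw [indicator_of_mem (h x).2, indicator_of_notMem (by simpa using (h x).2), mul_zero, sub_zero]
    refine hfx.congr_of_eventuallyEq (Eventually.of_forall fun y => ?_)
    simp [costDensity, (h y).1]
  · rcases lt_or_gt_of_ne (hne k) with hlt | hgt
    · have hmem : a ∈ uncontrolledSet Y T b x := (h x).2.mpr hlt.le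
      rw [indicator_of_mem hmem, indicator_of_notMem (by simpa using hmem), mul_zero, sub_zero]
      refine hfx.congr_of_eventuallyEq ?_
      filter_upwards [lt_mem_nhds hlt] with y hy
      have : runningControl Y T b y a = 0 := by
        rw [(h y).1]; exact max_eq_left (by linarith)
      simp [costDensity, this]
    · have hmem : a ∉ uncontrolledSet Y T b x := fun hm => absurd ((h x).2.mp hm) (not_le.mpr hgt)
      rw [indicator_of_notMem hmem, indicator_of_mem (by simpa using hmem)]
      set z := b - Y (T (k + 1) a.1) a.1 with hz
      have h1 : HasDerivAt (fun y => Real.exp (-q * a.2) * (f (z + Y a.2.toNNReal a.1)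
          + C * (q * (z - y)))) (Real.exp (-q * a.2) * (C * (q * (-1)))) x :=
        (((((hasDerivAt_id x).const_sub z).const_mul q).const_mul C).const_add _).const_mul _
      refine (h1.congr_of_eventuallyEq ?_).congr_deriv (by ring)
      filter_upwards [gt_mem_nhds hgt] with y hy
      have : runningControl Y T b y a = z - y := by
        rw [(h y).1]; exact max_eq_right (by linarith)
      rw [costDensity, this]
      congr 3; ring

/-- Away from the kink, whether `t` precedes the first control does not change for starting points
near `x`. -/
theorem GoodTimes.continuousAt_slopeDensity {a : Ω × ℝ} (ha : GoodTimes T a.1) {x : ℝ}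
    (hx : ContinuousAt (rightDerivative f) (x + Y a.2.toNNReal a.1))
    (hne : ∀ k, b - Y (T (k + 1) a.1) a.1 ≠ x) :
    ContinuousAt (fun x => slopeDensity Y T f q b x a - C * discountDensity Y T q b x a) x := by
  have hmem : ∀ᶠ y in 𝓝 x, (a ∈ uncontrolledSet Y T b y ↔ a ∈ uncontrolledSet Y T b x) := by
    rcases ha.runningControl_shift (Y := Y) b with h | ⟨k, h⟩
    · exact Eventually.of_forall fun y => by simp [(h y).2, (h x).2]
    · rcases lt_or_gt_of_ne (hne k) with hlt | hgt
      · filter_upwards [lt_mem_nhds hlt] with y hy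
        rw [(h y).2, (h x).2]
        exact ⟨fun _ => hlt.le, fun _ => hy.le⟩
      · filter_upwards [gt_mem_nhds hgt] with y hy
        rw [(h y).2, (h x).2]
        exact ⟨fun h' => absurd h' (not_le.mpr hy), fun h' => absurd h' (not_le.mpr hgt)⟩
  unfold slopeDensity discountDensity
  by_cases hm : a ∈ uncontrolledSet Y T b x
  · have h1 : ContinuousAt (fun y => Real.exp (-q * a.2)
        * rightDerivative f (y + Y a.2.toNNReal a.1)) x :=
      continuousAt_const.mul (ContinuousAt.comp (f := fun y => y + Y a.2.toNNReal a.1) hx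
        (by fun_prop))
    refine h1.congr ?_
    filter_upwards [hmem] with y hy
    have hy' := hy.mpr hm
    rw [indicator_of_mem hy', indicator_of_notMem (by simpa using hy'), mul_zero, sub_zero]
  · refine (continuousAt_const (y := 0 - C * (q * Real.exp (-q * a.2)))).congr ?_
    filter_upwards [hmem] with y hy
    have hy' := fun h => hm (hy.mp h)
    rw [indicator_of_notMem hy', indicator_of_mem (by simpa using hy')]

/-- The bound of the slopes of `costDensity` for starting points with `|y - x| ≤ 1`. -/
noncomputable def densityBound (Y : ℝ≥0 → Ω → ℝ) (T : ℕ → Ω → ℝ≥0) (K : ℝ) (N : ℕ) (C q b x : ℝ)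
    (a : Ω × ℝ) : ℝ :=
  Real.exp (-q * a.2) * (slopeBound K N (pathSize Y T b (x - 1) (|x| + 1) a) + |C| * q)

theorem abs_add_le_pathSize {x y : ℝ} (hy : |y - x| ≤ 1) (a : Ω × ℝ) :
    |y + Y a.2.toNNReal a.1| ≤ pathSize Y T b (x - 1) (|x| + 1) a := by
  have h1 := runningControl_nonneg (Y := Y) (T := T) b (x - 1) a
  have h2 := abs_add_le y (Y a.2.toNNReal a.1)
  have h3 := abs_add_le (y - x) x
  rw [sub_add_cancel] at h3
  unfold pathSize
  linarith

/-- The control decreases in the starting point, so its value at `x - 1` dominates it for all `y`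
within distance `1` of `x`. -/
theorem GoodTimes.abs_add_runningControl_le {a : Ω × ℝ} (ha : GoodTimes T a.1) {x y : ℝ}
    (hy : |y - x| ≤ 1) :
    |y + Y a.2.toNNReal a.1 + runningControl Y T b y a|
      ≤ pathSize Y T b (x - 1) (|x| + 1) a := by
  have h1 := runningControl_nonneg (Y := Y) (T := T) b y a
  have h2 := abs_add_three y (Y a.2.toNNReal a.1) (runningControl Y T b y a)
  have h3 := abs_add_le (y - x) x
  rw [sub_add_cancel] at h3
  have h4 := ha.runningControl_antitone (Y := Y) b (show x - 1 ≤ y by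
    have := (abs_le.mp hy).1; linarith)
  simp only at h4
  rw [abs_of_nonneg h1] at h2
  unfold pathSize
  linarith

theorem pathSize_nonneg (x : ℝ) {c : ℝ} (hc : 0 ≤ c) (a : Ω × ℝ) : 0 ≤ pathSize Y T b x c a := by
  have h1 := runningControl_nonneg (Y := Y) (T := T) b x a
  unfold pathSize
  positivity

/-- Both the controlled value and the control are `1`-Lipschitz in the starting point, and `f` is
Lipschitz on the interval that `pathSize` determines. -/
theorem GoodTimes.abs_costDensity_sub_le {a : Ω × ℝ} (ha : GoodTimes T a.1)
    (hf : ConvexOn ℝ univ f) (hg : HasPolyGrowth f K N) (hq : 0 < q) {x y z : ℝ}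
    (hy : |y - x| ≤ 1) (hz : |z - x| ≤ 1) :
    |costDensity Y T f C q b y a - costDensity Y T f C q b z a|
      ≤ densityBound Y T K N C q b x a * |y - z| := by
  have h1 := hg.abs_sub_le hf (ha.abs_add_runningControl_le (Y := Y) (b := b) hy)
    (ha.abs_add_runningControl_le (Y := Y) (b := b) hz)
  have h2 := ha.abs_add_runningControl_sub_le (Y := Y) b y z
  have h3 := ha.abs_runningControl_sub_le (Y := Y) b y z
  have hB := hg.slopeBound_nonneg (pathSize_nonneg (Y := Y) (T := T) (b := b) (x - 1)
    (show 0 ≤ |x| + 1 by positivity) a)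
  unfold costDensity densityBound
  set B := slopeBound K N (pathSize Y T b (x - 1) (|x| + 1) a)
  have h4 : |(y + Y a.2.toNNReal a.1 + runningControl Y T b y a)
      - (z + Y a.2.toNNReal a.1 + runningControl Y T b z a)| ≤ |y - z| := by
    refine le_trans (le_of_eq ?_) h2
    congr 1; ring
  rw [← mul_sub, abs_mul, abs_of_pos (Real.exp_pos _), mul_assoc]
  gcongr
  have e2 : f (y + Y a.2.toNNReal a.1 + runningControl Y T b y a)
        + C * (q * runningControl Y T b y a)
        - (f (z + Y a.2.toNNReal a.1 + runningControl Y T b z a)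
        + C * (q * runningControl Y T b z a))
      = (f (y + Y a.2.toNNReal a.1 + runningControl Y T b y a)
        - f (z + Y a.2.toNNReal a.1 + runningControl Y T b z a))
        + C * q * (runningControl Y T b y a - runningControl Y T b z a) := by ring
  rw [e2, add_mul]
  refine (abs_add_le _ _).trans (add_le_add (h1.trans ?_) ?_)
  · gcongr
  · rw [abs_mul, abs_mul, abs_of_pos hq]
    gcongr

theorem abs_slopeDensity_sub_le {a : Ω × ℝ}
    (hf : ConvexOn ℝ univ f) (hg : HasPolyGrowth f K N) (hq : 0 < q) {x y : ℝ}
    (hy : |y - x| ≤ 1) :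
    |slopeDensity Y T f q b y a - C * discountDensity Y T q b y a|
      ≤ densityBound Y T K N C q b x a := by
  have h1 := hg.abs_rightDerivative_le hf (abs_add_le_pathSize (Y := Y) (T := T) (b := b) hy a)
  have hB := hg.slopeBound_nonneg (pathSize_nonneg (Y := Y) (T := T) (b := b) (x - 1)
    (show 0 ≤ |x| + 1 by positivity) a)
  unfold slopeDensity discountDensity densityBound
  have hE := Real.exp_pos (-q * a.2)
  have hC := abs_nonneg C
  by_cases hm : a ∈ uncontrolledSet Y T b y
  · rw [indicator_of_mem hm, indicator_of_notMem (by simpa using hm), mul_zero, sub_zero, abs_mul,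
      abs_of_pos hE]
    gcongr
    have : 0 ≤ |C| * q := by positivity
    linarith
  · rw [indicator_of_notMem hm, indicator_of_mem (by simpa using hm), zero_sub, abs_neg, abs_mul,
      abs_mul, abs_of_pos hE, abs_of_pos hq]
    have : 0 ≤ Real.exp (-q * a.2) * slopeBound K N (pathSize Y T b (x - 1) (|x| + 1) a) := by
      positivity
    linarith

variable [MeasurableSpace Ω] {P : Measure Ω}

theorem IsRegularPair.integrable_densityBound (h : IsRegularPair P Y T q) (hq : 0 < q) (x : ℝ) :
    Integrable (densityBound Y T K N C q b x) (timeProd P) := by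
  have h0 : Integrable (fun a : Ω × ℝ => Real.exp (-q * a.2)) (timeProd P) := by
    simpa using h.integrable_abs_pow 0
  have h1 := h.integrable_pathSize_pow hq b (x - 1) (c := |x| + 1 + 1) (by positivity) N
  refine ((h0.mul_const (2 * K + |C| * q)).add (h1.const_mul (2 * K))).congr
    (ae_of_all _ fun a => ?_)
  -- The shift `r + 1` in `slopeBound` is absorbed into the constant of `pathSize`.
  have e : pathSize Y T b (x - 1) (|x| + 1) a + 1 = pathSize Y T b (x - 1) (|x| + 1 + 1) a := by
    unfold pathSize; ring
  simp only [Pi.add_apply, densityBound, slopeBound, e]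
  ring

theorem IsRegularPair.measurable_cost (h : IsRegularPair P Y T q) (hf : Measurable f) (b x : ℝ) :
    Measurable fun a : Ω × ℝ => f (x + Y a.2.toNNReal a.1 + runningControl Y T b x a) :=
  hf.comp ((measurable_const.add h.measurable_space_time).add (h.measurable_runningControl b x))

theorem IsRegularPair.integrable_cost (h : IsRegularPair P Y T q) (hq : 0 < q) (hf : Measurable f)
    (hg : HasPolyGrowth f K N) (b x : ℝ) :
    Integrable (fun a : Ω × ℝ => Real.exp (-q * a.2)
      * f (x + Y a.2.toNNReal a.1 + runningControl Y T b x a)) (timeProd P) := by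
  have h0 : Integrable (fun a : Ω × ℝ => Real.exp (-q * a.2)) (timeProd P) := by
    simpa using h.integrable_abs_pow 0
  have h1 := h.integrable_pathSize_pow hq b (x - 1) (c := |x| + 1) (by positivity) N
  have hm := h.measurable_cost hf b x
  refine ((h0.const_mul K).add (h1.const_mul K)).mono'
    (Measurable.mul (by fun_prop) hm).aestronglyMeasurable ?_
  filter_upwards [h.goodTimes_timeProd] with a ha
  have h2 := hg.le_of_abs_le (ha.abs_add_runningControl_le (Y := Y) (b := b) (x := x) (y := x)
    (by simp))
  rw [norm_mul, Real.norm_of_nonneg (Real.exp_pos _).le, Real.norm_eq_abs]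
  calc _ ≤ Real.exp (-q * a.2) * (K * (1 + pathSize Y T b (x - 1) (|x| + 1) a ^ N)) := by gcongr
    _ = _ := by simp only [Pi.add_apply]; ring

theorem IsRegularPair.integrable_control (h : IsRegularPair P Y T q) (hq : 0 < q) (b x : ℝ) :
    Integrable (fun a : Ω × ℝ => Real.exp (-q * a.2) * (q * runningControl Y T b x a))
      (timeProd P) := by
  refine ((h.integrable_runningControl_pow hq b x 1).const_mul q).congr (ae_of_all _ fun a => ?_)
  simp only [pow_one]; ring

theorem IsRegularPair.integrable_costDensity (h : IsRegularPair P Y T q) (hq : 0 < q)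
    (hf : Measurable f) (hg : HasPolyGrowth f K N) (C b x : ℝ) :
    Integrable (costDensity Y T f C q b x) (timeProd P) := by
  refine ((h.integrable_cost hq hf hg b x).add ((h.integrable_control hq b x).const_mul C)).congr
    (ae_of_all _ fun a => ?_)
  simp only [Pi.add_apply, costDensity]; ring

theorem IsRegularPair.measurable_slopeDensity (h : IsRegularPair P Y T q)
    (hf : ConvexOn ℝ univ f) (b x : ℝ) : Measurable (slopeDensity Y T f q b x) := by
  refine Measurable.indicator ?_ (h.measurableSet_uncontrolledSet b x)
  have h1 := (monotone_rightDerivative hf).measurable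
  have h2 := h1.comp (measurable_const (a := x) |>.add h.measurable_space_time)
  exact Measurable.mul (by fun_prop) h2

theorem IsRegularPair.measurable_discountDensity (h : IsRegularPair P Y T q) (b x : ℝ) :
    Measurable (discountDensity Y T q b x) :=
  Measurable.indicator (by fun_prop) (h.measurableSet_uncontrolledSet b x).compl

theorem IsRegularPair.integrable_slopeDensity (h : IsRegularPair P Y T q) (hq : 0 < q)
    (hf : ConvexOn ℝ univ f) (hg : HasPolyGrowth f K N) (b x : ℝ) :
    Integrable (slopeDensity Y T f q b x) (timeProd P) := by
  -- With `C = 0` the bound for the difference is a bound for `slopeDensity` alone.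
  refine (h.integrable_densityBound (K := K) (N := N) (C := 0) (b := b) hq x).mono'
    (h.measurable_slopeDensity hf b x).aestronglyMeasurable (ae_of_all _ fun a => ?_)
  have := abs_slopeDensity_sub_le (Y := Y) (T := T) (b := b) (C := 0) (a := a) (x := x)
    (y := x) hf hg hq (by simp)
  simpa using this

theorem IsRegularPair.integrable_discountDensity (h : IsRegularPair P Y T q) (b x : ℝ) :
    Integrable (discountDensity Y T q b x) (timeProd P) := by
  have h0 : Integrable (fun a : Ω × ℝ => Real.exp (-q * a.2)) (timeProd P) := by
    simpa using h.integrable_abs_pow 0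
  exact (h0.const_mul q).indicator (h.measurableSet_uncontrolledSet b x).compl

/-- For almost every outcome and time, the integrand is differentiable at the starting point `x`. -/
theorem IsRegularPair.ae_generic [IsProbabilityMeasure P] (h : IsRegularPair P Y T q)
    (hf : ConvexOn ℝ univ f) (b x : ℝ) :
    ∀ᵐ a ∂(timeProd P), GoodTimes T a.1 ∧
      ContinuousAt (rightDerivative f) (x + Y a.2.toNNReal a.1) ∧
      ∀ k, b - Y (T (k + 1) a.1) a.1 ≠ x := by
  -- A monotone function has only countably many discontinuities, and each is met with probability
  -- zero.
  have hD := (monotone_rightDerivative hf).countable_not_continuousAt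
  have h1 : ∀ᵐ a ∂(timeProd P), ∀ d ∈ {d | ¬ ContinuousAt (rightDerivative f) d},
      Y a.2.toNNReal a.1 ≠ d - x := (ae_ball_iff hD).mpr fun d _ => h.ne (d - x)
  have h2 : ∀ᵐ a ∂(timeProd P), ∀ k, Y (T (k + 1) a.1) a.1 ≠ b - x :=
    Measure.quasiMeasurePreserving_fst.ae (h.ne_arrival (b - x))
  filter_upwards [h.goodTimes_timeProd, h1, h2] with a ha h3 h4
  refine ⟨ha, ?_, fun k hk => h4 k (by linarith)⟩
  by_contra hcon
  exact h3 _ hcon (by ring)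

theorem IsRegularPair.hasDerivAt_integral_costDensity [IsProbabilityMeasure P]
    (h : IsRegularPair P Y T q) (hq : 0 < q) (hf : ConvexOn ℝ univ f) (hfm : Measurable f)
    (hg : HasPolyGrowth f K N) (C b x : ℝ) :
    HasDerivAt (fun x => ∫ a, costDensity Y T f C q b x a ∂(timeProd P))
      (∫ a, (slopeDensity Y T f q b x a - C * discountDensity Y T q b x a) ∂(timeProd P)) x := by
  refine (hasDerivAt_integral_of_dominated_loc_of_lip (F := costDensity Y T f C q b)
    (bound := densityBound Y T K N C q b x) (s := Metric.ball x 1) (Metric.ball_mem_nhds x one_pos)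
    (Eventually.of_forall fun y =>
      (h.integrable_costDensity hq hfm hg C b y).aestronglyMeasurable)
    (h.integrable_costDensity hq hfm hg C b x) ?_ ?_
    (h.integrable_densityBound hq x) ?_).2
  · exact ((h.measurable_slopeDensity hf b x).sub
      ((h.measurable_discountDensity b x).const_mul C)).aestronglyMeasurable
  · filter_upwards [h.goodTimes_timeProd] with a ha
    have hnn : 0 ≤ densityBound Y T K N C q b x a :=
      (abs_nonneg _).trans (abs_slopeDensity_sub_le (y := x) hf hg hq (by simp))
    refine LipschitzOnWith.of_dist_le_mul fun y hy z hz => ?_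
    have hy' : |y - x| ≤ 1 := (Metric.mem_ball.mp hy).le
    have hz' : |z - x| ≤ 1 := (Metric.mem_ball.mp hz).le
    rw [Real.dist_eq, Real.dist_eq, Real.coe_nnabs, abs_of_nonneg hnn]
    exact ha.abs_costDensity_sub_le hf hg hq hy' hz'
  · filter_upwards [h.ae_generic hf b x] with a ha
    exact ha.1.hasDerivAt_costDensity hf ha.2.1 ha.2.2

theorem IsRegularPair.continuous_integral_slopeDensity [IsProbabilityMeasure P]
    (h : IsRegularPair P Y T q) (hq : 0 < q) (hf : ConvexOn ℝ univ f)
    (hg : HasPolyGrowth f K N) (C b : ℝ) :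
    Continuous fun x =>
      ∫ a, (slopeDensity Y T f q b x a - C * discountDensity Y T q b x a) ∂(timeProd P) := by
  rw [continuous_iff_continuousAt]
  intro x
  refine continuousAt_of_dominated (bound := densityBound Y T K N C q b x)
    (Eventually.of_forall fun y => ((h.measurable_slopeDensity hf b y).sub
      ((h.measurable_discountDensity b y).const_mul C)).aestronglyMeasurable) ?_
    (h.integrable_densityBound hq x) ?_
  · filter_upwards [Metric.ball_mem_nhds x one_pos] with y hy
    exact ae_of_all _ fun a => abs_slopeDensity_sub_le hf hg hq (Metric.mem_ball.mp hy).le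
  · filter_upwards [h.ae_generic hf b x] with a ha
    exact ha.1.continuousAt_slopeDensity ha.2.1 ha.2.2

end Derivative

/-! ### Return from the densities on `Ω × [0, ∞)` to the cost and the first control time -/

section Assembly

variable {Ω : Type*} {Y : ℝ≥0 → Ω → ℝ} {T : ℕ → Ω → ℝ≥0} {f : ℝ → ℝ} {C q b : ℝ} {K : ℝ} {N : ℕ}

theorem GoodTimes.controlledPath_eq {ω : Ω} (hω : GoodTimes T ω) (b x t : ℝ) :
    controlledPath (fun s => x + Y s ω) (fun k => T k ω) b t.toNNReal
      = x + Y t.toNNReal ω + runningControl Y T b x (ω, t) := by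
  rw [controlledPath, hω.barrierControl_eq]

theorem GoodTimes.lintegral_controlMeasure {ω : Ω} (hω : GoodTimes T ω) (hq : 0 < q) (b x : ℝ) :
    ∫⁻ t : ℝ≥0, ENNReal.ofReal (Real.exp (-q * t))
        ∂(controlMeasure (fun s => x + Y s ω) (fun k => T k ω) b)
      = ∫⁻ t in Ici (0 : ℝ),
        ENNReal.ofReal (Real.exp (-q * t) * (q * runningControl Y T b x (ω, t))) := by
  rw [_root_.lintegral_controlMeasure hq hω.zero hω.strictMono hω.tendsto]
  simp only [hω.barrierControl_eq]

theorem GoodTimes.integral_controlMeasure {ω : Ω} (hω : GoodTimes T ω) (hq : 0 < q) (b x : ℝ)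
    (hint : Integrable (fun t => Real.exp (-q * t) * (q * runningControl Y T b x (ω, t)))
      (volume.restrict (Ici 0))) :
    ∫ t : ℝ≥0, Real.exp (-q * t) ∂(controlMeasure (fun s => x + Y s ω) (fun k => T k ω) b)
      = ∫ t in Ici (0 : ℝ), Real.exp (-q * t) * (q * runningControl Y T b x (ω, t)) := by
  have hnn := fun t : ℝ => runningControl_nonneg (Y := Y) (T := T) b x (ω, t)
  rw [integral_eq_lintegral_of_nonneg_ae (ae_of_all _ fun t => by positivity) (by fun_prop),
    hω.lintegral_controlMeasure hq,
    integral_eq_lintegral_of_nonneg_ae (ae_of_all _ fun t => ?_) hint.aestronglyMeasurable]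
  have := hnn t
  simp only [Pi.zero_apply]
  positivity

theorem GoodTimes.mem_timesBefore_iff {ω : Ω} (hω : GoodTimes T ω) (b x : ℝ) {t : ℝ} (ht : 0 ≤ t) :
    t ∈ timesBefore (firstControlTime Y T b x ω) ↔ (ω, t) ∈ uncontrolledSet Y T b x := by
  rw [← hω.lt_controlTime_iff]
  exact and_iff_right ht

theorem timesBefore_subset (S : ℝ≥0∞) : timesBefore S ⊆ Ici 0 := fun _ h => h.1

theorem measurableSet_timesBefore (S : ℝ≥0∞) : MeasurableSet (timesBefore S) :=
  measurableSet_Ici.inter (measurableSet_lt ENNReal.measurable_ofReal measurable_const)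

theorem GoodTimes.setIntegral_slopeDensity {ω : Ω} (hω : GoodTimes T ω) (b x : ℝ) :
    ∫ t in Ici (0 : ℝ), slopeDensity Y T f q b x (ω, t)
      = ∫ t in timesBefore (firstControlTime Y T b x ω),
        Real.exp (-q * t) * rightDerivative f (x + Y t.toNNReal ω) := by
  rw [← integral_indicator measurableSet_Ici, ← integral_indicator (measurableSet_timesBefore _)]
  congr 1 with t
  by_cases ht : t ∈ Ici (0 : ℝ)
  · rw [indicator_of_mem ht, slopeDensity]
    exact indicator_eq_indicator (hω.mem_timesBefore_iff b x ht).symm rfl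
  · rw [indicator_of_notMem ht, indicator_of_notMem fun h => ht (timesBefore_subset _ h)]

/-- For `S = ∞` the domain is empty, in accordance with `e^{-q∞} = 0`. -/
theorem setIntegral_after_eq_discount (hq : 0 < q) (S : ℝ≥0∞) :
    ∫ t in Ici (0 : ℝ), indicator (timesBefore S)ᶜ (fun t => q * Real.exp (-q * t)) t
      = discount q S := by
  rw [setIntegral_indicator (measurableSet_timesBefore S).compl]
  by_cases hS : S = ⊤
  · have : Ici (0 : ℝ) ∩ (timesBefore S)ᶜ = ∅ := by
      ext t
      simp [timesBefore, hS]
    rw [this, discount, if_pos hS]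
    simp
  · have : Ici (0 : ℝ) ∩ (timesBefore S)ᶜ = Ici S.toReal := by
      ext t
      simp only [mem_inter_iff, mem_Ici, mem_compl_iff, timesBefore, mem_ofPred_eq, not_and, not_lt]
      constructor
      · rintro ⟨h0, h⟩
        exact ENNReal.toReal_le_of_le_ofReal h0 (h h0)
      · intro h
        exact ⟨ENNReal.toReal_nonneg.trans h, fun _ => (ENNReal.le_ofReal_iff_toReal_le hS
          (ENNReal.toReal_nonneg.trans h)).mpr h⟩
    rw [this, discount, if_neg hS, integral_Ici_eq_integral_Ioi, integral_const_mul,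
      integral_exp_mul_Ioi (by linarith)]
    field_simp

theorem GoodTimes.setIntegral_discountDensity {ω : Ω} (hω : GoodTimes T ω) (hq : 0 < q)
    (b x : ℝ) : ∫ t in Ici (0 : ℝ), discountDensity Y T q b x (ω, t)
      = discount q (firstControlTime Y T b x ω) := by
  rw [← setIntegral_after_eq_discount hq]
  refine setIntegral_congr_fun measurableSet_Ici fun t ht => ?_
  exact indicator_eq_indicator (not_congr (hω.mem_timesBefore_iff b x ht).symm) rfl

variable [MeasurableSpace Ω] {P : Measure Ω}

theorem IsRegularPair.barrierCost_eq [IsProbabilityMeasure P] (h : IsRegularPair P Y T q)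
    (hq : 0 < q) (hf : Measurable f) (hg : HasPolyGrowth f K N) (C b x : ℝ) :
    barrierCost P Y T f C q b x = ∫ a, costDensity Y T f C q b x a ∂(timeProd P) := by
  have h1 := h.integrable_cost hq hf hg b x
  have h2 := h.integrable_control hq b x
  rw [timeProd, integral_prod _ (h.integrable_costDensity hq hf hg C b x), barrierCost]
  refine integral_congr_ae ?_
  -- Integrability for almost every outcome allows the running and the control cost to be merged
  -- into one time integral.
  filter_upwards [h.goodTimes, h1.prod_right_ae, h2.prod_right_ae] with ω hω i1 i2
  rw [hω.integral_controlMeasure hq b x i2, ← integral_const_mul,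
    ← integral_add (by simpa only [hω.controlledPath_eq] using i1) (i2.const_mul C)]
  refine integral_congr_ae (ae_of_all _ fun t => ?_)
  simp only [hω.controlledPath_eq, costDensity]
  ring

theorem IsRegularPair.absBarrierCost_lt_top (h : IsRegularPair P Y T q)
    (hq : 0 < q) (hf : Measurable f) (hg : HasPolyGrowth f K N) (b x : ℝ) :
    absBarrierCost P Y T f q b x < ⊤ := by
  have h1 := (h.integrable_cost hq hf hg b x).abs
  have h2 := h.integrable_control hq b x
  have hm := h.measurable_cost hf b x
  have hR := h.measurable_runningControl b x
  have m1 : Measurable fun a : Ω × ℝ => ENNReal.ofReal |Real.exp (-q * a.2)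
      * f (x + Y a.2.toNNReal a.1 + runningControl Y T b x a)| :=
    (Measurable.norm (Measurable.mul (by fun_prop) hm)).ennreal_ofReal
  have m2 : Measurable fun a : Ω × ℝ =>
      ENNReal.ofReal (Real.exp (-q * a.2) * (q * runningControl Y T b x a)) := by fun_prop
  have f1 := h1.2
  have f2 := h2.2
  rw [hasFiniteIntegral_iff_ofReal (ae_of_all _ fun a => abs_nonneg _), timeProd,
    lintegral_prod _ m1.aemeasurable] at f1
  rw [hasFiniteIntegral_iff_ofReal (ae_of_all _ fun a => by
    have := runningControl_nonneg (Y := Y) (T := T) b x a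
    simp only [Pi.zero_apply]
    positivity), timeProd, lintegral_prod _ m2.aemeasurable] at f2
  refine lt_of_le_of_lt (le_of_eq ?_) (ENNReal.add_lt_top.mpr ⟨f1, f2⟩)
  rw [← lintegral_add_left (Measurable.lintegral_prod_right' m1), absBarrierCost]
  refine lintegral_congr_ae ?_
  filter_upwards [h.goodTimes] with ω hω
  rw [hω.lintegral_controlMeasure hq]
  congr 1
  refine lintegral_congr fun t => ?_
  rw [hω.controlledPath_eq, abs_mul, Real.abs_exp]

theorem IsRegularPair.lintegral_slope_lt_top (h : IsRegularPair P Y T q) (hq : 0 < q)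
    (hf : ConvexOn ℝ univ f) (hg : HasPolyGrowth f K N) (b x : ℝ) :
    ∫⁻ ω, (∫⁻ t in timesBefore (firstControlTime Y T b x ω),
      ENNReal.ofReal (Real.exp (-q * t) * |rightDerivative f (x + Y t.toNNReal ω)|)) ∂P < ⊤ := by
  have h1 := (h.integrable_slopeDensity hq hf hg b x).abs
  have m1 : Measurable fun a : Ω × ℝ => ENNReal.ofReal |slopeDensity Y T f q b x a| :=
    (h.measurable_slopeDensity hf b x).norm.ennreal_ofReal
  have f1 := h1.2
  rw [hasFiniteIntegral_iff_ofReal (ae_of_all _ fun a => abs_nonneg _), timeProd,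
    lintegral_prod _ m1.aemeasurable] at f1
  refine lt_of_le_of_lt (le_of_eq ?_) f1
  refine lintegral_congr_ae ?_
  filter_upwards [h.goodTimes] with ω hω
  rw [← lintegral_indicator measurableSet_Ici, ← lintegral_indicator (measurableSet_timesBefore _)]
  refine lintegral_congr fun t => ?_
  by_cases ht : t ∈ Ici (0 : ℝ)
  · rw [indicator_of_mem ht]
    by_cases hm : (ω, t) ∈ uncontrolledSet Y T b x
    · rw [slopeDensity, indicator_of_mem hm,
        indicator_of_mem ((hω.mem_timesBefore_iff b x ht).mpr hm), abs_mul, Real.abs_exp]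
    · rw [slopeDensity, indicator_of_notMem hm,
        indicator_of_notMem fun h' => hm ((hω.mem_timesBefore_iff b x ht).mp h')]
      simp
  · rw [indicator_of_notMem ht, indicator_of_notMem fun h => ht (timesBefore_subset _ h)]

theorem IsRegularPair.integral_slope_eq [IsProbabilityMeasure P] (h : IsRegularPair P Y T q)
    (hq : 0 < q) (hf : ConvexOn ℝ univ f) (hg : HasPolyGrowth f K N) (C b x : ℝ) :
    ∫ a, (slopeDensity Y T f q b x a - C * discountDensity Y T q b x a) ∂(timeProd P)
      = (∫ ω, (∫ t in timesBefore (firstControlTime Y T b x ω),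
          Real.exp (-q * t) * rightDerivative f (x + Y t.toNNReal ω)) ∂P)
        - C * ∫ ω, discount q (firstControlTime Y T b x ω) ∂P := by
  have i1 := h.integrable_slopeDensity hq hf hg b x
  have i2 := h.integrable_discountDensity b x
  rw [integral_sub i1 (i2.const_mul C), integral_const_mul]
  congr 1
  · rw [timeProd, integral_prod _ i1]
    refine integral_congr_ae ?_
    filter_upwards [h.goodTimes] with ω hω
    exact hω.setIntegral_slopeDensity b x
  · rw [timeProd, integral_prod _ i2]
    congr 1
    refine integral_congr_ae ?_
    filter_upwards [h.goodTimes] with ω hω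
    exact hω.setIntegral_discountDensity hq b x

end Assembly

theorem proposition3p4 {Ω : Type*} [MeasurableSpace Ω] (P : Measure Ω) [IsProbabilityMeasure P]
    (X : ℝ≥0 → Ω → ℝ) (T : ℕ → Ω → ℝ≥0) (γ σ : ℝ) (ν : Measure ℝ) (η : ℝ) (f : ℝ → ℝ) (C q : ℝ)
    (hq : 0 < q) (hη : 0 < η)
    (hX : IsLevyProcess X P) (hν : HasLevyTriplet X P γ σ ν)
    (hT : IsPoissonArrivals T η P)
    (hXT : IndepFun (fun ω => fun t : ℝ≥0 => X t ω) (fun ω => fun k : ℕ => T k ω) P)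
    (hf : IsAdmissibleCost f C q)
    (hCP : ¬ IsDriftlessCompoundPoisson X P)
    (hexp : ∃ θ : ℝ, 0 < θ ∧
      ∫⁻ z in {z : ℝ | 1 ≤ |z|}, ENNReal.ofReal (Real.exp (θ * |z|)) ∂ν < ⊤)
    (b : ℝ) :
    (∀ x, absBarrierCost P X T f q b x < ⊤) ∧
    (∀ x, ∫⁻ ω, (∫⁻ t in timesBefore (firstControlTime X T b x ω),
        ENNReal.ofReal (Real.exp (-q * t) * |rightDerivative f (x + X t.toNNReal ω)|)) ∂P < ⊤) ∧
    ContDiff ℝ 1 (barrierCost P X T f C q b) ∧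
    ∀ x, HasDerivAt (barrierCost P X T f C q b)
      ((∫ ω, (∫ t in timesBefore (firstControlTime X T b x ω),
          Real.exp (-q * t) * rightDerivative f (x + X t.toNNReal ω)) ∂P)
        - C * ∫ ω, discount q (firstControlTime X T b x ω) ∂P) x := by
  have h := hX.isRegularPair hq hη hν hT hXT hCP hexp
  obtain ⟨K, N, hg⟩ := hf.exists_hasPolyGrowth
  have hc := hf.convex
  have hfm : Measurable f :=
    (continuousOn_univ.mp (hc.continuousOn isOpen_univ)).measurable
  have hfirst : ∀ x, ∀ᵐ ω ∂P, firstControlTime X T b x ω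
      = firstControlTime (jointVersion X) T b x ω := fun x => by
    -- Almost surely the two versions agree at all times simultaneously, so functionals of the whole
    -- path coincide.
    filter_upwards [hX.jointVersion_eq] with ω hω
    simp only [firstControlTime, hω]
  have e1 : ∀ x, absBarrierCost P X T f q b x = absBarrierCost P (jointVersion X) T f q b x :=
    fun x => by
      refine lintegral_congr_ae ?_
      filter_upwards [hX.jointVersion_eq] with ω hω
      simp only [hω]
  have e2 : barrierCost P X T f C q b
      = fun x => ∫ a, costDensity (jointVersion X) T f C q b x a ∂(timeProd P) := by
    funext x
    rw [← h.barrierCost_eq hq hfm hg C b x]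
    refine integral_congr_ae ?_
    filter_upwards [hX.jointVersion_eq] with ω hω
    simp only [hω]
  have hderiv := h.hasDerivAt_integral_costDensity hq hc hfm hg C b
  refine ⟨fun x => ?_, fun x => ?_, ?_, fun x => ?_⟩
  · rw [e1]
    exact h.absBarrierCost_lt_top hq hfm hg b x
  · refine lt_of_le_of_lt (le_of_eq (lintegral_congr_ae ?_))
      (h.lintegral_slope_lt_top hq hc hg b x)
    filter_upwards [hX.jointVersion_eq, hfirst x] with ω hω h1
    simp only [hω, h1]
  · rw [e2, contDiff_one_iff_deriv]
    refine ⟨fun x => (hderiv x).differentiableAt, ?_⟩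
    rw [funext fun x => (hderiv x).deriv]
    exact h.continuous_integral_slopeDensity hq hc hg C b
  · rw [e2]
    refine (hderiv x).congr_deriv ?_
    rw [h.integral_slope_eq hq hc hg C b x]
    congr 1
    · refine integral_congr_ae ?_
      filter_upwards [hX.jointVersion_eq, hfirst x] with ω hω h1
      simp only [hω, h1]
    · congr 1
      refine integral_congr_ae ?_
      filter_upwards [hfirst x] with ω h1
      rw [h1]
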